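/- **Setting.** Write $V_1=W^2-W'$, $V_2=W^2+W'$ for the partner potentials of a superpotential $W(x;a)$. A shape-invariant system is given by $W$, a parameter map $a_{k+1}=f(a_k)$ and a remainder $\mathcal R$ with $V_2(x;a)=V_1(x;f(a))+\mathcal R(a)$. Let $(\Psi_n)_{n\ge0}$ be an orthonormal basis of a complex Hilbert space, $E_n=\sum_{k=1}^n\mathcal R(a_k)$, and let $B_+$ be the raising operator, $B_+\Psi_n=\sqrt{E_{n+1}}\,\Psi_{n+1}$, where moving $B_+$ through a coefficient depending on the parameters replaces each $a_k$ by $a_{k+1}$. For a functional $\mathcal Z_k=\mathcal Z(a_k)$ let $$h_n=\frac{\sqrt{\prod_{k=1}^n\sum_{s=k}^n\mathcal R(a_s)}}{\prod_{k=1}^n\mathcal Z_k},\qquad K_n^m=\frac{\sqrt{\prod_{k=m+1}^{n+m}\sum_{s=k}^{n+m}\mathcal R(a_s)}}{\prod_{k=m+1}^{n+m}\mathcal Z_k\ \sqrt{\prod_{k=1}^{m}\sum_{s=k}^{n+m}\mathcal R(a_s)}},\qquad \mathcal N_m(x)=\Big(\sum_{n\ge0}\frac{x^n}{|K_n^m|^2}\Big)^{-1/2}.$$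 For an integer $m\ge0$ the photon-added coherent state (PA-SIPCS) is $|z\rangle_m=\mathcal N_m(|z|^2)\,B_+^m\sum_n\frac{z^n}{h_n}\Psi_n$. Let $\mathfrak H_m$ be the closed span of the $\Psi_{n+m}$, $n\ge0$. The Meijer function is $$G^{M,N}_{p,q}\Big(x\Big|{a_1,\dots,a_N;a_{N+1},\dots,a_p\atop b_1,\dots,b_M;b_{M+1},\dots,b_q}\Big)=\frac1{2\pi i}\int_L\frac{\prod_{j\le M}\Gamma(b_j+s)\prod_{j\le N}\Gamma(1-a_j-s)}{\prod_{j>M}\Gamma(1-b_j-s)\prod_{j>N}\Gamma(a_j+s)}\,x^{-s}\,ds$$ with the usual contours $L$ separating the poles of the $\Gamma(b_j+s)$, $j\le M$, from those of the $\Gamma(1-a_j-s)$, $j\le N$ (a vertical line, or a loop around one family of poles). **Claim.** In each case (1)-(4) below, let $D$ be the stated domain, $D=\mathbb C$ or $D=\{|z|<1\}$, and let $I=\{|z|^2: 0\ne z\in D\}$. Under the first stated range of parameters, for all $n\ge0$ and $z\in D$: $|K_n^m|^2$ and $\mathcal N_m$ are as given (the series for $\mathcal N_m^{-2}$ converges;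 the formula with $G$ is for $z\ne0$), $|z\rangle_m=\mathcal N_m(|z|^2)\sum_n\frac{z^n}{K_n^m}\Psi_{n+m}$ and $\|\,|z\rangle_m\|=1$. Under the range of parameters stated for the weight, the function $h_m$ has the given absolutely convergent Mellin transform; the real function $g_m$, given for $x>0$ ($x\ne1$ if $D$ is the disc), solves the moment problem $$\int_0^\infty x^{n+m}g_m(x)\,dx=|K_n^m|^2\qquad(n\ge0)$$ with absolutely convergent integrals; and $\omega_m$, defined on $I$ by $g_m(x)=\pi\,\mathcal N_m^2(x)\,x^{-m}\,\omega_m(x)$, is the given product of two Meijer functions, is strictly positive on $I$, and resolves the identity: $$\int_D d^2z\ |z\rangle_m\,\omega_m(|z|^2)\,{}_m\langle z|=\mathbf 1_{\mathfrak H_m}$$ in the weak sense, with absolutely convergent matrix elements between any two vectors of $\mathfrak H_m$. **(1) D-type.** $W=\beta x+\delta$, $a_{k+1}=a_k$, $\mathcal R=2\beta=\gamma>0$, $\mathcal Z=c\in\mathbb C\setminus\{0\}$, $D=\mathbb C$ (same range for the weight). $$|K_n^m|^2=\frac{\gamma^n\,n!\,\Gamma(n+1)}{|c|^{2n}\gamma^m\,\Gamma(n+m+1)},\qquad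 \mathcal N_m^{-2}(|z|^2)=\gamma^m\Gamma(m+1)\,{}_1F_1\big(m+1;1;\tfrac{|cz|^2}{\gamma}\big)=\gamma^m G^{1,1}_{1,2}\Big(-\tfrac{|cz|^2}\gamma\Big|{-m;\atop0;0}\Big),$$ $$h_m(x)=\frac{\gamma^{2m+1}}{|c|^{2(m+1)}}g_m(x)=G^{2,0}_{1,2}\Big(\tfrac{|c|^2}\gamma x\Big|{;0\atop-m,-m;}\Big),\qquad \int_0^\infty x^{s-1}h_m\,dx=\Big(\frac{|c|^2}\gamma\Big)^{-s}\frac{\Gamma(s-m)^2}{\Gamma(s)}\quad(\operatorname{Re}s>m),$$ $$\omega_m(x)=\frac1\pi\frac{|c|^2}\gamma\,G^{1,1}_{1,2}\Big(-\tfrac{|c|^2x}\gamma\Big|{-m;\atop0;0}\Big)\,G^{2,0}_{1,2}\Big(\tfrac{|c|^2}\gamma x\Big|{;m\atop0,0;}\Big).$$ **(2) C-type (SU(1,1)/Perelomov).** $W=\frac{a+\delta}x+\frac\beta2x$ on $x>0$, $a_{k+1}=a_k-1$, $\mathcal R=2\beta=\gamma>0$, $\mathcal Z(a)=\sqrt{1-\gamma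 a}\,e^{-i\alpha\mathcal R(a)}$ with $\alpha\in\mathbb R$, $\rho=a_1-\frac1\gamma<0$, $D=\{|z|<1\}$; for the weight $\rho<-1$. $$|K_n^m|^2=\frac{\Gamma(m-\rho)\Gamma(n+1)^2}{\gamma^m\Gamma(n+m-\rho)\Gamma(n+m+1)},$$ $$\mathcal N_m^{-2}(|z|^2)=\gamma^m\Gamma(m+1)\,{}_2F_1(m-\rho,m+1;1;|z|^2)=\frac{\gamma^m}{\Gamma(m-\rho)}G^{1,2}_{2,2}\Big(-|z|^2\Big|{-m,1-m+\rho;\atop0;0}\Big),$$ $$h_m(x)=\frac{\gamma^m}{\Gamma(m-\rho)}g_m(x)=G^{2,0}_{2,2}\Big(x\Big|{;0,-\rho-1\atop-m,-m;}\Big),\qquad \int_0^\infty x^{s-1}h_m\,dx=\frac{\Gamma(s-m)^2}{\Gamma(s)\Gamma(s-\rho-1)}\quad(\operatorname{Re}s>m),$$ $$\omega_m(x)=\frac1\pi\,G^{1,2}_{2,2}\Big(-x\Big|{-m,1-m+\rho;\atop0;0}\Big)\,G^{2,0}_{2,2}\Big(x\Big|{;m,m-\rho-1\atop0,0;}\Big).$$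 **(3) A-type, first choice.** $W=\beta(a+\gamma)\cot u+\frac\delta{\sin u}$, $u=\beta(x+\lambda)\in(0,\pi)$, $a_{k+1}=a_k-1$, $\mathcal R(a)=\beta^2(1-2(a+\gamma))$, $\mathcal Z=c$ with $\kappa=\beta=c\in\mathbb R\setminus\{0\}$, $\rho=-(a_1+\gamma)>0$, $D=\mathbb C$ (same range for the weight). With $\xi=\frac{\kappa^{2m}\Gamma(m+1)\Gamma(2m+2\rho)}{\Gamma(m+2\rho)}$ and $\chi=\frac{\kappa^{2m}\Gamma(m+\rho)\Gamma(m+\rho+\frac12)}{\Gamma(2m+2\rho)}$: $$|K_n^m|^2=\frac1{\kappa^{2m}}\frac{\Gamma(n+1)^2\Gamma(2n+2m+2\rho)\Gamma(n+m+2\rho)}{\Gamma(n+m+1)\Gamma(n+2m+2\rho)^2},$$ $$\mathcal N_m^{-2}(x)=\xi\;{}_3F_4\big(m+1,2m+2\rho,2m+2\rho;1,m+\rho,m+2\rho,m+\rho+\tfrac12;\tfrac x4\big)=\chi\,G_1(x),$$ $$G_1(x)=G^{1,3}_{3,5}\Big(-\tfrac x4\Big|{-m,1-2m-2\rho,1-2m-2\rho;\atop0;0,1-m-\rho,1-m-2\rho,\frac12-m-\rho}\Big),$$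 $$h_m(x)=G^{5,0}_{3,5}\Big(\tfrac x4\Big|{;0,2\rho+m-1,2\rho+m-1\atop-m,-m,2\rho-1,\rho-1,\rho-\frac12;}\Big),\qquad g_m=\frac1{2\sqrt\pi}\kappa^{-2m}2^{2(\rho-1)}h_m,$$ $$\int_0^\infty x^{s-1}h_m\,dx=\Big(\frac14\Big)^{-s}\frac{\Gamma(s-m)^2\Gamma(s-1+2\rho)\Gamma(s-1+\rho)\Gamma(s-\frac12+\rho)}{\Gamma(s)\Gamma(s-1+2\rho+m)^2}\quad(\operatorname{Re}s>\max(m,1-\rho)),$$ $$\omega_m(x)=\frac1{4\pi}\,G_1(x)\,G^{5,0}_{3,5}\Big(\tfrac x4\Big|{;m,2\rho+2m-1,2\rho+2m-1\atop0,0,2\rho+m-1,m+\rho-1,m+\rho-\frac12;}\Big).$$ **(4) A-type, second choice.** The same system with $\beta=\kappa\in\mathbb R\setminus\{0\}$, $a_1=-\frac\nu2$, $-(a_1+\gamma)=\frac\nu2+\frac12$, $\mathcal Z(a)=\sqrt{(\kappa-2\kappa a)(2\kappa-2\kappa a)}\,e^{-i\alpha\mathcal R(a)}$ with $\alpha\in\mathbb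 R$, $\nu>-1$, $D=\{|z|<1\}$; for the weight $\nu>0$. $$|K_n^m|^2=\frac1{\kappa^{2m}}\frac{\Gamma(n+1)^2\Gamma(n+m+\nu+1)\Gamma(2m+\nu+1)}{\Gamma(n+m+1)\Gamma(n+2m+\nu+1)^2},$$ $$\mathcal N_m^{-2}(x)=\frac{\kappa^{2m}\Gamma(m+1)\Gamma(2m+\nu+1)}{\Gamma(m+\nu+1)}\,{}_3F_2(m+1,2m+\nu+1,2m+\nu+1;1,m+\nu+1;x)=\frac{\kappa^{2m}}{\Gamma(2m+\nu+1)}G_1(x),$$ $$G_1(x)=G^{1,3}_{3,3}\Big(-x\Big|{-m,-2m-\nu,-2m-\nu;\atop0;0,-m-\nu}\Big),\qquad g_m=\frac{\Gamma(2m+\nu+1)}{\kappa^{2m}}h_m,\qquad h_m(x)=G^{3,0}_{3,3}\Big(x\Big|{;0,m+\nu,m+\nu\atop-m,-m,\nu;}\Big),$$ $$\int_0^\infty x^{s-1}h_m\,dx=\frac{\Gamma(s-m)^2\Gamma(s+\nu)}{\Gamma(s)\Gamma(s+m+\nu)^2}\quad(\operatorname{Re}s>m),$$ $$\omega_m(x)=\frac1\pi\,G_1(x)\,G^{3,0}_{3,3}\Big(x\Big|{;m,2m+\nu,2m+\nu\atop0,0,m+\nu;}\Big).$$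 -/

import Mathlib

open MeasureTheory

noncomputable section

/-! ## Shape-invariant systems -/

/-- The partner potential `V₁ = W² - W'` of a superpotential `W`. -/
def partnerV1 (W : ℝ → ℝ) (x : ℝ) : ℝ := W x ^ 2 - deriv W x

/-- The partner potential `V₂ = W² + W'` of a superpotential `W`. -/
def partnerV2 (W : ℝ → ℝ) (x : ℝ) : ℝ := W x ^ 2 + deriv W x

/-- A shape-invariant system with one real parameter: a superpotential `W(x; a)` on a domain,
a parameter map `a₁ ↦ a₂ = f(a₁)` and a remainder `R` with
`V₂(x; a) = V₁(x; f(a)) + R(a)` on the domain. -/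
structure SIPSystem where
  domain : Set ℝ
  superpotential : ℝ → ℝ → ℝ
  shift : ℝ → ℝ
  remainder : ℝ → ℝ
  shape_invariance : ∀ a, ∀ x ∈ domain,
    partnerV2 (superpotential a) x = partnerV1 (superpotential (shift a)) x + remainder a

/-- The D-type system `W(x; a) = β x + δ`; the parameter is constant. -/
def dType (β δ : ℝ) : SIPSystem where
  domain := Set.univ
  superpotential := fun _ x => β * x + δ
  shift := fun a => a
  remainder := fun _ => 2 * β
  shape_invariance := by
    intro a x _
    have h : HasDerivAt (fun x : ℝ => β * x + δ) (β * 1) x :=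
      ((hasDerivAt_id x).const_mul β).add_const δ
    simp only [partnerV1, partnerV2, h.deriv]
    ring

/-- The C-type system `W(x; a) = (a + δ) / x + (β / 2) x` on the half line, with `a ↦ a - 1`. -/
def cType (β δ : ℝ) : SIPSystem where
  domain := Set.Ioi 0
  superpotential := fun a x => (a + δ) / x + β / 2 * x
  shift := fun a => a - 1
  remainder := fun _ => 2 * β
  shape_invariance := by
    intro a x hx
    have hx0 : x ≠ 0 := ne_of_gt hx
    have h : ∀ p : ℝ, HasDerivAt (fun x : ℝ => p / x + β / 2 * x)
        (p * (-(x ^ 2)⁻¹) + β / 2 * 1) x := by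
      intro p
      have h1 := ((hasDerivAt_inv hx0).const_mul p).fun_add ((hasDerivAt_id x).const_mul (β / 2))
      simpa [div_eq_mul_inv] using h1
    simp only [partnerV1, partnerV2, (h _).deriv]
    field_simp
    ring

/-- The A-type system `W(x; a) = β (a + γ) cot u + δ / sin u`, `u = β (x + lam)`, on the
interval `0 < u < π`, with `a ↦ a - 1`. -/
def aType (β γ lam δ : ℝ) : SIPSystem where
  domain := {x | 0 < β * (x + lam) ∧ β * (x + lam) < Real.pi}
  superpotential := fun a x =>
    β * (a + γ) * Real.cot (β * (x + lam)) + δ / Real.sin (β * (x + lam))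
  shift := fun a => a - 1
  remainder := fun a => β ^ 2 * (1 - 2 * (a + γ))
  shape_invariance := by
    intro a x hx
    have hs : Real.sin (β * (x + lam)) ≠ 0 := (Real.sin_pos_of_pos_of_lt_pi hx.1 hx.2).ne'
    have hu : HasDerivAt (fun x : ℝ => β * (x + lam)) (β * 1) x :=
      ((hasDerivAt_id x).add_const lam).const_mul β
    have h : ∀ p : ℝ, HasDerivAt
        (fun x : ℝ => β * p * Real.cot (β * (x + lam)) + δ / Real.sin (β * (x + lam)))
        (β * p * ((-Real.sin (β * (x + lam)) * (β * 1) * Real.sin (β * (x + lam))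
            - Real.cos (β * (x + lam)) * (Real.cos (β * (x + lam)) * (β * 1)))
              / Real.sin (β * (x + lam)) ^ 2)
          + (0 * Real.sin (β * (x + lam)) - δ * (Real.cos (β * (x + lam)) * (β * 1)))
              / Real.sin (β * (x + lam)) ^ 2) x := by
      intro p
      simp only [Real.cot_eq_cos_div_sin]
      exact ((hu.cos.fun_div hu.sin hs).const_mul (β * p)).fun_add
        ((hasDerivAt_const x δ).fun_div hu.sin hs)
    simp only [partnerV1, partnerV2, (h _).deriv]
    rw [Real.cot_eq_cos_div_sin]
    field_simp
    ring

namespace SIPSystem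

/-- `paramSeq S a k` is `a_{k+1}`, where `a = a₁` and `a_{k+1} = f(a_k)`. -/
def paramSeq (S : SIPSystem) (a : ℝ) (k : ℕ) : ℝ := S.shift^[k] a

/-- `partialSum S a k N = R(a_{k+1}) + ⋯ + R(a_N)`. -/
def partialSum (S : SIPSystem) (a : ℝ) (k N : ℕ) : ℝ :=
  ∑ s ∈ Finset.Ico k N, S.remainder (S.paramSeq a s)

/-- The energies `E_n = R(a₁) + ⋯ + R(a_n)`. -/
def energy (S : SIPSystem) (a : ℝ) (n : ℕ) : ℝ := S.partialSum a 0 n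

/-- The raising operator `B₊ = A†(a₁) T(a₁)` on formal expansions `∑ φ(a)_n Ψ_n` whose
coefficients depend on the parameter: `B₊ Ψ_n = √E_{n+1} Ψ_{n+1}`, and moving `B₊` through a
coefficient replaces `a` by `f(a)` in it. -/
def raise (S : SIPSystem) (φ : ℝ → ℕ → ℂ) : ℝ → ℕ → ℂ
  | _, 0 => 0
  | a, n + 1 => (Real.sqrt (S.energy a (n + 1)) : ℂ) * φ (S.shift a) n

/-- The coefficients `h_n` of the ordinary shape-invariant coherent states, for the functional
`Z_k = Z(a_k)`:
`h_n = √(∏_{k=1}^n ∑_{s=k}^n R(a_s)) / ∏_{k=1}^n Z(a_k)`. -/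
def hCoeff (S : SIPSystem) (Z : ℝ → ℂ) (a : ℝ) (n : ℕ) : ℂ :=
  (Real.sqrt (∏ k ∈ Finset.range n, S.partialSum a k n) : ℂ)
    / ∏ k ∈ Finset.range n, Z (S.paramSeq a k)

/-- The coefficients `z^n / h_n` of the (unnormalized) coherent state. -/
def sipcsCoeff (S : SIPSystem) (Z : ℝ → ℂ) (z : ℂ) (a : ℝ) (n : ℕ) : ℂ :=
  z ^ n / S.hCoeff Z a n

/-- The coefficients of the (unnormalized) photon-added coherent state `B₊^m |z⟩`. -/
def paCoeff (S : SIPSystem) (Z : ℝ → ℂ) (m : ℕ) (z : ℂ) (a : ℝ) (n : ℕ) : ℂ :=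
  (S.raise^[m] (S.sipcsCoeff Z z)) a n

/-- The expansion coefficients `K_n^m` of the photon-added coherent states:
`√(∏_{k=m+1}^{n+m} ∑_{s=k}^{n+m} R(a_s)) /
  (∏_{k=m+1}^{n+m} Z(a_k) · √(∏_{k=1}^m ∑_{s=k}^{n+m} R(a_s)))`. -/
def kCoeff (S : SIPSystem) (Z : ℝ → ℂ) (m : ℕ) (a : ℝ) (n : ℕ) : ℂ :=
  (Real.sqrt (∏ k ∈ Finset.Ico m (n + m), S.partialSum a k (n + m)) : ℂ)
    / ((∏ k ∈ Finset.Ico m (n + m), Z (S.paramSeq a k))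
      * (Real.sqrt (∏ k ∈ Finset.range m, S.partialSum a k (n + m)) : ℂ))

/-- The normalization factor `N_m(x) = (∑ₙ xⁿ / |K_n^m|²)^{-1/2}`. -/
def normFactor (S : SIPSystem) (Z : ℝ → ℂ) (m : ℕ) (a : ℝ) (x : ℝ) : ℝ :=
  (∑' n : ℕ, x ^ n / ‖S.kCoeff Z m a n‖ ^ 2) ^ (-(1 / 2) : ℝ)

/-- The normalized photon-added coherent state `N_m(|z|²) B₊^m |z⟩` in a Hilbert space with
orthonormal basis `(Ψ_n)`. -/
def paState (S : SIPSystem) (Z : ℝ → ℂ) (m : ℕ) (a : ℝ)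
    {E : Type*} [NormedAddCommGroup E] [InnerProductSpace ℂ E]
    (Ψ : HilbertBasis ℕ ℂ E) (z : ℂ) : E :=
  (S.normFactor Z m a (‖z‖ ^ 2) : ℂ) • ∑' n : ℕ, S.paCoeff Z m z a n • Ψ n

end SIPSystem

/-- The auxiliary function `g(a; c, d) = c a + d`. -/
def auxG (c d a : ℝ) : ℝ := c * a + d

/-- The subspace `H_m`, the closed span of `Ψ_{n+m}`, `n ≥ 0`. -/
def paSubspace {E : Type*} [NormedAddCommGroup E] [InnerProductSpace ℂ E]
    (Ψ : HilbertBasis ℕ ℂ E) (m : ℕ) : Submodule ℂ E :=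
  (Submodule.span ℂ (Set.range fun n : ℕ => Ψ (n + m))).topologicalClosure

/-- The resolution of the identity `∫_D d²z |z⟩ ω(|z|²) ⟨z| = 1` on `H_m`, in the weak sense. -/
def ResolvesIdentity {E : Type*} [NormedAddCommGroup E] [InnerProductSpace ℂ E]
    (Ψ : HilbertBasis ℕ ℂ E) (m : ℕ) (D : Set ℂ) (state : ℂ → E) (ω : ℝ → ℝ) : Prop :=
  ∀ φ ∈ paSubspace Ψ m, ∀ ψ ∈ paSubspace Ψ m,
    IntegrableOn
      (fun z : ℂ => inner ℂ φ (state z) * (ω (‖z‖ ^ 2) : ℂ) * inner ℂ (state z) ψ) D ∧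
    ∫ z in D, inner ℂ φ (state z) * (ω (‖z‖ ^ 2) : ℂ) * inner ℂ (state z) ψ = inner ℂ φ ψ

/-! ## Special functions -/

/-- The generalized hypergeometric function `_pF_q(as; bs; x)`. -/
def genHypergeometric (as bs : List ℝ) (x : ℝ) : ℝ :=
  ∑' n : ℕ, (as.map fun a => (ascPochhammer ℝ n).eval a).prod
    / (bs.map fun b => (ascPochhammer ℝ n).eval b).prod * (x ^ n / (n.factorial : ℝ))

/-- The Mellin-Barnes kernel
`∏ Γ(b_j + s) ∏ Γ(1 - a_j - s) / (∏ Γ(1 - b'_j - s) ∏ Γ(a'_j + s))`, where `as` are the first `n`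
upper and `bs` the first `m` lower parameters, `as'` and `bs'` the remaining ones. The value of
`Γ` at its poles is `0` in Mathlib, so that `1 / Γ` is correctly `0` there. -/
def meijerKernel (as as' bs bs' : List ℂ) (s : ℂ) : ℂ :=
  (bs.map fun b => Complex.Gamma (b + s)).prod * (as.map fun a => Complex.Gamma (1 - a - s)).prod
    / ((bs'.map fun b => Complex.Gamma (1 - b - s)).prod
      * (as'.map fun a => Complex.Gamma (a + s)).prod)

/-- The integrand `kernel(s) z^{-s}` of the Mellin-Barnes integral. -/
def meijerIntegrand (as as' bs bs' : List ℂ) (z s : ℂ) : ℂ :=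
  meijerKernel as as' bs bs' s * z ^ (-s)

/-- `c = (σ, τ)` is admissible if the line `Re s = σ` has the poles of all `Γ(b_j + s)` on its left
and those of all `Γ(1 - a_j - s)` on its right, all of them in the strip `|Im s| < τ`. -/
def MeijerAdmissible (as bs : List ℂ) (c : ℝ × ℝ) : Prop :=
  0 < c.2 ∧ (∀ b ∈ bs, -b.re < c.1 ∧ |b.im| < c.2) ∧ (∀ a ∈ as, c.1 < 1 - a.re ∧ |a.im| < c.2)

/-- `(2πi)⁻¹ ∫ F(s) ds` along the line from `σ - i∞` to `σ + i∞`. -/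
def lineIntegral (σ : ℝ) (F : ℂ → ℂ) : ℂ :=
  (2 * Real.pi * Complex.I)⁻¹ * (Complex.I * ∫ y : ℝ, F (σ + y * Complex.I))

/-- `(2πi)⁻¹ ∫ F(s) ds` along the loop from `-∞ - iτ` via `σ - iτ` and `σ + iτ` to `-∞ + iτ`. -/
def leftLoopIntegral (σ τ : ℝ) (F : ℂ → ℂ) : ℂ :=
  (2 * Real.pi * Complex.I)⁻¹ *
    ((∫ x in Set.Iic σ, F (x - τ * Complex.I))
      + Complex.I * (∫ y in (-τ)..τ, F (σ + y * Complex.I))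
      - ∫ x in Set.Iic σ, F (x + τ * Complex.I))

/-- `(2πi)⁻¹ ∫ F(s) ds` along the loop from `+∞ - iτ` via `σ - iτ` and `σ + iτ` to `+∞ + iτ`. -/
def rightLoopIntegral (σ τ : ℝ) (F : ℂ → ℂ) : ℂ :=
  (2 * Real.pi * Complex.I)⁻¹ *
    (-(∫ x in Set.Ici σ, F (x - τ * Complex.I))
      + Complex.I * (∫ y in (-τ)..τ, F (σ + y * Complex.I))
      + ∫ x in Set.Ici σ, F (x + τ * Complex.I))

open Classical in
/-- The Meijer function `G^{m,n}_{p,q}(z | as ; as' / bs ; bs')`, with `n = as.length`,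
`p = n + as'.length`, `m = bs.length`, `q = m + bs'.length`, for parameters for which a vertical
line separates the two families of poles (the value does not depend on the admissible contour).
The contour is the vertical line if `|arg z| < (m + n - (p + q)/2) π`, and otherwise the loop
around the poles of the `Γ(b_j + s)` if `p < q`, or `p = q` and `|z| < 1`, and the loop around the
poles of the `Γ(1 - a_j - s)` if `p > q`, or `p = q` and `|z| > 1`. The point `z = 0`, and the
circle `|z| = 1` when `p = q`, are not in the domain of the function in general. -/
def meijerG (as as' bs bs' : List ℂ) (z : ℂ) : ℂ :=
  if h : ∃ c : ℝ × ℝ, MeijerAdmissible as bs c then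
    if |z.arg| < ((bs.length + as.length : ℝ)
        - ((as.length + as'.length) + (bs.length + bs'.length)) / 2) * Real.pi then
      lineIntegral h.choose.1 (meijerIntegrand as as' bs bs' z)
    else if as.length + as'.length < bs.length + bs'.length ∨
        (as.length + as'.length = bs.length + bs'.length ∧ ‖z‖ < 1) then
      leftLoopIntegral h.choose.1 h.choose.2 (meijerIntegrand as as' bs bs' z)
    else
      rightLoopIntegral h.choose.1 h.choose.2 (meijerIntegrand as as' bs bs' z)
  else 0

end

noncomputable section

open Set Filter Topology Complex

/-! Each claim reduces to quotients of Gamma functions. The partial sums of remainders are products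
of linear factors in the indices, so the products in `kCoeff` telescope and $|K_n^m|^2$ is a Gamma
quotient in n. Applying the raising operator m times to the coherent state produces exactly the
coefficients $z^n/K_n^m$ on $\Psi_{n+m}$ (`SIPSystem.paCoeff_add`).

The series $\sum x^n/|K_n^m|^2$ is hypergeometric. It is also the sum of the residues of the
Mellin-Barnes integrand at the poles 0, -1, -2, ... of Γ(s). At a negative argument the sign of the
residue cancels the sign of the power, so all terms are nonnegative, and convergence of the residue
expansion yields summability and the Meijer form together (`meijerG_neg_eq_tsum`). The expansion is
valid because shifting s by -1 multiplies the integrand by z times a rational function, which makes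
it decay geometrically to the left (`leftDecay_meijerIntegrand`).

For the moment problem, positivity is not read off from a contour integral. A positive density is
built by multiplicative convolution from elementary ones: $x^a e^{-x}$, with Mellin transform
Γ(s+a); beta densities, with transform Γ(s+p)/Γ(s+p+q); and powers on (0,1], with transform 1/(s+c).
Convolution multiplies Mellin transforms, so each kernel in the theorem is the transform of such a
density. Mellin inversion then identifies the density with the Meijer function. For p < q the kernel
is integrable on vertical lines and inversion applies directly (`meijerG_eq_of_isDensityIoi`). For p
= q the contour is a loop and the kernel need not be integrable on a line. There the kernel is
divided by s², the loop is opened into a line, inversion is applied, and two differentiations in x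
remove the divisions. For x > 1 the loop encloses no singularity, so the function vanishes, as the
density does (`meijerG_eq_of_isDensityIoo`).

The moments of the density are the values of its transform at the points n+m+1. Multiplying the
density by $x^m$ translates the kernel by m, which gives the second Meijer factor of the weight.
Angular integration together with the moments makes the functions $\sqrt{\omega_m}\,\mathcal N_m
z^n/K_n^m$ orthonormal in L², and an orthonormal coefficient family resolves the identity
(`ResolvesIdentity.of_moments`). -/

/-- `Φ` decreases geometrically under translation to the left, away from a bounded set. -/
def LeftDecay (Φ : ℂ → ℂ) : Prop :=
  ∃ r M : ℝ, 0 < r ∧ r < 1 ∧ ∀ s : ℂ, M ≤ ‖s‖ → ‖Φ (s - 1)‖ ≤ r * ‖Φ s‖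

/-! ### Exponential bounds and integrability from a unit-shift inequality -/

lemma le_pow_mul_of_shift {f : ℝ → ℝ} {r b : ℝ} (hr : 0 ≤ r)
    (h : ∀ x ≤ b, f (x - 1) ≤ r * f x) (k : ℕ) (x : ℝ) (hx : x + k ≤ b) :
    f x ≤ r ^ k * f (x + k) := by
  induction k generalizing x with
  | zero => simp
  | succ k ih =>
    push_cast at hx
    have h1 := h (x + 1) (by have : (0 : ℝ) ≤ k := k.cast_nonneg; linarith)
    have h2 := ih (x + 1) (by linarith)
    calc f x ≤ r * f (x + 1) := by simpa using h1
      _ ≤ r * (r ^ k * f (x + 1 + k)) := by gcongr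
      _ = r ^ (k + 1) * f (x + (k + 1 : ℕ)) := by push_cast; ring_nf

/-- Enough unit translations carry x into the window [b-1, b], where C bounds f. Their number k is
at least b-1-x, so the gained factor r^k is at most the stated exponential. -/
lemma le_exp_of_shift {f : ℝ → ℝ} {r b C : ℝ} (hr : 0 < r) (hr1 : r < 1) (hC : 0 ≤ C)
    (h : ∀ x ≤ b, f (x - 1) ≤ r * f x) (hb : ∀ x ∈ Icc (b - 1) b, f x ≤ C) :
    ∀ x ≤ b, f x ≤ C * Real.exp (-Real.log r * (x - (b - 1))) := by
  intro x hx
  have hlog : Real.log r < 0 := Real.log_neg hr hr1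
  rcases le_total x (b - 1) with hx1 | hx1
  · set k := ⌈b - 1 - x⌉₊ with hk
    have hk1 : b - 1 - x ≤ k := Nat.le_ceil _
    have hk2 : (k : ℝ) < b - 1 - x + 1 := Nat.ceil_lt_add_one (by linarith)
    have h1 := le_pow_mul_of_shift hr.le h k x (by linarith)
    have h2 := hb (x + k) ⟨by linarith, by linarith⟩
    calc f x ≤ r ^ k * f (x + k) := h1
      _ ≤ r ^ k * C := by gcongr
      _ = C * Real.exp (Real.log r * k) := by
        rw [mul_comm, ← Real.rpow_natCast, Real.rpow_def_of_pos hr]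
      _ ≤ C * Real.exp (-Real.log r * (x - (b - 1))) := by
        refine mul_le_mul_of_nonneg_left (Real.exp_le_exp.2 ?_) hC
        nlinarith
  · calc f x ≤ C * 1 := by rw [mul_one]; exact hb x ⟨hx1, hx⟩
      _ ≤ _ := by
        gcongr
        rw [Real.one_le_exp_iff]
        nlinarith

lemma integral_exp_shift_Iic {c b : ℝ} (hc : 0 < c) :
    ∫ x in Iic b, Real.exp (c * (x - (b - 1))) = Real.exp c / c := by
  have h : ∀ x, Real.exp (c * (x - (b - 1))) = Real.exp (-c * (b - 1)) * Real.exp (c * x) := by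
    intro x
    rw [← Real.exp_add]
    ring_nf
  simp_rw [h]
  rw [integral_const_mul, integral_exp_mul_Iic hc, ← mul_div_assoc, ← Real.exp_add]
  ring_nf

lemma integrableOn_exp_shift_Iic {c b : ℝ} (hc : 0 < c) :
    IntegrableOn (fun x => Real.exp (c * (x - (b - 1)))) (Iic b) := by
  have h : ∀ x, Real.exp (c * (x - (b - 1))) = Real.exp (-c * (b - 1)) * Real.exp (c * x) := by
    intro x
    rw [← Real.exp_add]
    ring_nf
  simp_rw [h]
  exact (integrableOn_exp_mul_Iic hc b).const_mul _

lemma integrableOn_Iic_of_shift_le {f : ℝ → ℂ} {r b σ : ℝ} (hf : ContinuousOn f (Iic σ))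
    (hr : 0 < r) (hr1 : r < 1) (h : ∀ x ≤ b, ‖f (x - 1)‖ ≤ r * ‖f x‖) :
    IntegrableOn f (Iic σ) := by
  -- The shift inequality is known only up to b and continuity only up to σ, so the window ends at
  -- the smaller of the two.
  set b' := min b σ
  obtain ⟨C, hC⟩ := (isCompact_Icc (a := b' - 1) (b := b')).exists_bound_of_continuousOn
    (hf.mono (fun x hx => le_trans hx.2 (min_le_right _ _)))
  have hC0 : 0 ≤ C := (norm_nonneg _).trans (hC b' ⟨by linarith, le_rfl⟩)
  have hlog : 0 < -Real.log r := by linarith [Real.log_neg hr hr1]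
  have h1 : IntegrableOn f (Iic b') := by
    refine Integrable.mono' ((integrableOn_exp_shift_Iic (b := b') hlog).const_mul C)
      ((hf.mono (Iic_subset_Iic.2 (min_le_right _ _))).aestronglyMeasurable measurableSet_Iic) ?_
    refine (ae_restrict_iff' measurableSet_Iic).2 (Eventually.of_forall fun x hx => ?_)
    exact le_exp_of_shift (f := fun x => ‖f x‖) hr hr1 hC0
      (fun x hx => h x (hx.trans (min_le_left _ _))) hC x hx
  have h2 : IntegrableOn f (Icc b' σ) :=
    (hf.mono (fun x hx => hx.2)).integrableOn_Icc
  rw [← Iic_union_Icc_eq_Iic (min_le_right b σ)]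
  exact h1.union h2

/-- The bound involves f only through C and r. This uniformity makes the horizontal legs of a loop
vanish as its height grows. -/
lemma norm_setIntegral_Iic_le_of_shift {f : ℝ → ℂ} {r b C : ℝ}
    (hr : 0 < r) (hr1 : r < 1) (hC : 0 ≤ C)
    (h : ∀ x ≤ b, ‖f (x - 1)‖ ≤ r * ‖f x‖) (hb : ∀ x ∈ Icc (b - 1) b, ‖f x‖ ≤ C) {σ : ℝ}
    (hσ : σ ≤ b) :
    ‖∫ x in Iic σ, f x‖ ≤ C * (Real.exp (-Real.log r) / -Real.log r) := by
  have hlog : 0 < -Real.log r := by linarith [Real.log_neg hr hr1]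
  calc ‖∫ x in Iic σ, f x‖
      ≤ ∫ x in Iic σ, C * Real.exp (-Real.log r * (x - (b - 1))) := by
        refine norm_integral_le_of_norm_le
          (((integrableOn_exp_shift_Iic hlog).mono_set (Iic_subset_Iic.2 hσ)).const_mul C) ?_
        refine (ae_restrict_iff' measurableSet_Iic).2 (Eventually.of_forall fun x hx => ?_)
        exact le_exp_of_shift (f := fun x => ‖f x‖) hr hr1 hC h hb x (le_trans hx hσ)
    _ ≤ ∫ x in Iic b, C * Real.exp (-Real.log r * (x - (b - 1))) := by
        refine setIntegral_mono_set ((integrableOn_exp_shift_Iic hlog).const_mul C)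
          (Eventually.of_forall fun x => by positivity) (Iic_subset_Iic.2 hσ).eventuallyLE
    _ = _ := by rw [integral_const_mul, integral_exp_shift_Iic hlog]

lemma abs_im_le_norm_add_mul_I (x t : ℝ) : |t| ≤ ‖(x : ℂ) + t * I‖ := by
  simpa using Complex.abs_im_le_norm ((x : ℂ) + t * I)

lemma abs_re_le_norm_add_mul_I (x t : ℝ) : |x| ≤ ‖(x : ℂ) + t * I‖ := by
  simpa using Complex.abs_re_le_norm ((x : ℂ) + t * I)

/-- Since |Re s| ≤ ‖s‖, the threshold on x can be chosen independently of the height t. -/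
lemma LeftDecay.horizontal {Φ : ℂ → ℂ} (h : LeftDecay Φ) :
    ∃ r b : ℝ, 0 < r ∧ r < 1 ∧ ∀ t : ℝ, ∀ x ≤ b, ‖Φ (((x - 1 : ℝ) : ℂ) + t * I)‖
      ≤ r * ‖Φ ((x : ℂ) + t * I)‖ := by
  obtain ⟨r, M, hr, hr1, h⟩ := h
  refine ⟨r, -|M|, hr, hr1, fun t x hx => ?_⟩
  have := h ((x : ℂ) + t * I) ((le_abs_self M).trans (le_trans (by
    linarith [neg_abs_le x]) (abs_re_le_norm_add_mul_I x t)))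
  convert this using 3
  push_cast; ring

/-- Since |Im s| ≤ ‖s‖, on a sufficiently high line the decay holds for every x, without going far
to the left. -/
lemma LeftDecay.high {Φ : ℂ → ℂ} (h : LeftDecay Φ) :
    ∃ r M : ℝ, 0 < r ∧ r < 1 ∧ ∀ t : ℝ, M ≤ |t| → ∀ x : ℝ, ‖Φ (((x - 1 : ℝ) : ℂ) + t * I)‖
      ≤ r * ‖Φ ((x : ℂ) + t * I)‖ := by
  obtain ⟨r, M, hr, hr1, h⟩ := h
  refine ⟨r, M, hr, hr1, fun t ht x => ?_⟩
  have := h ((x : ℂ) + t * I) (ht.trans (abs_im_le_norm_add_mul_I x t))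
  convert this using 3
  push_cast; ring

lemma LeftDecay.integrableOn_Iic {Φ : ℂ → ℂ} (h : LeftDecay Φ) {σ t : ℝ}
    (hc : ContinuousOn (fun x : ℝ => Φ ((x : ℂ) + t * I)) (Iic σ)) :
    IntegrableOn (fun x : ℝ => Φ ((x : ℂ) + t * I)) (Iic σ) := by
  obtain ⟨r, b, hr, hr1, h⟩ := h.horizontal
  exact integrableOn_Iic_of_shift_le hc hr hr1 (h t)

lemma horizontal_continuous (t : ℝ) : Continuous (fun x : ℝ => (x : ℂ) + t * I) := by fun_prop

lemma continuousOn_horizontal {Φ : ℂ → ℂ} {t : ℝ} (S : Set ℝ)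
    (hd : ∀ s : ℂ, s.im = t → DifferentiableAt ℂ Φ s) :
    ContinuousOn (fun x : ℝ => Φ ((x : ℂ) + t * I)) S := by
  intro x _
  exact ((hd _ (by simp)).continuousAt.comp
    (horizontal_continuous t).continuousAt).continuousWithinAt

/-! ### Loops, rectangles and the residue of a simple pole -/

/-- The integral of `Φ` over the boundary of the rectangle `[a, b] × [-τ, τ]`. -/
def rectIntegral (a b τ : ℝ) (Φ : ℂ → ℂ) : ℂ :=
  (∫ x in a..b, Φ (x - τ * I)) - (∫ x in a..b, Φ (x + τ * I))
    + I * (∫ y in (-τ)..τ, Φ (b + y * I)) - I * (∫ y in (-τ)..τ, Φ (a + y * I))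

/-- Two loops of equal height share their horizontal rays far to the left; what remains of the
difference is the boundary of a rectangle. Regularity is needed only on the two horizontal lines, so
poles may lie between them. -/
lemma leftLoopIntegral_sub {Φ : ℂ → ℂ} {a b τ : ℝ} (h : LeftDecay Φ)
    (hd : ∀ s : ℂ, |s.im| = |τ| → DifferentiableAt ℂ Φ s) :
    leftLoopIntegral b τ Φ - leftLoopIntegral a τ Φ
      = (2 * Real.pi * I)⁻¹ * rectIntegral a b τ Φ := by
  have e : ∀ σ : ℝ, ∀ t : ℝ, |t| = |τ| →
      IntegrableOn (fun x : ℝ => Φ ((x : ℂ) + t * I)) (Iic σ) := fun σ t ht =>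
    h.integrableOn_Iic (continuousOn_horizontal _ (fun s hs => hd s (by rw [hs, ht])))
  have e1 : ∀ σ : ℝ, IntegrableOn (fun x : ℝ => Φ ((x : ℂ) - τ * I)) (Iic σ) := by
    intro σ
    simpa [sub_eq_add_neg] using e σ (-τ) (abs_neg τ)
  rw [leftLoopIntegral, leftLoopIntegral, rectIntegral,
    ← intervalIntegral.integral_Iic_sub_Iic (e1 a) (e1 b),
    ← intervalIntegral.integral_Iic_sub_Iic (e a τ rfl) (e b τ rfl)]
  ring

lemma rectIntegral_eq_zero {Φ : ℂ → ℂ} {a b τ : ℝ} (hab : a ≤ b) (hτ : 0 ≤ τ)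
    (hd : ∀ s : ℂ, a ≤ s.re → s.re ≤ b → |s.im| ≤ τ → DifferentiableAt ℂ Φ s) :
    rectIntegral a b τ Φ = 0 := by
  have := Complex.integral_boundary_rect_eq_zero_of_differentiableOn Φ ⟨a, -τ⟩ ⟨b, τ⟩ (by
    intro s hs
    rw [mem_reProdIm] at hs
    simp only [uIcc_of_le hab, uIcc_of_le (show -τ ≤ τ by linarith), mem_Icc] at hs
    exact (hd s hs.1.1 hs.1.2 (abs_le.2 hs.2)).differentiableWithinAt)
  simpa [rectIntegral, sub_eq_add_neg] using this

lemma rectIntegral_congr {Φ Ψ : ℂ → ℂ} {a b τ : ℝ} (h : ∀ s : ℂ,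
    (s.re ∈ uIcc a b ∧ |s.im| = |τ|) ∨ (s.re = a ∨ s.re = b) → Φ s = Ψ s) :
    rectIntegral a b τ Φ = rectIntegral a b τ Ψ := by
  have h1 : ∫ x in a..b, Φ (x - τ * I) = ∫ x in a..b, Ψ (x - τ * I) :=
    intervalIntegral.integral_congr fun x hx => h _ (Or.inl ⟨by simpa using hx, by simp⟩)
  have h2 : ∫ x in a..b, Φ (x + τ * I) = ∫ x in a..b, Ψ (x + τ * I) :=
    intervalIntegral.integral_congr fun x hx => h _ (Or.inl ⟨by simpa using hx, by simp⟩)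
  have h3 : ∀ y : ℝ, Φ (b + y * I) = Ψ (b + y * I) := fun y => h _ (Or.inr (Or.inr (by simp)))
  have h4 : ∀ y : ℝ, Φ (a + y * I) = Ψ (a + y * I) := fun y => h _ (Or.inr (Or.inl (by simp)))
  simp only [rectIntegral, h1, h2, h3, h4]

/-- Averaging over y ↦ -y cancels the imaginary part of the integrand and leaves b/(b²+y²), whose
primitive is an arctangent. -/
lemma integral_im_part {b τ : ℝ} (hb : b ≠ 0) (hτ : 0 < τ) :
    ∫ y in (-τ)..τ, ((b : ℂ) + y * I)⁻¹ = ((2 * Real.arctan (τ / b) : ℝ) : ℂ) := by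
  have hne : ∀ y : ℝ, (b : ℂ) + y * I ≠ 0 := fun y h => hb (by simpa using congrArg Complex.re h)
  have hcont : Continuous fun y : ℝ => ((b : ℂ) + y * I)⁻¹ :=
    Continuous.inv₀ (by fun_prop) hne
  have h1 : ∫ y in (-τ)..τ, ((b : ℂ) + y * I)⁻¹ = ∫ y in (-τ)..τ, ((b : ℂ) + (-y : ℝ) * I)⁻¹ := by
    have := intervalIntegral.integral_comp_neg (a := -τ) (b := τ)
      (fun y : ℝ => ((b : ℂ) + y * I)⁻¹)
    simpa using this.symm
  have h2 : ∀ y : ℝ, ((b : ℂ) + y * I)⁻¹ + ((b : ℂ) + (-y : ℝ) * I)⁻¹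
      = ((2 * (b⁻¹ * (1 + (y / b) ^ 2)⁻¹) : ℝ) : ℂ) := by
    intro y
    have h3 := hne y
    have h4 := hne (-y)
    have h5 : (b ^ 2 + y ^ 2) ≠ 0 := by positivity
    have h5' : (b ^ 2 + y ^ 2 : ℂ) ≠ 0 := by exact_mod_cast h5
    have h6 : (2 * (b⁻¹ * (1 + (y / b) ^ 2)⁻¹) : ℝ) = 2 * b / (b ^ 2 + y ^ 2) := by
      field_simp
    rw [h6, inv_add_inv h3 h4]
    have h7 : ((b : ℂ) + y * I) * ((b : ℂ) + (-y : ℝ) * I) = b ^ 2 + y ^ 2 := by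
      push_cast
      linear_combination (-(y : ℂ) ^ 2) * I_sq
    rw [h7]
    push_cast
    ring
  have h3 : (∫ y in (-τ)..τ, ((b : ℂ) + y * I)⁻¹) + (∫ y in (-τ)..τ, ((b : ℂ) + y * I)⁻¹)
      = ((4 * Real.arctan (τ / b) : ℝ) : ℂ) := by
    nth_rw 2 [h1]
    rw [← intervalIntegral.integral_add (hcont.intervalIntegrable _ _)
      ((show Continuous fun y : ℝ => ((b : ℂ) + (-y : ℝ) * I)⁻¹ from
        hcont.comp continuous_neg).intervalIntegrable _ _)]
    simp_rw [h2]
    rw [intervalIntegral.integral_ofReal, intervalIntegral.integral_const_mul,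
      intervalIntegral.integral_const_mul, intervalIntegral.integral_comp_div
        (fun y => (1 + y ^ 2)⁻¹) hb, integral_inv_one_add_sq, neg_div, Real.arctan_neg]
    congr 1
    rw [smul_eq_mul]
    field_simp
    ring
  rw [← two_mul] at h3
  have h4 : (2 : ℂ) * ∫ y in (-τ)..τ, ((b : ℂ) + y * I)⁻¹
      = 2 * ((2 * Real.arctan (τ / b) : ℝ) : ℂ) := by
    rw [h3]
    push_cast
    ring
  exact mul_left_cancel₀ two_ne_zero h4

lemma integral_horizontal_part {a b τ : ℝ} (hτ : 0 < τ) :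
    (∫ x in a..b, ((x : ℂ) - τ * I)⁻¹) - (∫ x in a..b, ((x : ℂ) + τ * I)⁻¹)
      = I * ((2 * (Real.arctan (b / τ) - Real.arctan (a / τ)) : ℝ) : ℂ) := by
  have hne1 : ∀ x : ℝ, (x : ℂ) - τ * I ≠ 0 := fun x h =>
    hτ.ne' (by simpa using congrArg Complex.im h)
  have hne2 : ∀ x : ℝ, (x : ℂ) + τ * I ≠ 0 := fun x h =>
    hτ.ne' (by simpa using congrArg Complex.im h)
  rw [← intervalIntegral.integral_sub
    ((show Continuous fun x : ℝ => ((x : ℂ) - τ * I)⁻¹ from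
      Continuous.inv₀ (by fun_prop) hne1).intervalIntegrable _ _)
    ((show Continuous fun x : ℝ => ((x : ℂ) + τ * I)⁻¹ from
      Continuous.inv₀ (by fun_prop) hne2).intervalIntegrable _ _)]
  have h2 : ∀ x : ℝ, ((x : ℂ) - τ * I)⁻¹ - ((x : ℂ) + τ * I)⁻¹
      = I * ((2 * (τ⁻¹ * (1 + (x / τ) ^ 2)⁻¹) : ℝ) : ℂ) := by
    intro x
    have h5 : (x ^ 2 + τ ^ 2) ≠ 0 := by positivity
    have h5' : (x ^ 2 + τ ^ 2 : ℂ) ≠ 0 := by exact_mod_cast h5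
    have h6 : (2 * (τ⁻¹ * (1 + (x / τ) ^ 2)⁻¹) : ℝ) = 2 * τ / (x ^ 2 + τ ^ 2) := by
      field_simp
      ring
    rw [h6, inv_sub_inv (hne1 x) (hne2 x)]
    have h7 : ((x : ℂ) - τ * I) * ((x : ℂ) + τ * I) = x ^ 2 + τ ^ 2 := by
      linear_combination (-(τ : ℂ) ^ 2) * I_sq
    rw [h7]
    push_cast
    ring
  simp_rw [h2]
  rw [intervalIntegral.integral_const_mul, intervalIntegral.integral_ofReal,
    intervalIntegral.integral_const_mul, intervalIntegral.integral_const_mul,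
    intervalIntegral.integral_comp_div (fun y => (1 + y ^ 2)⁻¹) hτ.ne', integral_inv_one_add_sq,
    smul_eq_mul]
  congr 3
  field_simp

/-- The four sides contribute angles. By arctan t + arctan(1/t) = ±π/2, those on each side of the
pole add up to π. -/
lemma rectIntegral_inv {a b τ : ℝ} (ha : a < 0) (hb : 0 < b) (hτ : 0 < τ) :
    rectIntegral a b τ (fun s => s⁻¹) = 2 * Real.pi * I := by
  have h1 : Real.arctan (b / τ) + Real.arctan (τ / b) = Real.pi / 2 := by
    have := Real.arctan_inv_of_pos (div_pos hτ hb)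
    rw [inv_div] at this
    linarith
  have h2 : Real.arctan (a / τ) + Real.arctan (τ / a) = -(Real.pi / 2) := by
    have := Real.arctan_inv_of_neg (div_neg_of_pos_of_neg hτ ha)
    rw [inv_div] at this
    linarith
  rw [rectIntegral, integral_horizontal_part hτ, integral_im_part hb.ne' hτ,
    integral_im_part ha.ne hτ]
  have h3 : 2 * (Real.arctan (b / τ) - Real.arctan (a / τ)) + 2 * Real.arctan (τ / b)
      - 2 * Real.arctan (τ / a) = 2 * Real.pi := by linarith
  have h4 := congrArg (fun t : ℝ => (t : ℂ)) h3
  push_cast at h4 ⊢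
  linear_combination I * h4

/-- A(s)/(s-w) differs from A(w)/(s-w) by the slope of A at w, which extends holomorphically across
w and integrates to zero. An open set U is used because the removable singularity is filled on a
neighbourhood of w. -/
lemma rectIntegral_residue {A : ℂ → ℂ} {a b w τ : ℝ} (ha : a < w) (hb : w < b) (hτ : 0 < τ)
    {U : Set ℂ} (hU : IsOpen U) (hA : DifferentiableOn ℂ A U)
    (hsub : ∀ s : ℂ, a ≤ s.re → s.re ≤ b → |s.im| ≤ τ → s ∈ U) :
    rectIntegral a b τ (fun s => A s / (s - w)) = 2 * Real.pi * I * A w := by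
  have hw : (w : ℂ) ∈ U := hsub w (by simpa using ha.le) (by simpa using hb.le) (by simpa using hτ.le)
  have hD : DifferentiableOn ℂ (dslope A w) U :=
    (Complex.differentiableOn_dslope (hU.mem_nhds hw)).2 hA
  have h0 : rectIntegral a b τ (dslope A w) = 0 :=
    rectIntegral_eq_zero (ha.trans hb).le hτ.le fun s h1 h2 h3 =>
      hD.differentiableAt (hU.mem_nhds (hsub s h1 h2 h3))
  have h1 := rectIntegral_inv (a := a - w) (b := b - w) (by linarith) (by linarith) hτ
  have h2 : rectIntegral a b τ (fun s => (s - w)⁻¹) = 2 * Real.pi * I := by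
    rw [← h1, rectIntegral, rectIntegral]
    have e1 := intervalIntegral.integral_comp_sub_right (a := a) (b := b)
      (fun x : ℝ => ((x : ℂ) - τ * I)⁻¹) w
    have e2 := intervalIntegral.integral_comp_sub_right (a := a) (b := b)
      (fun x : ℝ => ((x : ℂ) + τ * I)⁻¹) w
    rw [← e1, ← e2]
    congr 1
    · congr 1
      · congr 1
        · congr 1; ext x; push_cast; ring_nf
        · congr 1; ext x; push_cast; ring_nf
      · congr 2; ext x; push_cast; ring_nf
    · congr 2; ext x; push_cast; ring_nf
  have hne : ∀ s : ℂ, (s.re ∈ uIcc a b ∧ |s.im| = |τ|) ∨ (s.re = a ∨ s.re = b) → s ≠ w := by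
    rintro s hs rfl
    rcases hs with hs | hs | hs
    · simp only [ofReal_re, ofReal_im, abs_zero] at hs
      exact (abs_pos.2 hτ.ne').ne hs.2
    · simp at hs; exact ha.ne hs.symm
    · simp at hs; exact hb.ne hs
  have h3 : rectIntegral a b τ (fun s => A s / (s - w))
      = rectIntegral a b τ (fun s => dslope A w s + A w * (s - w)⁻¹) := by
    refine rectIntegral_congr fun s hs => ?_
    have := sub_ne_zero.2 (hne s hs)
    rw [dslope_of_ne _ (hne s hs), slope_def_field]
    field_simp
    ring
  have hcD : ∀ s : ℂ, a ≤ s.re → s.re ≤ b → |s.im| ≤ τ → ContinuousAt (dslope A w) s :=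
    fun s h1 h2 h3 => (hD.differentiableAt (hU.mem_nhds (hsub s h1 h2 h3))).continuousAt
  have hadd : rectIntegral a b τ (fun s => dslope A w s + A w * (s - w)⁻¹)
      = rectIntegral a b τ (dslope A w) + A w * rectIntegral a b τ (fun s => (s - w)⁻¹) := by
    have hab : a ≤ b := (ha.trans hb).le
    have key : ∀ (p q : ℝ) (c : ℝ → ℂ), Continuous c → p ≤ q →
        (∀ y ∈ Icc p q, a ≤ (c y).re ∧ (c y).re ≤ b ∧ |(c y).im| ≤ τ ∧ c y ≠ w) →
        ∫ y in p..q, (dslope A w (c y) + A w * (c y - w)⁻¹)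
          = (∫ y in p..q, dslope A w (c y)) + A w * ∫ y in p..q, (c y - w)⁻¹ := by
      intro p q c hc hpq hh
      rw [← intervalIntegral.integral_const_mul, ← intervalIntegral.integral_add]
      · refine ContinuousOn.intervalIntegrable fun y hy => ?_
        rw [uIcc_of_le hpq] at hy
        obtain ⟨k1, k2, k3, _⟩ := hh y hy
        exact (ContinuousAt.comp (hcD _ k1 k2 k3) hc.continuousAt).continuousWithinAt
      · refine ContinuousOn.intervalIntegrable fun y hy => ?_
        rw [uIcc_of_le hpq] at hy
        obtain ⟨_, _, _, k4⟩ := hh y hy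
        have : ContinuousAt (fun y => (c y - w)⁻¹) y :=
          ContinuousAt.inv₀ (hc.continuousAt.sub continuousAt_const) (sub_ne_zero.2 k4)
        exact (this.const_mul _).continuousWithinAt
    have hτ2 : -τ ≤ τ := by linarith
    rw [rectIntegral, rectIntegral, rectIntegral,
      key a b (fun x => (x : ℂ) - τ * I) (by fun_prop) hab, key a b (fun x => (x : ℂ) + τ * I)
        (by fun_prop) hab, key (-τ) τ (fun y => (b : ℂ) + y * I) (by fun_prop) hτ2,
      key (-τ) τ (fun y => (a : ℂ) + y * I) (by fun_prop) hτ2]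
    · ring
    · intro y hy
      refine ⟨by simp, by simpa using hab, by simpa using abs_le.2 hy, hne _ (Or.inr (Or.inl (by simp)))⟩
    · intro y hy
      refine ⟨by simpa using hab, by simp, by simpa using abs_le.2 hy, hne _ (Or.inr (Or.inr (by simp)))⟩
    · intro x hx
      refine ⟨by simpa using hx.1, by simpa using hx.2, by simp [abs_of_pos hτ],
        hne _ (Or.inl ⟨by simpa [uIcc_of_le hab] using hx, by simp⟩)⟩
    · intro x hx
      refine ⟨by simpa using hx.1, by simpa using hx.2, by simp [abs_of_pos hτ],
        hne _ (Or.inl ⟨by simpa [uIcc_of_le hab] using hx, by simp⟩)⟩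
  rw [h3, hadd, h0, h2]
  ring

/-! ## Decay and regularity of the Mellin-Barnes integrand -/

lemma leftDecay_of_tendsto {Φ : ℂ → ℂ} {Q : ℂ → ℝ} {ℓ : ℝ} (hℓ : ℓ < 1)
    (hQ : Tendsto Q (Bornology.cobounded ℂ) (𝓝 ℓ))
    (h : ∀ᶠ s in Bornology.cobounded ℂ, ‖Φ (s - 1)‖ ≤ Q s * ‖Φ s‖) : LeftDecay Φ := by
  obtain ⟨r, hr1, hr2⟩ := exists_between (max_lt hℓ zero_lt_one)
  have h1 : ∀ᶠ s in Bornology.cobounded ℂ, ‖Φ (s - 1)‖ ≤ r * ‖Φ s‖ := by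
    filter_upwards [h, hQ.eventually (eventually_lt_nhds ((le_max_left _ _).trans_lt hr1))]
      with s h1 h2
    exact h1.trans (by gcongr)
  obtain ⟨M, -, hM⟩ := (hasBasis_cobounded_norm (E := ℂ)).eventually_iff.1 h1
  exact ⟨r, M, (le_max_right _ _).trans_lt hr1, hr2, fun s hs => hM hs⟩

lemma tendsto_norm_add_div_norm (c : ℂ) :
    Tendsto (fun s : ℂ => ‖c + s‖ / ‖s‖) (Bornology.cobounded ℂ) (𝓝 1) := by
  have h1 : Tendsto (fun s : ℂ => ‖c * s⁻¹ + 1‖) (Bornology.cobounded ℂ) (𝓝 1) := by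
    have := ((tendsto_inv₀_cobounded (α := ℂ)).const_mul c).add_const 1
    simpa using this.norm
  refine h1.congr' ?_
  filter_upwards [Bornology.eventually_ne_cobounded (0 : ℂ)] with s hs
  rw [← norm_div, add_div, div_self hs, div_eq_mul_inv]

lemma tendsto_norm_list_prod_div {α : Type*} (l : List α) (f : α → ℂ → ℂ)
    (hf : ∀ c, Tendsto (fun s : ℂ => ‖f c s‖ / ‖s‖) (Bornology.cobounded ℂ) (𝓝 1)) :
    Tendsto (fun s : ℂ => ‖(l.map fun c => f c s).prod‖ / ‖s‖ ^ l.length)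
      (Bornology.cobounded ℂ) (𝓝 1) := by
  induction l with
  | nil => simp
  | cons a l ih =>
    have := (hf a).mul ih
    rw [mul_one] at this
    refine this.congr fun s => ?_
    simp only [List.map_cons, List.prod_cons, norm_mul, List.length_cons, pow_succ]
    rw [div_mul_div_comm, mul_comm (‖s‖ ^ l.length)]

lemma list_prod_Gamma_shift_right (l : List ℂ) (s : ℂ) (h : ∀ b ∈ l, b + s - 1 ≠ 0) :
    (l.map fun b => Gamma (b + s)).prod
      = (l.map fun b => b + s - 1).prod * (l.map fun b => Gamma (b + (s - 1))).prod := by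
  induction l with
  | nil => simp
  | cons b l ih =>
    simp only [List.map_cons, List.prod_cons]
    rw [ih fun b hb => h b (List.mem_cons_of_mem _ hb)]
    have := Complex.Gamma_add_one (b + s - 1) (h b List.mem_cons_self)
    rw [sub_add_cancel] at this
    rw [this, ← add_sub_assoc]
    ring

lemma list_prod_Gamma_shift_left (l : List ℂ) (s : ℂ) (h : ∀ a ∈ l, 1 - a - s ≠ 0) :
    (l.map fun a => Gamma (1 - a - (s - 1))).prod
      = (l.map fun a => 1 - a - s).prod * (l.map fun a => Gamma (1 - a - s)).prod := by
  induction l with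
  | nil => simp
  | cons b l ih =>
    simp only [List.map_cons, List.prod_cons]
    rw [ih fun b hb => h b (List.mem_cons_of_mem _ hb)]
    have := Complex.Gamma_add_one (1 - b - s) (h b List.mem_cons_self)
    rw [show 1 - b - (s - 1) = 1 - b - s + 1 by ring, this]
    ring

lemma eventually_list_ne {α : Type*} (l : List α) (c : α → ℂ) :
    ∀ᶠ s in Bornology.cobounded ℂ, ∀ b ∈ l, s ≠ c b := by
  induction l with
  | nil => simp
  | cons b l ih =>
    filter_upwards [ih, Bornology.eventually_ne_cobounded (c b)] with s h1 h2
    simpa using ⟨h2, h1⟩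

lemma list_prod_map_ne_zero {α : Type*} {l : List α} {f : α → ℂ} (h : ∀ a ∈ l, f a ≠ 0) :
    (l.map f).prod ≠ 0 := by
  simpa [List.prod_eq_zero_iff] using h

/-- The functional equation of Γ shows that the value at s-1 divided by the value at s is z times a
rational function of s with numerator degree p and denominator degree q. Its modulus tends to 0 if p
< q and to ‖z‖ if p = q. -/
lemma leftDecay_meijerIntegrand (as as' bs bs' : List ℂ) {z : ℂ} (hz : z ≠ 0)
    (h : as.length + as'.length < bs.length + bs'.length ∨
      (as.length + as'.length = bs.length + bs'.length ∧ ‖z‖ < 1)) :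
    LeftDecay (meijerIntegrand as as' bs bs' z) := by
  set p : ℂ → ℂ := fun s => (as.map fun a => 1 - a - s).prod
  set p' : ℂ → ℂ := fun s => (as'.map fun a => a + s - 1).prod
  set q : ℂ → ℂ := fun s => (bs.map fun a => a + s - 1).prod
  set q' : ℂ → ℂ := fun s => (bs'.map fun a => 1 - a - s).prod
  have t1 : ∀ c : ℂ, Tendsto (fun s : ℂ => ‖c + s - 1‖ / ‖s‖) (Bornology.cobounded ℂ) (𝓝 1) :=
    fun c => (tendsto_norm_add_div_norm (c - 1)).congr fun s => by ring_nf
  have t2 : ∀ c : ℂ, Tendsto (fun s : ℂ => ‖1 - c - s‖ / ‖s‖) (Bornology.cobounded ℂ) (𝓝 1) :=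
    fun c => (tendsto_norm_add_div_norm (c - 1)).congr fun s => by
      rw [← norm_neg]; ring_nf
  have hp := tendsto_norm_list_prod_div as _ t2
  have hp' := tendsto_norm_list_prod_div as' _ t1
  have hq := tendsto_norm_list_prod_div bs _ t1
  have hq' := tendsto_norm_list_prod_div bs' _ t2
  have hmain : ∃ ℓ < 1, Tendsto (fun s : ℂ => ‖s‖ ^ (as.length + as'.length)
      / ‖s‖ ^ (bs.length + bs'.length) * ‖z‖) (Bornology.cobounded ℂ) (𝓝 ℓ) := by
    rcases h with h | ⟨h, hz1⟩
    · refine ⟨0, one_pos, ?_⟩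
      obtain ⟨k, hk⟩ := Nat.exists_eq_add_of_lt h
      have h1 : Tendsto (fun s : ℂ => ‖s⁻¹‖ ^ (k + 1) * ‖z‖) (Bornology.cobounded ℂ) (𝓝 0) := by
        have := ((tendsto_inv₀_cobounded (α := ℂ)).norm.pow (k + 1)).mul_const ‖z‖
        simpa using this
      refine h1.congr' ?_
      filter_upwards [Bornology.eventually_ne_cobounded (0 : ℂ)] with s hs
      have hs' : ‖s‖ ≠ 0 := norm_ne_zero_iff.2 hs
      rw [hk, add_assoc, pow_add ‖s‖ _ (k + 1), norm_inv, inv_pow]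
      field_simp
    · refine ⟨‖z‖, hz1, tendsto_const_nhds.congr' ?_⟩
      filter_upwards [Bornology.eventually_ne_cobounded (0 : ℂ)] with s hs
      have hs' : ‖s‖ ≠ 0 := norm_ne_zero_iff.2 hs
      rw [h, div_self (by positivity), one_mul]
  obtain ⟨ℓ, hℓ, hlim⟩ := hmain
  have hQ := ((hp.mul hp').div (hq.mul hq') (by norm_num)).mul hlim
  rw [mul_one, div_one, one_mul] at hQ
  refine leftDecay_of_tendsto hℓ hQ ?_
  -- Only the zeros of the linear factors must be avoided. With the value 0 of Γ at its poles, the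
  -- equation Γ(s+1) = sΓ(s) holds for every nonzero s, so the poles themselves need no exclusion.
  filter_upwards [eventually_list_ne as fun a => 1 - a, eventually_list_ne as' fun a => 1 - a,
    eventually_list_ne bs fun a => 1 - a, eventually_list_ne bs' fun a => 1 - a,
    Bornology.eventually_ne_cobounded (0 : ℂ)] with s h1 h2 h3 h4 hs
  have e1 : ∀ {l : List ℂ}, (∀ a ∈ l, s ≠ 1 - a) → ∀ a ∈ l, 1 - a - s ≠ 0 := fun hl a ha h0 =>
    hl a ha (by linear_combination -h0)
  have e2 : ∀ {l : List ℂ}, (∀ a ∈ l, s ≠ 1 - a) → ∀ a ∈ l, a + s - 1 ≠ 0 := fun hl a ha h0 =>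
    hl a ha (by linear_combination h0)
  have hq0 : q s ≠ 0 := list_prod_map_ne_zero (e2 h3)
  have hq0' : q' s ≠ 0 := list_prod_map_ne_zero (e1 h4)
  have hp0' : p' s ≠ 0 := list_prod_map_ne_zero (e2 h2)
  have key : meijerIntegrand as as' bs bs' z (s - 1)
      = p s * p' s / (q s * q' s) * z * meijerIntegrand as as' bs bs' z s := by
    simp only [meijerIntegrand, meijerKernel]
    rw [list_prod_Gamma_shift_left as s (e1 h1), list_prod_Gamma_shift_left bs' s (e1 h4),
      list_prod_Gamma_shift_right bs s (e2 h3), list_prod_Gamma_shift_right as' s (e2 h2),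
      show -(s - 1) = -s + 1 by ring, cpow_add _ _ hz, cpow_one]
    change _ * (p s * _) / ((q' s * _) * _) * _ = _ * _ * ((q s * _) * _ / (_ * (p' s * _)) * _)
    field_simp
  rw [key, norm_mul, norm_mul, norm_div, norm_mul, norm_mul]
  have hs' : ‖s‖ ≠ 0 := norm_ne_zero_iff.2 hs
  refine le_of_eq ?_
  congr 1
  change _ = ‖p s‖ / _ * (‖p' s‖ / _) / (‖q s‖ / _ * (‖q' s‖ / _)) * _
  have h5 : ‖q s‖ ≠ 0 := norm_ne_zero_iff.2 hq0
  have h6 : ‖q' s‖ ≠ 0 := norm_ne_zero_iff.2 hq0'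
  rw [pow_add, pow_add]
  field_simp

/-- ‖s‖/‖s-1‖ tends to 1, so any ratio r < 1 leaves room for the extra factor. It is applied twice,
to reach the kernel divided by s². -/
lemma LeftDecay.div_id {Φ : ℂ → ℂ} (h : LeftDecay Φ) : LeftDecay fun s => Φ s / s := by
  obtain ⟨r, M, hr, hr1, h⟩ := h
  have hQ : Tendsto (fun s : ℂ => r * (‖(-1 : ℂ) + s‖ / ‖s‖)⁻¹) (Bornology.cobounded ℂ)
      (𝓝 (r * 1⁻¹)) := ((tendsto_norm_add_div_norm (-1)).inv₀ one_ne_zero).const_mul r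
  refine leftDecay_of_tendsto (by simpa using hr1) hQ ?_
  have hM : ∀ᶠ s in Bornology.cobounded ℂ, M ≤ ‖s‖ :=
    tendsto_norm_cobounded_atTop.eventually (eventually_ge_atTop M)
  filter_upwards [hM, Bornology.eventually_ne_cobounded (0 : ℂ), Bornology.eventually_ne_cobounded (1 : ℂ)]
    with s h1 h2 h3
  have h4 : ‖s‖ ≠ 0 := norm_ne_zero_iff.2 h2
  have h5 : ‖s - 1‖ ≠ 0 := norm_ne_zero_iff.2 (sub_ne_zero.2 h3)
  rw [norm_div, norm_div, neg_add_eq_sub, inv_div]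
  calc ‖Φ (s - 1)‖ / ‖s - 1‖ ≤ r * ‖Φ s‖ / ‖s - 1‖ := by gcongr; exact h s h1
    _ = _ := by field_simp

lemma differentiableAt_list_prod {α : Type*} {l : List α} {f : α → ℂ → ℂ} {s : ℂ}
    (h : ∀ a ∈ l, DifferentiableAt ℂ (f a) s) :
    DifferentiableAt ℂ (fun s => (l.map fun a => f a s).prod) s := by
  induction l with
  | nil => simp
  | cons a l ih =>
    simp only [List.map_cons, List.prod_cons]
    exact (h a List.mem_cons_self).fun_mul (ih fun b hb => h b (List.mem_cons_of_mem _ hb))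

lemma ne_neg_nat_of {s : ℂ} (h : s.im ≠ 0 ∨ 0 < s.re) (n : ℕ) : s ≠ -n := by
  rintro rfl
  rcases h with h | h
  · simp at h
  · simp at h
    linarith [n.cast_nonneg (α := ℝ)]

lemma list_prod_map_inv {α : Type*} (l : List α) (f : α → ℂ) :
    (l.map fun a => (f a)⁻¹).prod = (l.map f).prod⁻¹ := by
  induction l with
  | nil => simp
  | cons a l ih => simp [ih, mul_comm]

/-- 1/Γ is entire, and the inverse of the default value 0 at the poles of Γ is its correct value
there. The denominator of the kernel therefore imposes no condition. -/
lemma differentiableAt_list_prod_Gamma_inv (l : List ℂ) (u : ℂ → ℂ → ℂ)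
    (hu : ∀ a, Differentiable ℂ (u a)) (s : ℂ) :
    DifferentiableAt ℂ (fun s => ((l.map fun a => Gamma (u a s)).prod)⁻¹) s := by
  have : (fun s => ((l.map fun a => Gamma (u a s)).prod)⁻¹)
      = fun s => (l.map fun a => (Gamma (u a s))⁻¹).prod := by
    ext s
    rw [list_prod_map_inv]
  rw [this]
  exact differentiableAt_list_prod fun a _ =>
    (differentiable_one_div_Gamma _).comp s (hu a s)

lemma differentiableAt_meijerKernel {as as' bs bs' : List ℂ} {s : ℂ}
    (h1 : ∀ b ∈ bs, (b + s).im ≠ 0 ∨ 0 < (b + s).re)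
    (h2 : ∀ a ∈ as, (1 - a - s).im ≠ 0 ∨ 0 < (1 - a - s).re) :
    DifferentiableAt ℂ (meijerKernel as as' bs bs') s := by
  have e : meijerKernel as as' bs bs' = fun s =>
      ((bs.map fun b => Gamma (b + s)).prod * (as.map fun a => Gamma (1 - a - s)).prod)
      * (((bs'.map fun b => Gamma (1 - b - s)).prod)⁻¹
        * ((as'.map fun a => Gamma (a + s)).prod)⁻¹) := by
    ext s
    rw [meijerKernel, div_eq_mul_inv, mul_inv]
  rw [e]
  refine ((differentiableAt_list_prod fun b hb => ?_).fun_mul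
    (differentiableAt_list_prod fun a ha => ?_)).fun_mul
    ((differentiableAt_list_prod_Gamma_inv bs' (fun b s => 1 - b - s) (fun a => by fun_prop)
      s).fun_mul
    (differentiableAt_list_prod_Gamma_inv as' (fun b s => b + s) (fun a => by fun_prop) s))
  · exact (differentiableAt_Gamma _ (ne_neg_nat_of (h1 b hb))).comp s (by fun_prop)
  · exact (differentiableAt_Gamma _ (ne_neg_nat_of (h2 a ha))).comp s (by fun_prop)

lemma differentiableAt_const_cpow_neg {z : ℂ} (hz : z ≠ 0) (s : ℂ) :
    DifferentiableAt ℂ (fun s => z ^ (-s)) s :=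
  differentiableAt_id.neg.const_cpow (Or.inl hz)

/-! ## The left loop as a sum of residues -/

lemma tendsto_sub_natCast_atBot (c : ℝ) : Tendsto (fun n : ℕ => c - (n : ℝ)) atTop atBot :=
  tendsto_atBot_add_const_left _ c (tendsto_neg_atTop_atBot.comp tendsto_natCast_atTop_atTop)

/-- The segment moves by unit steps, so the decay inequality transports a bound on one segment to
all later ones with a factor r^k. Continuity is required only on these segments, which can be placed
between poles. -/
lemma LeftDecay.tendsto_vertical {Φ : ℂ → ℂ} (h : LeftDecay Φ) {c t₁ t₂ : ℝ} (ht : t₁ ≤ t₂)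
    (hd : ∀ n : ℕ, ∀ y ∈ Icc t₁ t₂, ContinuousAt Φ (((c - n : ℝ) : ℂ) + y * I)) :
    Tendsto (fun n : ℕ => ∫ y in t₁..t₂, Φ (((c - n : ℝ) : ℂ) + y * I)) atTop (𝓝 0) := by
  obtain ⟨r, b, hr, hr1, h⟩ := h.horizontal
  obtain ⟨N, hN⟩ := exists_nat_ge (c - b)
  obtain ⟨C, hC⟩ := (isCompact_Icc (a := t₁) (b := t₂)).exists_bound_of_continuousOn
    (f := fun y : ℝ => Φ (((c - N : ℝ) : ℂ) + y * I)) fun y hy =>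
      (ContinuousAt.comp (f := fun y : ℝ => ((c - N : ℝ) : ℂ) + y * I) (hd N y hy)
        (by fun_prop)).continuousWithinAt
  have hC0 : 0 ≤ C := (norm_nonneg _).trans (hC t₁ ⟨le_rfl, ht⟩)
  rw [← tendsto_add_atTop_iff_nat N]
  have hb : ∀ k : ℕ, ‖∫ y in t₁..t₂, Φ (((c - (k + N : ℕ) : ℝ) : ℂ) + y * I)‖
      ≤ r ^ k * C * |t₂ - t₁| := by
    intro k
    refine intervalIntegral.norm_integral_le_of_norm_le_const fun y hy => ?_
    rw [uIoc_of_le ht] at hy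
    have h5 := le_pow_mul_of_shift (f := fun x : ℝ => ‖Φ ((x : ℂ) + y * I)‖) hr.le (h y) k
      (c - (k + N : ℕ)) (by push_cast; linarith)
    have h6 : c - ((k + N : ℕ) : ℝ) + k = c - N := by push_cast; ring
    simp only [h6] at h5
    exact h5.trans (mul_le_mul_of_nonneg_left (hC y ⟨hy.1.le, hy.2⟩) (by positivity))
  refine squeeze_zero_norm hb ?_
  have := ((tendsto_pow_atTop_nhds_zero_of_lt_one hr.le hr1).mul_const C).mul_const |t₂ - t₁|
  simpa using this

lemma tendsto_leftLoopIntegral_atBot {Φ : ℂ → ℂ} (h : LeftDecay Φ) {c τ : ℝ} (hτ : 0 < τ)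
    (hd : ∀ n : ℕ, ∀ y : ℝ, ContinuousAt Φ (((c - n : ℝ) : ℂ) + y * I)) :
    Tendsto (fun n : ℕ => leftLoopIntegral (c - n) τ Φ) atTop (𝓝 0) := by
  have ha := tendsto_sub_natCast_atBot c
  have h1 := tendsto_integral_Iic_zero (μ := volume) (f := fun x : ℝ => Φ (x - τ * I)) ha
  have h2 := tendsto_integral_Iic_zero (μ := volume) (f := fun x : ℝ => Φ (x + τ * I)) ha
  have h3 := h.tendsto_vertical (c := c) (show -τ ≤ τ by linarith) fun n y _ => hd n y
  have := ((h1.add (h3.const_mul I)).sub h2).const_mul (2 * Real.pi * I)⁻¹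
  simpa [leftLoopIntegral] using this

lemma Gamma_eq_div_prod (n : ℕ) (s : ℂ) (h : ∀ j < n, s ≠ -j) :
    Gamma s * ∏ j ∈ Finset.range n, (s + j) = Gamma (s + n) := by
  induction n with
  | zero => simp
  | succ n ih =>
    rw [Finset.prod_range_succ, ← mul_assoc, ih fun j hj => h j (hj.trans n.lt_succ_self),
      mul_comm, Nat.cast_succ, ← add_assoc, Complex.Gamma_add_one _ fun h0 =>
        h n n.lt_succ_self (by linear_combination h0)]

lemma prod_neg_add (n : ℕ) :
    ∏ j ∈ Finset.range n, (-(n : ℂ) + j) = (-1) ^ n * n.factorial := by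
  induction n with
  | zero => simp
  | succ n ih =>
    rw [Finset.prod_range_succ', Nat.factorial_succ]
    have : ∀ j ∈ Finset.range n, (-((n + 1 : ℕ) : ℂ) + (j + 1 : ℕ)) = -(n : ℂ) + j := by
      intro j _; push_cast; ring
    rw [Finset.prod_congr rfl this, ih]
    push_cast
    ring

/-- This is the residue (-1)^n/n! of Γ at -n, seen from Γ(s) = Γ(s+n+1)/(s(s+1)⋯(s+n)). The left
side lies half a unit beyond -n, and the condition on b keeps -n+1 outside; for n = 0 there is no
further pole of Γ to the right. -/
lemma rectIntegral_Gamma_mul {B : ℂ → ℂ} {σ₁ b τ : ℝ} (n : ℕ) (hτ : 0 < τ)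
    (hB : ∀ s : ℂ, s.re < σ₁ → DifferentiableAt ℂ B s) (hb : b < σ₁) (hb0 : -(n : ℝ) < b)
    (hbn : n ≠ 0 → b < -n + 1) :
    rectIntegral (-(1 / 2) - n) b τ (fun s => Gamma s * B s)
      = 2 * Real.pi * I * ((-1) ^ n / n.factorial * B (-n)) := by
  set U : Set ℂ := {s | s.re < σ₁ ∧ -(n : ℝ) - 1 < s.re ∧ (n = 0 ∨ s.re < -n + 1)} with hU
  have hUo : IsOpen U := by
    rcases eq_or_ne n 0 with h0 | h0
    · have : U = {s | s.re < σ₁} ∩ {s | -(n : ℝ) - 1 < s.re} := by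
        ext s; simp [hU, h0]
      rw [this]
      exact (isOpen_lt continuous_re continuous_const).inter
        (isOpen_lt continuous_const continuous_re)
    · have : U = {s | s.re < σ₁} ∩ ({s | -(n : ℝ) - 1 < s.re} ∩ {s | s.re < -(n : ℝ) + 1}) := by
        ext s; simp [hU, h0]
      rw [this]
      exact (isOpen_lt continuous_re continuous_const).inter
        ((isOpen_lt continuous_const continuous_re).inter
          (isOpen_lt continuous_re continuous_const))
  have hUne : ∀ s ∈ U, ∀ j < n, s ≠ -j := by
    rintro s ⟨-, -, h3⟩ j hj rfl
    rcases h3 with h3 | h3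
    · omega
    · simp at h3
      have : (j : ℝ) + 1 ≤ n := by exact_mod_cast hj
      linarith
  set A : ℂ → ℂ := fun s => Gamma (s + (n + 1 : ℕ)) / (∏ j ∈ Finset.range n, (s + j)) * B s
  have hA : DifferentiableOn ℂ A U := by
    intro s hs
    refine DifferentiableAt.differentiableWithinAt ?_
    refine DifferentiableAt.fun_mul (DifferentiableAt.fun_div ?_ ?_ ?_) (hB s hs.1)
    · refine (differentiableAt_Gamma _ (ne_neg_nat_of (Or.inr ?_))).comp s (by fun_prop)
      have := hs.2.1
      simp
      linarith
    · exact DifferentiableAt.fun_finsetProd fun j _ => by fun_prop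
    · exact Finset.prod_ne_zero_iff.2 fun j hj h0 =>
        hUne s hs j (Finset.mem_range.1 hj) (by linear_combination h0)
  have hsub : ∀ s : ℂ, -(1 / 2) - (n : ℝ) ≤ s.re → s.re ≤ b → |s.im| ≤ τ → s ∈ U := by
    intro s h1 h2 _
    refine ⟨by linarith, by linarith, ?_⟩
    rcases eq_or_ne n 0 with h0 | h0
    · exact Or.inl h0
    · exact Or.inr (by linarith [hbn h0])
  have h1 := rectIntegral_residue (a := -(1 / 2) - n) (b := b) (w := -(n : ℝ)) (by linarith) hb0
    hτ hUo hA hsub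
  have h2 : rectIntegral (-(1 / 2) - n) b τ (fun s => Gamma s * B s)
      = rectIntegral (-(1 / 2) - n) b τ (fun s => A s / (s - (-(n : ℝ) : ℝ))) := by
    refine rectIntegral_congr fun s hs => ?_
    have hsn : ∀ j < n + 1, s ≠ -j := by
      rintro j hj rfl
      have hj' : (j : ℝ) ≤ n := by exact_mod_cast Nat.lt_succ_iff.1 hj
      rcases hs with hs | hs | hs
      · simp only [neg_im, natCast_im, neg_zero, abs_zero] at hs
        exact (abs_pos.2 hτ.ne').ne hs.2
      · simp at hs
        linarith
      · simp at hs
        rcases Nat.lt_succ_iff_lt_or_eq.1 hj with h | rfl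
        · have h4 : (j : ℝ) + 1 ≤ n := by exact_mod_cast h
          linarith [hbn (by omega)]
        · linarith
    have h4 := Gamma_eq_div_prod (n + 1) s hsn
    rw [Finset.prod_range_succ] at h4
    have h5 : ∏ j ∈ Finset.range n, (s + j) ≠ 0 := Finset.prod_ne_zero_iff.2 fun j hj h0 =>
        hsn j (by have := Finset.mem_range.1 hj; omega) (by linear_combination h0)
    have h6 : s + n ≠ 0 := fun h0 => hsn n (by omega) (by linear_combination h0)
    simp only [A]
    rw [← h4]
    push_cast
    rw [sub_neg_eq_add]
    field_simp
  rw [h2, h1]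
  simp only [A]
  push_cast
  rw [prod_neg_add, neg_add_cancel_left, Complex.Gamma_one]
  congr 2
  rcases neg_one_pow_eq_or ℂ n with h | h <;> rw [h] <;> simp [div_neg, neg_div]

/-- The loop is pushed to the left through the half-integers -1/2-N, picking up one residue at each
step, and the remaining loop tends to 0. Only convergence of the ordered partial sums is obtained
here. -/
lemma tendsto_sum_residues {B : ℂ → ℂ} {σ σ₁ τ : ℝ} (hσ : 0 < σ) (hσ₁ : σ < σ₁) (hτ : 0 < τ)
    (h : LeftDecay fun s => Gamma s * B s)
    (hB : ∀ s : ℂ, s.im ≠ 0 ∨ s.re < σ₁ → DifferentiableAt ℂ B s) :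
    Tendsto (fun N : ℕ => ∑ n ∈ Finset.range N, ((-1) ^ n / n.factorial * B (-n))) atTop
      (𝓝 (leftLoopIntegral σ τ fun s => Gamma s * B s)) := by
  set Φ : ℂ → ℂ := fun s => Gamma s * B s
  have hΦ : ∀ s : ℂ, s.im ≠ 0 ∨ s.re < σ₁ → (∀ m : ℕ, s ≠ -m) → DifferentiableAt ℂ Φ s :=
    fun s hs hs' => (differentiableAt_Gamma s hs').fun_mul (hB s hs)
  have hd : ∀ s : ℂ, |s.im| = |τ| → DifferentiableAt ℂ Φ s := by
    intro s hs
    have : s.im ≠ 0 := abs_pos.1 (by rw [hs]; exact abs_pos.2 hτ.ne')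
    exact hΦ s (Or.inl this) (ne_neg_nat_of (Or.inl this))
  have hpi : (2 * Real.pi * I : ℂ) ≠ 0 := by simp [Real.pi_ne_zero]
  have hsum : ∀ N : ℕ, ∑ n ∈ Finset.range (N + 1), ((-1) ^ n / n.factorial * B (-n))
      = leftLoopIntegral σ τ Φ - leftLoopIntegral (-(1 / 2) - N) τ Φ := by
    intro N
    induction N with
    | zero =>
      have h1 := leftLoopIntegral_sub (a := -(1 / 2) - (0 : ℕ)) (b := σ) h hd
      rw [rectIntegral_Gamma_mul (σ₁ := σ₁) 0 hτ (fun s hs => hB s (Or.inr hs)) hσ₁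
        (by simpa using hσ) (by simp), inv_mul_cancel_left₀ hpi] at h1
      rw [h1]
      simp
    | succ N ih =>
      have h1 := leftLoopIntegral_sub (a := -(1 / 2) - (N + 1 : ℕ)) (b := -(1 / 2) - N) h hd
      rw [rectIntegral_Gamma_mul (σ₁ := σ₁) (N + 1) hτ (fun s hs => hB s (Or.inr hs))
        (by linarith [N.cast_nonneg (α := ℝ)]) (by push_cast; linarith)
        (fun _ => by push_cast; linarith), inv_mul_cancel_left₀ hpi] at h1
      rw [Finset.sum_range_succ, ih, ← h1]
      ring
  rw [← tendsto_add_atTop_iff_nat 1]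
  simp_rw [hsum]
  have := (tendsto_leftLoopIntegral_atBot h (c := -(1 / 2)) hτ fun n y => by
    refine (hΦ _ (Or.inr ?_) ?_).continuousAt
    · simp
      linarith [n.cast_nonneg (α := ℝ)]
    · intro m hm
      have h2 := congrArg Complex.re hm
      simp at h2
      have h3 : (2 * m : ℝ) = 2 * n + 1 := by linarith
      have h4 : 2 * m = 2 * n + 1 := by exact_mod_cast h3
      omega).const_sub (leftLoopIntegral σ τ Φ)
  simpa using this

lemma meijerAdmissible_exists {as bs : List ℝ} (h : ∀ b ∈ bs, ∀ a ∈ as, -b < 1 - a) :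
    ∃ c : ℝ × ℝ, MeijerAdmissible (as.map (↑)) (bs.map (↑)) c := by
  have : ∃ σ : ℝ, (∀ b ∈ bs, -b < σ) ∧ ∀ a ∈ as, σ < 1 - a := by
    obtain ⟨σ, h1, h2⟩ := Order.exists_between_finsets (bs.map fun b => -b).toFinset
      (as.map fun a => 1 - a).toFinset (by
        simp only [List.mem_toFinset, List.mem_map, forall_exists_index, and_imp,
          forall_apply_eq_imp_iff₂]
        exact h)
    simp only [List.mem_toFinset, List.mem_map, forall_exists_index, and_imp,
      forall_apply_eq_imp_iff₂] at h1 h2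
    exact ⟨σ, h1, h2⟩
  obtain ⟨σ, h1, h2⟩ := this
  refine ⟨(σ, 1), one_pos, ?_, ?_⟩
  · intro b hb
    obtain ⟨b, hb', rfl⟩ := List.mem_map.1 hb
    exact ⟨by simpa using h1 b hb', by simp⟩
  · intro b hb
    obtain ⟨b, hb', rfl⟩ := List.mem_map.1 hb
    exact ⟨by simpa using h2 b hb', by simp⟩

/-- The power series of `G^{1,n}_{n,q}(-x)`. -/
theorem meijerG_neg_eq_tsum (as bs' : List ℝ) {x : ℝ} (hx : 0 < x) (has : ∀ a ∈ as, a < 1)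
    (hbs : ∀ b ∈ bs', b < 1)
    (hlen : as.length < 1 + bs'.length ∨ (as.length = 1 + bs'.length ∧ x < 1)) :
    Summable (fun n : ℕ => (as.map fun a => Real.Gamma (1 - a + n)).prod
      / (bs'.map fun b => Real.Gamma (1 - b + n)).prod * (x ^ n / n.factorial)) ∧
    meijerG (as.map (↑)) [] [0] (bs'.map (↑)) (-(x : ℂ))
      = ((∑' n : ℕ, (as.map fun a => Real.Gamma (1 - a + n)).prod
        / (bs'.map fun b => Real.Gamma (1 - b + n)).prod * (x ^ n / n.factorial) : ℝ) : ℂ) := by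
  set t : ℕ → ℝ := fun n => (as.map fun a => Real.Gamma (1 - a + n)).prod
      / (bs'.map fun b => Real.Gamma (1 - b + n)).prod * (x ^ n / n.factorial) with ht
  have hz : (-(x : ℂ)) ≠ 0 := by simpa using hx.ne'
  have hadm : ∃ c : ℝ × ℝ, MeijerAdmissible (as.map (↑)) [0] c := by
    have := meijerAdmissible_exists (as := as) (bs := [0]) (by simpa using has)
    simpa only [List.map_cons, List.map_nil, Complex.ofReal_zero] using this
  have hle : as.length ≤ 1 + bs'.length := by omega
  -- A negative number has argument π, while the aperture is (1 + (p-q)/2)π ≤ π. The definition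
  -- therefore selects a loop, and by the length condition the left one.
  have harg : ¬ |(-(x : ℂ)).arg| < ((([0] : List ℂ).length + (as.map ((↑) : ℝ → ℂ)).length : ℝ)
        - (((as.map ((↑) : ℝ → ℂ)).length + ([] : List ℂ).length)
          + (([0] : List ℂ).length + (bs'.map ((↑) : ℝ → ℂ)).length)) / 2) * Real.pi := by
    rw [← Complex.ofReal_neg, Complex.arg_ofReal_of_neg (neg_lt_zero.2 hx), abs_of_pos Real.pi_pos, not_lt]
    have : (as.length : ℝ) ≤ 1 + bs'.length := by exact_mod_cast hle
    simp only [List.length_map, List.length_nil, List.length_cons]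
    push_cast
    nlinarith [Real.pi_pos]
  have hlen2 : (as.map ((↑) : ℝ → ℂ)).length + ([] : List ℂ).length
      < ([0] : List ℂ).length + (bs'.map ((↑) : ℝ → ℂ)).length ∨
      ((as.map ((↑) : ℝ → ℂ)).length + ([] : List ℂ).length
      = ([0] : List ℂ).length + (bs'.map ((↑) : ℝ → ℂ)).length ∧ ‖(-(x : ℂ))‖ < 1) := by
    simpa [abs_of_pos hx] using hlen
  rw [meijerG, dif_pos hadm, if_neg harg, if_pos hlen2]
  obtain ⟨hτ, hσ, hσ₁⟩ := hadm.choose_spec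
  set σ := hadm.choose.1
  set τ := hadm.choose.2
  have hσ0 : 0 < σ := by simpa using (hσ 0 (by simp)).1
  -- A little room to the right of σ, still left of all poles of the Γ(1-a-s), provides an open half
  -- plane on which the cofactor of Γ(s) is holomorphic.
  obtain ⟨σ₁, h1, h2⟩ : ∃ σ₁ : ℝ, σ < σ₁ ∧ ∀ a ∈ as, σ₁ ≤ 1 - a := by
    obtain ⟨σ₁, h1, h2⟩ := Order.exists_between_finsets {σ}
      (as.map fun a => 1 - a).toFinset (by
        simp only [Finset.mem_singleton, List.mem_toFinset, List.mem_map, forall_exists_index,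
          and_imp, forall_apply_eq_imp_iff₂, forall_eq]
        intro a ha
        simpa using (hσ₁ a (List.mem_map.2 ⟨a, ha, rfl⟩)).1)
    simp only [List.mem_toFinset, List.mem_map, forall_exists_index, and_imp,
      forall_apply_eq_imp_iff₂] at h2
    exact ⟨σ₁, h1 σ (by simp), fun a ha => (h2 a ha).le⟩
  set B : ℂ → ℂ := fun s => meijerKernel (as.map (↑)) [] [] (bs'.map (↑)) s * (-(x : ℂ)) ^ (-s)
  have hΦ : meijerIntegrand (as.map (↑)) [] [0] (bs'.map (↑)) (-(x : ℂ))
      = fun s => Gamma s * B s := by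
    ext s
    simp only [meijerIntegrand, meijerKernel, B, List.map_cons, List.map_nil, List.prod_cons,
      List.prod_nil, zero_add]
    ring
  have hdecay := leftDecay_meijerIntegrand (as.map (↑)) [] [0] (bs'.map (↑)) hz hlen2
  rw [hΦ] at hdecay ⊢
  have hlim := tendsto_sum_residues hσ0 h1 hτ hdecay (by
    intro s hs
    refine (differentiableAt_meijerKernel (by simp) ?_).fun_mul
      (differentiableAt_const_cpow_neg hz s)
    intro a ha
    obtain ⟨a, ha', rfl⟩ := List.mem_map.1 ha
    rcases hs with hs | hs
    · left; simpa using hs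
    · right
      have := h2 a ha'
      simp
      linarith)
  -- The sign of the residue of Γ at -n cancels the sign of (-x)^n.
  have hterm : ∀ n : ℕ, ((-1) ^ n / n.factorial * B (-n) : ℂ) = ((t n : ℝ) : ℂ) := by
    intro n
    have e1 : ∀ l : List ℝ, ((l.map ((↑) : ℝ → ℂ)).map fun a => Gamma (1 - a - (-(n : ℂ)))).prod
        = (((l.map fun a => Real.Gamma (1 - a + n)).prod : ℝ) : ℂ) := by
      intro l
      induction l with
      | nil => simp
      | cons a l ih =>
        simp only [List.map_cons, List.prod_cons]
        rw [ih]
        push_cast [← Complex.Gamma_ofReal]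
        rw [sub_neg_eq_add]
    simp only [B, ht, meijerKernel, e1, List.map_nil, List.prod_nil, one_mul, mul_one, neg_neg,
      cpow_natCast]
    push_cast
    rw [neg_pow]
    have : ((-1 : ℂ) ^ n) * (-1) ^ n = 1 := by
      rw [← mul_pow]; simp
    linear_combination (((as.map fun a => Real.Gamma (1 - a + n)).prod : ℝ) : ℂ)
      / (((bs'.map fun a => Real.Gamma (1 - a + n)).prod : ℝ) : ℂ) * (x : ℂ) ^ n
        / (n.factorial : ℂ) * this
  simp_rw [hterm] at hlim
  -- Nonnegative terms turn convergence of the partial sums of residues into summability.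
  have ht0 : ∀ n, 0 ≤ t n := by
    intro n
    have e2 : ∀ l : List ℝ, (∀ a ∈ l, a < 1) →
        0 ≤ (l.map fun a => Real.Gamma (1 - a + n)).prod := by
      intro l hl
      refine List.prod_nonneg fun y hy => ?_
      obtain ⟨a, ha, rfl⟩ := List.mem_map.1 hy
      exact Real.Gamma_nonneg_of_nonneg (by
        linarith [hl a ha, n.cast_nonneg (α := ℝ)])
    have := e2 as has
    have := e2 bs' hbs
    positivity
  have hre : Tendsto (fun N : ℕ => ∑ n ∈ Finset.range N, t n) atTop
      (𝓝 (leftLoopIntegral σ τ fun s => Gamma s * B s).re) := by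
    have := (Complex.continuous_re.tendsto _).comp hlim
    refine this.congr fun N => ?_
    simp [← Complex.ofReal_sum]
  have hS : HasSum t _ := (hasSum_iff_tendsto_nat_of_nonneg ht0 _).2 hre
  refine ⟨hS.summable, ?_⟩
  refine tendsto_nhds_unique hlim ?_
  have := (Complex.continuous_ofReal.tendsto _).comp hS.summable.hasSum.tendsto_sum_nat
  refine this.congr fun N => ?_
  simp

/-! ## Densities with a given Mellin transform -/

/-- `d` is a nonnegative function whose Mellin transform is `K` on the half plane `Re s > s₀`. -/
structure MellinPair (d : ℝ → ℝ) (K : ℂ → ℂ) (s₀ : ℝ) : Prop where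
  meas : Measurable d
  nonneg : ∀ x, 0 < x → 0 ≤ d x
  hasMellin : ∀ s : ℂ, s₀ < s.re → HasMellin (fun x => (d x : ℂ)) s (K s)

namespace MellinPair

variable {d f g : ℝ → ℝ} {K Kf Kg : ℂ → ℂ} {s₀ s₁ : ℝ}

lemma mono (h : MellinPair d K s₀) (hs : s₀ ≤ s₁) : MellinPair d K s₁ :=
  ⟨h.meas, h.nonneg, fun s h1 => h.hasMellin s (hs.trans_lt h1)⟩

lemma congr (h : MellinPair d K s₀) {K' : ℂ → ℂ} (hK : ∀ s : ℂ, s₀ < s.re → K s = K' s) :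
    MellinPair d K' s₀ :=
  ⟨h.meas, h.nonneg, fun s h1 => hK s h1 ▸ h.hasMellin s h1⟩

lemma integrableOn (h : MellinPair d K s₀) {σ : ℝ} (hσ : s₀ < σ) :
    IntegrableOn (fun x => x ^ (σ - 1) * d x) (Ioi 0) := by
  have := (h.hasMellin σ (by simpa using hσ)).1.re
  refine (integrableOn_congr_fun (fun x (hx : 0 < x) => ?_) measurableSet_Ioi).1 this
  rw [smul_eq_mul, ← ofReal_one, ← ofReal_sub, ← ofReal_cpow hx.le, ← ofReal_mul]
  rfl

lemma integral_eq (h : MellinPair d K s₀) {σ : ℝ} (hσ : s₀ < σ) :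
    ((∫ x in Ioi (0 : ℝ), x ^ (σ - 1) * d x : ℝ) : ℂ) = K σ := by
  rw [← (h.hasMellin σ (by simpa using hσ)).2, ← integral_complex_ofReal, mellin]
  refine setIntegral_congr_fun measurableSet_Ioi fun x (hx : 0 < x) => ?_
  rw [smul_eq_mul, ← ofReal_one, ← ofReal_sub, ← ofReal_cpow hx.le, ← ofReal_mul]

lemma norm_integrand (h : MellinPair d K s₀) (s : ℂ) {x : ℝ} (hx : 0 < x) :
    ‖(x : ℂ) ^ (s - 1) • (d x : ℂ)‖ = x ^ (s.re - 1) * d x := by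
  rw [norm_smul, norm_cpow_eq_rpow_re_of_pos hx, sub_re, one_re, norm_real,
    Real.norm_of_nonneg (h.nonneg x hx)]

/-- Nonnegativity of d bounds its transform on a whole vertical line by the integral at the real
point of that line. This bound replaces asymptotics of Γ throughout. -/
lemma norm_le (h : MellinPair d K s₀) {s : ℂ} (hs : s₀ < s.re) :
    ‖K s‖ ≤ ∫ x in Ioi (0 : ℝ), x ^ (s.re - 1) * d x := by
  rw [← (h.hasMellin s hs).2, mellin]
  refine (norm_integral_le_integral_norm _).trans (le_of_eq ?_)
  exact setIntegral_congr_fun measurableSet_Ioi fun x hx => h.norm_integrand s hx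

end MellinPair

/-- The multiplicative convolution of two functions on the half line. -/
def mulConv (f g : ℝ → ℝ) (x : ℝ) : ℝ := ∫ v in Ioi (0 : ℝ), f (x / v) * g v / v

lemma measurable_mulConv {f g : ℝ → ℝ} (hf : Measurable f) (hg : Measurable g) :
    Measurable (mulConv f g) := by
  have h : Measurable (fun p : ℝ × ℝ => f (p.1 / p.2) * g p.2 / p.2) := by fun_prop
  exact (StronglyMeasurable.integral_prod_right (ν := volume.restrict (Ioi (0 : ℝ)))
    (f := fun x v => f (x / v) * g v / v) h.stronglyMeasurable).measurable

lemma setIntegral_rpow_comp_div (f : ℝ → ℝ) (σ : ℝ) {v : ℝ} (hv : 0 < v) :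
    ∫ x in Ioi (0 : ℝ), x ^ (σ - 1) * f (x / v) = v ^ σ * ∫ x in Ioi (0 : ℝ), x ^ (σ - 1) * f x := by
  have h := integral_comp_mul_left_Ioi (fun x => x ^ (σ - 1) * f x) 0 (inv_pos.2 hv)
  rw [mul_zero, inv_inv, smul_eq_mul] at h
  have h1 : ∫ x in Ioi (0 : ℝ), x ^ (σ - 1) * f (x / v)
      = ∫ x in Ioi (0 : ℝ), v ^ (σ - 1) * ((v⁻¹ * x) ^ (σ - 1) * f (v⁻¹ * x)) := by
    refine setIntegral_congr_fun measurableSet_Ioi fun x (hx : 0 < x) => ?_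
    rw [Real.mul_rpow (by positivity) hx.le, Real.inv_rpow hv.le, div_eq_inv_mul]
    have : v ^ (σ - 1) ≠ 0 := by positivity
    field_simp
  rw [h1, integral_const_mul, h, ← mul_assoc, Real.rpow_sub_one hv.ne', div_mul_cancel₀ _ hv.ne']

lemma integrableOn_rpow_comp_div {f : ℝ → ℝ} {σ : ℝ}
    (hf : IntegrableOn (fun x => x ^ (σ - 1) * f x) (Ioi 0)) {v : ℝ} (hv : 0 < v) :
    IntegrableOn (fun x => x ^ (σ - 1) * f (x / v)) (Ioi 0) := by
  have h := (integrableOn_Ioi_comp_mul_left_iff (fun x => x ^ (σ - 1) * f x) 0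
    (inv_pos.2 hv)).2 (by simpa using hf)
  refine (integrableOn_congr_fun (fun x (hx : 0 < x) => ?_) measurableSet_Ioi).1
    (h.const_mul (v ^ (σ - 1)))
  rw [Real.mul_rpow (by positivity) hx.le, Real.inv_rpow hv.le, div_eq_inv_mul]
  have : v ^ (σ - 1) ≠ 0 := by positivity
  field_simp

/-- For fixed v the substitution x = vu separates the double integral into the product of the two
transforms. Fubini applies because both densities are nonnegative, so the absolute integral is a
product of the same kind at Re s. -/
lemma MellinPair.mulConv {f g : ℝ → ℝ} {Kf Kg : ℂ → ℂ} {s₀ : ℝ} (hf : MellinPair f Kf s₀)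
    (hg : MellinPair g Kg s₀) : MellinPair (mulConv f g) (fun s => Kf s * Kg s) s₀ := by
  refine ⟨measurable_mulConv hf.meas hg.meas, fun x hx => ?_, fun s hs => ?_⟩
  · refine setIntegral_nonneg measurableSet_Ioi fun v (hv : 0 < v) => ?_
    have := hf.nonneg _ (div_pos hx hv)
    have := hg.nonneg v hv
    positivity
  set μ := volume.restrict (Ioi (0 : ℝ))
  set H : ℝ × ℝ → ℂ := fun p =>
    (p.1 : ℂ) ^ (s - 1) * (((f (p.1 / p.2) : ℝ) : ℂ) * ((g p.2 / p.2 : ℝ) : ℂ)) with hH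
  have hmeas : Measurable H := by
    have := hf.meas
    have := hg.meas
    fun_prop
  have hnorm : ∀ v : ℝ, 0 < v → ∀ x : ℝ, 0 < x →
      ‖H (x, v)‖ = x ^ (s.re - 1) * f (x / v) * (g v / v) := by
    intro v hv x hx
    simp only [hH]
    rw [norm_mul, norm_mul, norm_cpow_eq_rpow_re_of_pos hx, norm_real, norm_real,
      Real.norm_of_nonneg (hf.nonneg _ (div_pos hx hv)),
      Real.norm_of_nonneg (div_nonneg (hg.nonneg v hv) hv.le), sub_re, one_re, mul_assoc]
  have hint : Integrable H (μ.prod μ) := by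
    rw [integrable_prod_iff' hmeas.aestronglyMeasurable]
    constructor
    · refine (ae_restrict_iff' measurableSet_Ioi).2 (Eventually.of_forall fun v hv => ?_)
      have h1 := (integrableOn_rpow_comp_div (hf.integrableOn hs) hv).mul_const (g v / v)
      refine Integrable.mono' h1 (hmeas.comp (by fun_prop)).aestronglyMeasurable ?_
      exact (ae_restrict_iff' measurableSet_Ioi).2
        (Eventually.of_forall fun x hx => (hnorm v hv x hx).le)
    · have h1 := (hg.integrableOn hs).const_mul (∫ x in Ioi (0 : ℝ), x ^ (s.re - 1) * f x)
      refine (integrable_congr ?_).1 h1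
      refine (ae_restrict_iff' measurableSet_Ioi).2 (Eventually.of_forall fun v (hv : 0 < v) => ?_)
      simp only
      rw [setIntegral_congr_fun measurableSet_Ioi fun x hx => hnorm v hv x hx,
        integral_mul_const, setIntegral_rpow_comp_div f _ hv, Real.rpow_sub_one hv.ne']
      ring
  have hx : ∀ x, 0 < x → ∫ v in Ioi (0 : ℝ), H (x, v)
      = (x : ℂ) ^ (s - 1) • ((_root_.mulConv f g x : ℝ) : ℂ) := by
    intro x hx
    simp only [hH, _root_.mulConv]
    rw [integral_const_mul, smul_eq_mul, ← integral_complex_ofReal]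
    congr 1
    refine setIntegral_congr_fun measurableSet_Ioi fun v hv => ?_
    push_cast
    ring
  have hv : ∀ v, 0 < v → ∫ x in Ioi (0 : ℝ), H (x, v)
      = Kf s * ((v : ℂ) ^ (s - 1) • (g v : ℂ)) := by
    intro v hv
    have h1 := mellin_comp_mul_left (fun x => (f x : ℂ)) s (inv_pos.2 hv)
    rw [(hf.hasMellin s hs).2, mellin] at h1
    simp only [hH]
    simp_rw [← mul_assoc]
    rw [integral_mul_const]
    have h2 : ∫ x in Ioi (0 : ℝ), (x : ℂ) ^ (s - 1) * ((f (x / v) : ℝ) : ℂ)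
        = ((v⁻¹ : ℝ) : ℂ) ^ (-s) * Kf s := by
      rw [← smul_eq_mul, ← h1]
      simp_rw [smul_eq_mul, div_eq_inv_mul]
    have hv0 : (v : ℂ) ≠ 0 := ofReal_ne_zero.2 hv.ne'
    have h3 : ((v⁻¹ : ℝ) : ℂ) ^ (-s) = (v : ℂ) ^ s := by
      rw [ofReal_inv, inv_cpow _ _ (by rw [arg_ofReal_of_nonneg hv.le]; exact Real.pi_pos.ne),
        cpow_neg, inv_inv]
    rw [h2, h3, smul_eq_mul, cpow_sub _ _ hv0, cpow_one]
    push_cast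
    ring
  refine ⟨?_, ?_⟩
  · refine (integrable_congr ?_).1 hint.integral_prod_left
    exact (ae_restrict_iff' measurableSet_Ioi).2 (Eventually.of_forall fun x h => hx x h)
  · rw [mellin, ← setIntegral_congr_fun measurableSet_Ioi fun x h => hx x h,
      integral_integral_swap (f := fun x v => H (x, v)) hint,
      setIntegral_congr_fun measurableSet_Ioi fun v h => hv v h, integral_const_mul]
    congr 1
    exact (hg.hasMellin s hs).2

/-- `x ^ c` on the unit interval. -/
def powDensity (c : ℝ) : ℝ → ℝ := indicator (Ioc 0 1) fun x => x ^ c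

/-- `x ^ a e ^ (-x)` on the half line. -/
def gammaDensity (a : ℝ) : ℝ → ℝ := indicator (Ioi 0) fun x => x ^ a * Real.exp (-x)

/-- `x ^ p (1 - x) ^ (q - 1) / Γ(q)` on the unit interval. -/
def betaDensity (p q : ℝ) : ℝ → ℝ :=
  indicator (Ioo 0 1) fun x => x ^ p * (1 - x) ^ (q - 1) / Real.Gamma q

lemma mellinPair_powDensity (c : ℝ) : MellinPair (powDensity c) (fun s => 1 / (s + c)) (-c) := by
  refine ⟨Measurable.indicator (by fun_prop) measurableSet_Ioc, fun x _ =>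
    indicator_nonneg (fun y hy => Real.rpow_nonneg hy.1.le _) x, fun s hs => ?_⟩
  have h := hasMellin_cpow_Ioc (c : ℂ) (s := s) (by simp; linarith)
  have e : (fun x => ((powDensity c x : ℝ) : ℂ))
      = indicator (Ioc 0 1) (fun t => ↑t ^ (c : ℂ) : ℝ → ℂ) := by
    ext x
    by_cases hx : x ∈ Ioc (0 : ℝ) 1
    · rw [powDensity, indicator_of_mem hx, indicator_of_mem hx, ofReal_cpow hx.1.le]
    · rw [powDensity, indicator_of_notMem hx, indicator_of_notMem hx, ofReal_zero]
  rw [e]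
  exact h

lemma mellinPair_gammaDensity (a : ℝ) :
    MellinPair (gammaDensity a) (fun s => Gamma (s + a)) (-a) := by
  refine ⟨Measurable.indicator (by fun_prop) measurableSet_Ioi, fun x _ =>
    indicator_nonneg (fun y (hy : 0 < y) => by positivity) x, fun s hs => ?_⟩
  have hs' : 0 < (s + a).re := by simp; linarith
  have e : ∀ x ∈ Ioi (0 : ℝ), ((-x).exp : ℂ) * (x : ℂ) ^ (s + a - 1)
      = (x : ℂ) ^ (s - 1) • ((gammaDensity a x : ℝ) : ℂ) := by
    intro x (hx : 0 < x)
    rw [gammaDensity, indicator_of_mem (show x ∈ Ioi (0 : ℝ) from hx), smul_eq_mul, ofReal_mul,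
      ofReal_cpow hx.le, show s + a - 1 = (s - 1) + a by ring,
      cpow_add _ _ (ofReal_ne_zero.2 hx.ne')]
    push_cast
    ring
  have h := Complex.GammaIntegral_convergent hs'
  refine ⟨(integrableOn_congr_fun e measurableSet_Ioi).1 (by exact_mod_cast h), ?_⟩
  rw [Gamma_eq_integral hs', GammaIntegral, mellin]
  exact (setIntegral_congr_fun measurableSet_Ioi e).symm

lemma mellinPair_betaDensity (p : ℝ) {q : ℝ} (hq : 0 < q) :
    MellinPair (betaDensity p q) (fun s => Gamma (s + p) / Gamma (s + p + q)) (-p) := by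
  have hΓ := Real.Gamma_pos_of_pos hq
  refine ⟨Measurable.indicator (by fun_prop) measurableSet_Ioo, fun x _ =>
    indicator_nonneg (fun y hy => ?_) x, fun s hs => ?_⟩
  · have := hy.1
    have : 0 < 1 - y := sub_pos.2 hy.2
    positivity
  have hs' : 0 < (s + p).re := by simp; linarith
  have e : ∀ x ∈ Ioo (0 : ℝ) 1, (x : ℂ) ^ (s + p - 1) * (1 - (x : ℂ)) ^ ((q : ℂ) - 1)
      * (Real.Gamma q : ℂ)⁻¹ = (x : ℂ) ^ (s - 1) • ((betaDensity p q x : ℝ) : ℂ) := by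
    intro x hx
    have h1 : 0 ≤ 1 - x := (sub_pos.2 hx.2).le
    rw [betaDensity, indicator_of_mem hx, smul_eq_mul, ofReal_div, ofReal_mul,
      ofReal_cpow hx.1.le, ofReal_cpow h1, show s + p - 1 = (s - 1) + p by ring,
      cpow_add _ _ (ofReal_ne_zero.2 hx.1.ne')]
    push_cast
    ring
  have h := betaIntegral_convergent (u := s + p) (v := q) hs' (by simpa using hq)
  rw [intervalIntegrable_iff_integrableOn_Ioo_of_le zero_le_one] at h
  have h0 : ∀ x ∈ Ioi (0 : ℝ) \ Ioo 0 1, (x : ℂ) ^ (s - 1) • ((betaDensity p q x : ℝ) : ℂ) = 0 := by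
    intro x hx
    rw [betaDensity, indicator_of_notMem hx.2, ofReal_zero, smul_zero]
  refine ⟨?_, ?_⟩
  · have h1 := (integrableOn_congr_fun e measurableSet_Ioo).1
      (h.mul_const ((Real.Gamma q : ℂ)⁻¹))
    exact h1.of_forall_sdiff_eq_zero measurableSet_Ioi h0
  · rw [mellin, setIntegral_eq_of_subset_of_forall_sdiff_eq_zero measurableSet_Ioi
      Ioo_subset_Ioi_self h0, ← setIntegral_congr_fun measurableSet_Ioo e, integral_mul_const,
      ← integral_Ioc_eq_integral_Ioo, ← intervalIntegral.integral_of_le zero_le_one,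
      ← betaIntegral, betaIntegral_eq_Gamma_mul_div _ _ hs' (by simpa using hq), Gamma_ofReal]
    have : (Real.Gamma q : ℂ) ≠ 0 := ofReal_ne_zero.2 hΓ.ne'
    field_simp

/-! ### Densities on the half line -/

lemma norm_add_mul_I_sq (c y : ℝ) : ‖(c : ℂ) + y * I‖ ^ 2 = c ^ 2 + y ^ 2 := by
  rw [← Complex.normSq_eq_norm_sq, Complex.normSq_add_mul_I]

lemma integrable_of_norm_le_inv_sq {F : ℝ → ℂ} (hF : Continuous F) {c C : ℝ} (hc : 0 < c)
    (h : ∀ y : ℝ, ‖F y‖ ≤ C / ‖(c : ℂ) + y * I‖ ^ 2) : Integrable F := by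
  have hi : Integrable fun y : ℝ => (c⁻¹) ^ 2 * C * (1 + (y / c) ^ 2)⁻¹ :=
    (integrable_inv_one_add_sq.comp_div hc.ne').const_mul _
  refine hi.mono' hF.aestronglyMeasurable (Eventually.of_forall fun y => (h y).trans (le_of_eq ?_))
  rw [norm_add_mul_I_sq]
  field_simp

lemma continuous_vertical_of_differentiableAt {F : ℂ → ℂ} {σ : ℝ}
    (h : ∀ s : ℂ, s.re = σ → DifferentiableAt ℂ F s) :
    Continuous fun y : ℝ => F (σ + y * I) :=
  continuous_iff_continuousAt.2 fun y =>
    ContinuousAt.comp (f := fun y : ℝ => (σ : ℂ) + y * I) (h _ (by simp)).continuousAt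
      (by fun_prop)

lemma differentiableAt_Gamma_add {s : ℂ} {a : ℝ} (h : -a < s.re) :
    DifferentiableAt ℂ (fun s => Gamma (s + a)) s :=
  (differentiableAt_Gamma _ (ne_neg_nat_of (Or.inr (by simp; linarith)))).comp s (by fun_prop)

/-- Γ(s+2) = (s+1)sΓ(s) is bounded on the line by its Mellin integral, hence Γ(s) is O(‖s‖⁻²) there.
-/
lemma integrable_Gamma_vertical {c : ℝ} (hc : 0 < c) :
    Integrable fun y : ℝ => Gamma ((c : ℂ) + y * I) := by
  have h0 := mellinPair_gammaDensity 0
  refine integrable_of_norm_le_inv_sq (c := c)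
    (C := ∫ x in Ioi (0 : ℝ), x ^ (c + 2 - 1) * gammaDensity 0 x)
    (continuous_vertical_of_differentiableAt fun s hs =>
      differentiableAt_Gamma _ (ne_neg_nat_of (Or.inr (by linarith)))) hc fun y => ?_
  set s : ℂ := (c : ℂ) + y * I with hs
  have hs0 : s ≠ 0 := fun h => hc.ne' (by simpa [hs] using congrArg Complex.re h)
  have hs1 : s + 1 ≠ 0 := fun h => by
    have := congrArg Complex.re h
    simp [hs] at this
    linarith
  have h1 : Gamma (s + 2) = (s + 1) * (s * Gamma s) := by
    rw [← Complex.Gamma_add_one s hs0, ← Complex.Gamma_add_one (s + 1) hs1]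
    ring_nf
  have h2 := h0.norm_le (s := s + 2) (by simp [hs]; linarith)
  simp only [ofReal_zero, add_zero] at h2
  rw [h1, norm_mul, norm_mul] at h2
  have h3 : (s + 2).re = c + 2 := by simp [hs]
  rw [h3] at h2
  have h4 : ‖s‖ ≤ ‖s + 1‖ := by
    have e1 := norm_add_mul_I_sq c y
    have e2 := norm_add_mul_I_sq (c + 1) y
    have e3 : ((c + 1 : ℝ) : ℂ) + y * I = s + 1 := by rw [hs]; push_cast; ring
    rw [e3] at e2
    refine le_of_sq_le_sq ?_ (norm_nonneg _)
    rw [e1, e2]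
    nlinarith
  rw [le_div_iff₀ (by positivity)]
  calc ‖Gamma s‖ * ‖s‖ ^ 2 = ‖s‖ * (‖s‖ * ‖Gamma s‖) := by ring
    _ ≤ ‖s + 1‖ * (‖s‖ * ‖Gamma s‖) := by gcongr
    _ ≤ _ := h2

/-- A positive continuous density on the half line. -/
structure IsDensityIoi (d : ℝ → ℝ) (K : ℂ → ℂ) (s₀ : ℝ) : Prop extends MellinPair d K s₀ where
  cont : ContinuousOn d (Ioi 0)
  pos : ∀ x, 0 < x → 0 < d x
  bound : ∀ σ, s₀ < σ → ∃ C, ∀ x, 0 < x → d x ≤ C * x ^ (-σ)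
  vertical : ∀ σ : ℝ, s₀ < σ → Integrable fun y : ℝ => K (σ + y * I)

lemma IsDensityIoi.mono {d : ℝ → ℝ} {K : ℂ → ℂ} {s₀ s₁ : ℝ} (h : IsDensityIoi d K s₀)
    (hs : s₀ ≤ s₁) : IsDensityIoi d K s₁ :=
  ⟨h.toMellinPair.mono hs, h.cont, h.pos, fun σ hσ => h.bound σ (hs.trans_lt hσ),
    fun σ hσ => h.vertical σ (hs.trans_lt hσ)⟩

lemma IsDensityIoi.congr {d : ℝ → ℝ} {K K' : ℂ → ℂ} {s₀ : ℝ} (h : IsDensityIoi d K s₀)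
    (hK : ∀ s : ℂ, s₀ < s.re → K s = K' s) : IsDensityIoi d K' s₀ :=
  ⟨h.toMellinPair.congr hK, h.cont, h.pos, h.bound, fun σ hσ =>
    (h.vertical σ hσ).congr (Eventually.of_forall fun y => hK _ (by simpa using hσ))⟩

lemma isDensityIoi_gammaDensity (a : ℝ) :
    IsDensityIoi (gammaDensity a) (fun s => Gamma (s + a)) (-a) := by
  have e : ∀ x, 0 < x → gammaDensity a x = x ^ a * Real.exp (-x) := fun x hx => by
    rw [gammaDensity, indicator_of_mem (show x ∈ Ioi (0 : ℝ) from hx)]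
  refine ⟨mellinPair_gammaDensity a, ?_, fun x hx => by rw [e x hx]; positivity, ?_, ?_⟩
  · refine ContinuousOn.congr (f := fun x => x ^ a * Real.exp (-x)) ?_ fun x hx => e x hx
    exact ContinuousOn.mul (fun x (hx : 0 < x) =>
      (Real.continuousAt_rpow_const x a (Or.inl hx.ne')).continuousWithinAt) (by fun_prop)
  · intro σ hσ
    have hp : 0 < a + σ := by linarith
    -- The constant comes from t ≤ exp t at t = x/(a+σ), raised to the power a+σ.
    refine ⟨(a + σ) ^ (a + σ), fun x hx => ?_⟩
    have h1 : x ≤ (a + σ) * Real.exp (x / (a + σ)) := by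
      have := Real.add_one_le_exp (x / (a + σ))
      calc x = (a + σ) * (x / (a + σ)) := by field_simp
        _ ≤ _ := by gcongr; linarith
    have h2 : x ^ (a + σ) ≤ (a + σ) ^ (a + σ) * Real.exp x := by
      calc x ^ (a + σ) ≤ ((a + σ) * Real.exp (x / (a + σ))) ^ (a + σ) := by gcongr
        _ = _ := by
          rw [Real.mul_rpow hp.le (Real.exp_pos _).le, ← Real.exp_mul, div_mul_cancel₀ _ hp.ne']
    rw [e x hx]
    calc x ^ a * Real.exp (-x) = x ^ (a + σ) * Real.exp (-x) * x ^ (-σ) := by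
          rw [Real.rpow_add hx, Real.rpow_neg hx.le]
          field_simp
      _ ≤ ((a + σ) ^ (a + σ) * Real.exp x) * Real.exp (-x) * x ^ (-σ) := by gcongr
      _ = _ := by rw [mul_assoc _ (Real.exp x), ← Real.exp_add, add_neg_cancel, Real.exp_zero,
                    mul_one]
  · intro σ hσ
    have := integrable_Gamma_vertical (c := σ + a) (by linarith)
    refine this.congr (Eventually.of_forall fun y => ?_)
    simp only
    push_cast
    ring_nf

/-- The bound on f gives f(x/v)g(v)/v ≤ C x^(-σ) v^(σ-1) g(v), a dominating function that separates
x from v. It yields the continuity and the power bound of the convolution. On a vertical line an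
integrable transform is multiplied by a bounded one. Only f has to be regular: g may be
discontinuous, and it suffices that it is positive on (0,1). -/
lemma IsDensityIoi.mulConv {f g : ℝ → ℝ} {Kf Kg : ℂ → ℂ} {s₀ : ℝ} (hf : IsDensityIoi f Kf s₀)
    (hg : MellinPair g Kg s₀) (hpos : ∀ x ∈ Ioo (0 : ℝ) 1, 0 < g x)
    (hK : ∀ σ : ℝ, s₀ < σ → Continuous fun y : ℝ => Kg (σ + y * I)) :
    IsDensityIoi (mulConv f g) (fun s => Kf s * Kg s) s₀ := by
  have key : ∀ σ, s₀ < σ → ∃ C, ∀ x, 0 < x → ∀ v, 0 < v →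
      f (x / v) * g v / v ≤ C * x ^ (-σ) * (v ^ (σ - 1) * g v) := by
    intro σ hσ
    obtain ⟨C, hC⟩ := hf.bound σ hσ
    refine ⟨C, fun x hx v hv => ?_⟩
    have h1 := hC _ (div_pos hx hv)
    have h2 := hg.nonneg v hv
    calc f (x / v) * g v / v ≤ C * (x / v) ^ (-σ) * g v / v := by gcongr
      _ = _ := by
        rw [Real.div_rpow hx.le hv.le, Real.rpow_neg hv.le, Real.rpow_sub_one hv.ne']
        field_simp
  have hnn : ∀ x, 0 < x → ∀ v, 0 < v → 0 ≤ f (x / v) * g v / v := by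
    intro x hx v hv
    have := hf.nonneg _ (div_pos hx hv)
    have := hg.nonneg v hv
    positivity
  have hmeas : ∀ x, AEStronglyMeasurable (fun v => f (x / v) * g v / v)
      (volume.restrict (Ioi 0)) := by
    intro x
    have := hf.meas
    have := hg.meas
    exact Measurable.aestronglyMeasurable (by fun_prop)
  have hint : ∀ x, 0 < x → IntegrableOn (fun v => f (x / v) * g v / v) (Ioi 0) := by
    intro x hx
    obtain ⟨C, hC⟩ := key (s₀ + 1) (by linarith)
    refine ((hg.integrableOn (σ := s₀ + 1) (by linarith)).const_mul
      (C * x ^ (-(s₀ + 1)))).mono' (hmeas x) ?_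
    refine (ae_restrict_iff' measurableSet_Ioi).2 (Eventually.of_forall fun v hv => ?_)
    rw [Real.norm_of_nonneg (hnn x hx v hv)]
    exact hC x hx v hv
  refine ⟨hf.toMellinPair.mulConv hg, fun x (hx : 0 < x) => ?_, fun x hx => ?_, fun σ hσ => ?_,
    fun σ hσ => ?_⟩
  · refine ContinuousAt.continuousWithinAt ?_
    obtain ⟨C, hC⟩ := key (s₀ + 1) (by linarith)
    -- Near x the coefficient in front of the v-integrand is replaced by a constant, so that the
    -- dominating function no longer depends on y.
    have hev : ∀ᶠ y in 𝓝 x, 0 < y ∧ C * y ^ (-(s₀ + 1)) ≤ C * x ^ (-(s₀ + 1)) + 1 := by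
      refine (eventually_gt_nhds hx).and ?_
      have : ContinuousAt (fun y : ℝ => C * y ^ (-(s₀ + 1))) x :=
        (Real.continuousAt_rpow_const x _ (Or.inl hx.ne')).const_mul C
      filter_upwards [this.eventually (eventually_lt_nhds (lt_add_one _))] with y hy using hy.le
    refine continuousAt_of_dominated (Eventually.of_forall fun y => hmeas y)
      (bound := fun v => (C * x ^ (-(s₀ + 1)) + 1) * (v ^ (s₀ + 1 - 1) * g v)) ?_
      ((hg.integrableOn (σ := s₀ + 1) (by linarith)).const_mul _) ?_
    · filter_upwards [hev] with y hy
      refine (ae_restrict_iff' measurableSet_Ioi).2 (Eventually.of_forall fun v (hv : 0 < v) => ?_)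
      rw [Real.norm_of_nonneg (hnn y hy.1 v hv)]
      have := hg.nonneg v hv
      exact (hC y hy.1 v hv).trans (by gcongr; exact hy.2)
    · refine (ae_restrict_iff' measurableSet_Ioi).2 (Eventually.of_forall fun v (hv : 0 < v) => ?_)
      have h1 : ContinuousAt f (x / v) :=
        hf.cont.continuousAt (Ioi_mem_nhds (div_pos hx hv))
      have h2 : ContinuousAt (fun y => f (y / v)) x :=
        ContinuousAt.comp (f := fun y => y / v) h1 (by fun_prop)
      exact (h2.mul_const _).div_const _
  · rw [_root_.mulConv, setIntegral_pos_iff_support_of_nonneg_ae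
      ((ae_restrict_iff' measurableSet_Ioi).2 (Eventually.of_forall fun v hv => hnn x hx v hv))
      (hint x hx)]
    refine lt_of_lt_of_le ?_ (measure_mono (s := Ioo (0 : ℝ) 1) fun v hv => ⟨?_, hv.1⟩)
    · simp
    · have h1 := hf.pos _ (div_pos hx hv.1)
      have h2 := hpos v hv
      have h3 := hv.1
      exact (by positivity : 0 < f (x / v) * g v / v).ne'
  · obtain ⟨C, hC⟩ := key σ hσ
    refine ⟨C * ∫ v in Ioi (0 : ℝ), v ^ (σ - 1) * g v, fun x hx => ?_⟩
    calc _root_.mulConv f g x ≤ ∫ v in Ioi (0 : ℝ), C * x ^ (-σ) * (v ^ (σ - 1) * g v) :=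
          setIntegral_mono_on (hint x hx) ((hg.integrableOn hσ).const_mul _) measurableSet_Ioi
            fun v hv => hC x hx v hv
      _ = _ := by rw [integral_const_mul]; ring
  · refine (hf.vertical σ hσ).mul_bdd (hK σ hσ).aestronglyMeasurable
      (c := ∫ x in Ioi (0 : ℝ), x ^ (σ - 1) * g x) (Eventually.of_forall fun y => ?_)
    have := hg.norm_le (s := (σ : ℂ) + y * I) (by simpa using hσ)
    simpa using this

/-- Translating the kernel by m corresponds to a power of x; this relates the Meijer function of the
moment problem to the one in the weight. -/
lemma MellinPair.pow_mul {d : ℝ → ℝ} {K : ℂ → ℂ} {s₀ : ℝ} (h : MellinPair d K s₀) (m : ℕ) :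
    MellinPair (fun x => x ^ m * d x) (fun s => K (s + m)) (s₀ - m) := by
  refine ⟨by have := h.meas; fun_prop, fun x hx => mul_nonneg (by positivity) (h.nonneg x hx),
    fun s hs => ?_⟩
  have h1 := h.hasMellin (s + m) (by simp; linarith)
  have e : (fun x : ℝ => ((x ^ m * d x : ℝ) : ℂ)) = fun x : ℝ => (x : ℂ) ^ (m : ℂ) • (d x : ℂ) := by
    ext x
    rw [cpow_natCast, smul_eq_mul]
    push_cast
    rfl
  rw [e]
  exact ⟨MellinConvergent.cpow_smul.2 h1.1, (mellin_cpow_smul _ _ _).trans h1.2⟩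

lemma IsDensityIoi.pow_mul {d : ℝ → ℝ} {K : ℂ → ℂ} {s₀ : ℝ} (h : IsDensityIoi d K s₀) (m : ℕ) :
    IsDensityIoi (fun x => x ^ m * d x) (fun s => K (s + m)) (s₀ - m) := by
  refine ⟨h.toMellinPair.pow_mul m, (by fun_prop : Continuous fun x : ℝ => x ^ m).continuousOn.mul
    h.cont, fun x hx => mul_pos (by positivity) (h.pos x hx), fun σ hσ => ?_, fun σ hσ => ?_⟩
  · obtain ⟨C, hC⟩ := h.bound (σ + m) (by linarith)
    refine ⟨C, fun x hx => ?_⟩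
    calc x ^ m * d x ≤ x ^ m * (C * x ^ (-(σ + m))) := by gcongr; exact hC x hx
      _ = _ := by
        rw [neg_add, Real.rpow_add hx, Real.rpow_neg hx.le (m : ℝ), Real.rpow_natCast]
        field_simp
  · refine (h.vertical (σ + m) (by linarith)).congr (Eventually.of_forall fun y => ?_)
    simp only
    push_cast
    ring_nf

lemma div_Gamma_succ {s : ℂ} {c : ℝ} (hs : -c < s.re) (n : ℕ) :
    Gamma (s + c) / Gamma (s + c + n) * (1 / (s + (c + n : ℝ)))
      = Gamma (s + c) / Gamma (s + c + (n + 1 : ℕ)) := by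
  have h : s + c + n ≠ 0 := fun h0 => by
    have := congrArg Complex.re h0
    simp at this
    linarith [n.cast_nonneg (α := ℝ)]
  rw [Nat.cast_succ, ← add_assoc, Complex.Gamma_add_one _ h]
  push_cast
  rw [← add_assoc]
  field_simp

lemma continuous_vertical_inv_add {c s₀ σ : ℝ} (hc : -c ≤ s₀) (hσ : s₀ < σ) :
    Continuous fun y : ℝ => 1 / ((σ : ℂ) + y * I + c) := by
  refine Continuous.div (by fun_prop) (by fun_prop) fun y h0 => ?_
  have := congrArg Complex.re h0
  simp at this
  linarith

/-- The quotient is the product of 1/(s+c+k) for k < n, that is, n convolutions with power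
densities. Unlike a single beta density this also covers n = 0, which is needed for m = 0. -/
lemma IsDensityIoi.exists_mul_Gamma_ratio {d : ℝ → ℝ} {K : ℂ → ℂ} {s₀ c : ℝ}
    (h : IsDensityIoi d K s₀) (hc : -c ≤ s₀) (n : ℕ) :
    ∃ d', IsDensityIoi d' (fun s => K s * (Gamma (s + c) / Gamma (s + c + n))) s₀ := by
  induction n with
  | zero =>
    refine ⟨d, h.congr fun s hs => ?_⟩
    have : Gamma (s + c) ≠ 0 := Gamma_ne_zero_of_re_pos (by simp; linarith)
    simp [this]
  | succ n ih =>
    obtain ⟨d', hd'⟩ := ih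
    have hcn : -(c + n) ≤ s₀ := by linarith [n.cast_nonneg (α := ℝ)]
    refine ⟨_, (hd'.mulConv ((mellinPair_powDensity (c + n)).mono hcn) (fun x hx => ?_)
      fun σ hσ => continuous_vertical_inv_add hcn hσ).congr fun s hs => ?_⟩
    · rw [powDensity, indicator_of_mem (show x ∈ Ioc (0 : ℝ) 1 from ⟨hx.1, hx.2.le⟩)]
      exact Real.rpow_pos_of_pos hx.1 _
    · rw [mul_assoc, div_Gamma_succ (by linarith)]

/-- A density on the unit interval, positive and continuous in its interior. -/
structure IsDensityIoo (d : ℝ → ℝ) (K : ℂ → ℂ) (s₀ : ℝ) : Prop extends MellinPair d K s₀ where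
  zero : ∀ x, 1 ≤ x → d x = 0
  cont : ContinuousOn d (Ioo 0 1)
  pos : ∀ x ∈ Ioo (0 : ℝ) 1, 0 < d x

lemma IsDensityIoo.congr {d : ℝ → ℝ} {K K' : ℂ → ℂ} {s₀ : ℝ} (h : IsDensityIoo d K s₀)
    (hK : ∀ s : ℂ, s₀ < s.re → K s = K' s) : IsDensityIoo d K' s₀ :=
  ⟨h.toMellinPair.congr hK, h.zero, h.cont, h.pos⟩

lemma IsDensityIoo.pow_mul {d : ℝ → ℝ} {K : ℂ → ℂ} {s₀ : ℝ} (h : IsDensityIoo d K s₀) (m : ℕ) :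
    IsDensityIoo (fun x => x ^ m * d x) (fun s => K (s + m)) (s₀ - m) :=
  ⟨h.toMellinPair.pow_mul m, fun x hx => by simp [h.zero x hx],
    (by fun_prop : Continuous fun x : ℝ => x ^ m).continuousOn.mul h.cont,
    fun x hx => mul_pos (pow_pos hx.1 m) (h.pos x hx)⟩

lemma isDensityIoo_betaDensity (p : ℝ) {q : ℝ} (hq : 0 < q) :
    IsDensityIoo (betaDensity p q) (fun s => Gamma (s + p) / Gamma (s + p + q)) (-p) := by
  have hΓ := Real.Gamma_pos_of_pos hq
  have e : ∀ x ∈ Ioo (0 : ℝ) 1, betaDensity p q x = x ^ p * (1 - x) ^ (q - 1) / Real.Gamma q :=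
    fun x hx => by rw [betaDensity, indicator_of_mem hx]
  refine ⟨mellinPair_betaDensity p hq, fun x hx => ?_, ?_, fun x hx => ?_⟩
  · rw [betaDensity, indicator_of_notMem fun h => hx.not_gt h.2]
  · refine ContinuousOn.congr ?_ e
    intro x hx
    have h1 : ContinuousAt (fun x : ℝ => x ^ p) x :=
      Real.continuousAt_rpow_const x p (Or.inl hx.1.ne')
    have h2 : ContinuousAt (fun x : ℝ => (1 - x) ^ (q - 1)) x :=
      ContinuousAt.rpow_const (by fun_prop) (Or.inl (sub_pos.2 hx.2).ne')
    exact ((h1.mul h2).div_const _).continuousWithinAt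
  · rw [e x hx]
    have := hx.1
    have : 0 < 1 - x := sub_pos.2 hx.2
    positivity

namespace IsDensityIoo

variable {d : ℝ → ℝ} {K : ℂ → ℂ} {s₀ : ℝ}

/-- On [a, 1] every power of v is bounded, and d vanishes beyond 1, so any exponent is admissible
away from the origin. -/
lemma integrableOn_tail (h : IsDensityIoo d K s₀) (c : ℝ) {a : ℝ} (ha : 0 < a) :
    IntegrableOn (fun v => v ^ (-c - 1) * d v) (Ioi a) := by
  have h1 : IntegrableOn (fun v => v ^ (s₀ + 1 - 1) * d v) (Ioo a 1) :=
    (h.integrableOn (σ := s₀ + 1) (by linarith)).mono_set fun v hv => ha.trans hv.1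
  have h2 : IntegrableOn (fun v => v ^ (-c - 1 - s₀) * (v ^ (s₀ + 1 - 1) * d v)) (Ioo a 1) := by
    have hc : ContinuousOn (fun v : ℝ => v ^ (-c - 1 - s₀)) (Icc a 1) := fun v hv =>
      (Real.continuousAt_rpow_const v _ (Or.inl (ha.trans_le hv.1).ne')).continuousWithinAt
    obtain ⟨C, hC⟩ := isCompact_Icc.exists_bound_of_continuousOn hc
    refine Integrable.bdd_mul (c := C) h1
      ((hc.mono Ioo_subset_Icc_self).aestronglyMeasurable measurableSet_Ioo) ?_
    exact (ae_restrict_iff' measurableSet_Ioo).2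
      (Eventually.of_forall fun v hv => hC v ⟨hv.1.le, hv.2.le⟩)
  have h3 : IntegrableOn (fun v => v ^ (-c - 1) * d v) (Ioo a 1) := by
    refine (integrableOn_congr_fun (fun v hv => ?_) measurableSet_Ioo).1 h2
    rw [← mul_assoc, ← Real.rpow_add (ha.trans hv.1)]
    ring_nf
  refine h3.of_forall_sdiff_eq_zero measurableSet_Ioi fun v hv => ?_
  rw [h.zero v (not_lt.1 fun h1 => hv.2 ⟨hv.1, h1⟩), mul_zero]

lemma hasDerivAt_tail (h : IsDensityIoo d K s₀) (c : ℝ) {x : ℝ} (hx : x ∈ Ioo (0 : ℝ) 1) :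
    HasDerivAt (fun x => ∫ v in Ioi x, v ^ (-c - 1) * d v) (-(x ^ (-c - 1) * d x)) x := by
  set w : ℝ → ℝ := fun v => v ^ (-c - 1) * d v
  have ha : 0 < x / 2 := half_pos hx.1
  have hI := h.integrableOn_tail c ha
  have hmeas : Measurable w := by have := h.meas; fun_prop
  have hcont : ContinuousAt w x :=
    (Real.continuousAt_rpow_const x _ (Or.inl hx.1.ne')).mul
      (h.cont.continuousAt (Ioo_mem_nhds hx.1 hx.2))
  have hd : HasDerivAt (fun y => ∫ v in (x / 2)..y, w v) (w x) x :=
    intervalIntegral.integral_hasDerivAt_right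
      (intervalIntegrable_iff.2 (hI.mono_set (by
        rw [uIoc_of_le (by linarith [hx.1])]; exact Ioc_subset_Ioi_self)))
      (hmeas.stronglyMeasurable.stronglyMeasurableAtFilter) hcont
  have hd2 := hd.const_sub (∫ v in Ioi (x / 2), w v)
  refine hd2.congr_of_eventuallyEq ?_
  filter_upwards [eventually_gt_nhds (show x / 2 < x by linarith [hx.1])] with y hy
  have hy2 : IntegrableOn w (Ioi y) := hI.mono_set (Ioi_subset_Ioi hy.le)
  rw [eq_sub_iff_add_eq, add_comm]
  exact intervalIntegral.integral_interval_add_Ioi hI hy2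

/-- The power density at x/v vanishes unless v ≥ x, which leaves a tail integral. This links
division of the transform by s+c to integration in x, and so its removal to differentiation. -/
lemma _root_.mulConv_powDensity_eq (c : ℝ) (f : ℝ → ℝ) {x : ℝ} (hx : 0 < x) :
    mulConv (powDensity c) f x = x ^ c * ∫ v in Ioi x, v ^ (-c - 1) * f v := by
  have e : ∀ v ∈ Ioi (0 : ℝ), powDensity c (x / v) * f v / v
      = indicator (Ici x) (fun v => x ^ c * (v ^ (-c - 1) * f v)) v := by
    intro v (hv : 0 < v)
    by_cases hxv : x ≤ v
    · rw [indicator_of_mem (show v ∈ Ici x from hxv), powDensity,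
        indicator_of_mem
        (show x / v ∈ Ioc (0 : ℝ) 1 from ⟨div_pos hx hv, (div_le_one hv).2 hxv⟩), Real.div_rpow hx.le hv.le,
        Real.rpow_sub_one hv.ne', Real.rpow_neg hv.le]
      field_simp
    · rw [indicator_of_notMem (show v ∉ Ici x from hxv), powDensity,
        indicator_of_notMem fun h => hxv ((div_le_one hv).1 h.2)]
      simp
  rw [mulConv, setIntegral_congr_fun measurableSet_Ioi e, setIntegral_indicator measurableSet_Ici,
    inter_eq_self_of_subset_right (show Ici x ⊆ Ioi 0 from fun v hv => hx.trans_le hv), integral_const_mul,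
    integral_Ici_eq_integral_Ioi]

/-- Multiplication of the Mellin transform by `1 / (s + c)`. -/
lemma mulConv_powDensity (h : IsDensityIoo d K s₀) {c : ℝ} (hc : -c ≤ s₀) :
    IsDensityIoo (mulConv (powDensity c) d) (fun s => K s * (1 / (s + c))) s₀ := by
  refine ⟨(((mellinPair_powDensity c).mono hc).mulConv h.toMellinPair).congr fun s _ =>
    mul_comm _ _, fun x hx => ?_, fun x hx => ?_, fun x hx => ?_⟩
  · rw [mulConv_powDensity_eq c d (by linarith), setIntegral_congr_fun (g := fun _ => 0)
      measurableSet_Ioi fun v (hv : x < v) => by simp only; rw [h.zero v (hx.trans hv.le), mul_zero]]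
    simp
  · refine ContinuousAt.continuousWithinAt ?_
    have h1 : ContinuousAt (fun x => x ^ c * ∫ v in Ioi x, v ^ (-c - 1) * d v) x :=
      (Real.continuousAt_rpow_const x _ (Or.inl hx.1.ne')).mul (h.hasDerivAt_tail c hx).continuousAt
    refine h1.congr ?_
    filter_upwards [eventually_gt_nhds hx.1] with y hy
    rw [mulConv_powDensity_eq c d hy]
  · rw [mulConv_powDensity_eq c d hx.1]
    refine mul_pos (Real.rpow_pos_of_pos hx.1 _) ?_
    rw [setIntegral_pos_iff_support_of_nonneg_ae _ (h.integrableOn_tail c hx.1)]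
    · refine lt_of_lt_of_le ?_ (measure_mono (s := Ioo x 1) fun v hv => ⟨?_, hv.1⟩)
      · simpa using hx.2
      · have hv0 := hx.1.trans hv.1
        exact (mul_pos (Real.rpow_pos_of_pos hv0 _) (h.pos v ⟨hv0, hv.2⟩)).ne'
    · refine (ae_restrict_iff' measurableSet_Ioi).2 (Eventually.of_forall fun v (hv : x < v) => ?_)
      have hv0 := hx.1.trans hv
      exact mul_nonneg (Real.rpow_nonneg hv0.le _) (h.nonneg v hv0)

lemma exists_mul_Gamma_ratio {c : ℝ} (h : IsDensityIoo d K s₀) (hc : -c ≤ s₀) (n : ℕ) :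
    ∃ d', IsDensityIoo d' (fun s => K s * (Gamma (s + c) / Gamma (s + c + n))) s₀ := by
  induction n with
  | zero =>
    refine ⟨d, h.congr fun s hs => ?_⟩
    have : Gamma (s + c) ≠ 0 := Gamma_ne_zero_of_re_pos (by simp; linarith)
    simp [this]
  | succ n ih =>
    obtain ⟨d', hd'⟩ := ih
    have hcn : -(c + n) ≤ s₀ := by linarith [n.cast_nonneg (α := ℝ)]
    refine ⟨_, (hd'.mulConv_powDensity hcn).congr fun s hs => ?_⟩
    rw [mul_assoc, div_Gamma_succ (by linarith)]

lemma integral_mono (h : IsDensityIoo d K s₀) {σ σ' : ℝ} (hσ : s₀ < σ) (hσ' : σ ≤ σ') :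
    ∫ x in Ioi (0 : ℝ), x ^ (σ' - 1) * d x ≤ ∫ x in Ioi (0 : ℝ), x ^ (σ - 1) * d x := by
  refine setIntegral_mono_on (h.integrableOn (hσ.trans_le hσ')) (h.integrableOn hσ)
    measurableSet_Ioi fun x (hx : 0 < x) => ?_
  rcases le_or_gt 1 x with h1 | h1
  · simp [h.zero x h1]
  · exact mul_le_mul_of_nonneg_right
      (Real.rpow_le_rpow_of_exponent_ge hx h1.le (by linarith)) (h.nonneg x hx)

/-- Below 1 higher powers are smaller, so one constant bounds the transform on a whole right half
plane. This serves both the line integral of the kernel over s² and the vanishing of the right loop.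
-/
lemma exists_norm_le (h : IsDensityIoo d K s₀) {σ : ℝ} (hσ : s₀ < σ) :
    ∃ C, ∀ s : ℂ, σ ≤ s.re → ‖K s‖ ≤ C :=
  ⟨_, fun _ hs => (h.norm_le (hσ.trans_le hs)).trans (h.integral_mono hσ hs)⟩

end IsDensityIoo

/-! ## Loops and lines -/

/-- Cauchy's theorem on a half-infinite strip: the left edge of a rectangle recedes by unit steps
and its contribution tends to 0. -/
lemma LeftDecay.strip {Φ : ℂ → ℂ} (h : LeftDecay Φ) {σ t₁ t₂ : ℝ} (ht : t₁ ≤ t₂)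
    (hd : ∀ s : ℂ, s.im ∈ Icc t₁ t₂ → DifferentiableAt ℂ Φ s) :
    (∫ x in Iic σ, Φ ((x : ℂ) + t₁ * I)) - (∫ x in Iic σ, Φ ((x : ℂ) + t₂ * I))
      + I * (∫ y in t₁..t₂, Φ ((σ : ℂ) + y * I)) = 0 := by
  have ha := tendsto_sub_natCast_atBot σ
  have hi : ∀ t ∈ Icc t₁ t₂, IntegrableOn (fun x : ℝ => Φ ((x : ℂ) + t * I)) (Iic σ) :=
    fun t ht => h.integrableOn_Iic (continuousOn_horizontal _ fun s hs => hd s (hs ▸ ht))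
  have h1 := intervalIntegral_tendsto_integral_Iic σ (hi t₁ ⟨le_rfl, ht⟩) ha
  have h2 := intervalIntegral_tendsto_integral_Iic σ (hi t₂ ⟨ht, le_rfl⟩) ha
  have h3 := h.tendsto_vertical (c := σ) ht fun n y hy => (hd _ (by simpa using hy)).continuousAt
  have h4 := ((h1.sub h2).add_const (I * (∫ y in t₁..t₂, Φ ((σ : ℂ) + y * I)))).sub
    (h3.const_mul I)
  rw [mul_zero, sub_zero] at h4
  refine tendsto_nhds_unique h4 (tendsto_const_nhds.congr fun n => ?_)
  have := Complex.integral_boundary_rect_eq_zero_of_differentiableOn Φ ⟨σ - n, t₁⟩ ⟨σ, t₂⟩ (by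
    intro s hs
    rw [mem_reProdIm] at hs
    simp only [uIcc_of_le ht] at hs
    exact (hd s hs.2).differentiableWithinAt)
  simp only [smul_eq_mul] at this
  exact this.symm

/-- All singularities lie on the real ray Re s ≤ s₀, so the strips between the two heights, above
and below the axis, contribute nothing. -/
lemma leftLoopIntegral_height {Φ : ℂ → ℂ} (h : LeftDecay Φ) {σ τ T s₀ : ℝ} (hs : s₀ < σ)
    (hτ : 0 < τ) (hT : τ ≤ T)
    (hd : ∀ s : ℂ, s.im ≠ 0 ∨ s₀ < s.re → DifferentiableAt ℂ Φ s) :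
    leftLoopIntegral σ T Φ = leftLoopIntegral σ τ Φ := by
  have h1 := h.strip (σ := σ) hT fun s hs => hd s (Or.inl (hτ.trans_le hs.1).ne')
  have h2 := h.strip (σ := σ) (neg_le_neg hT) fun s hs => hd s (Or.inl (by linarith [hs.2] :
    s.im < 0).ne)
  have hc : Continuous fun y : ℝ => Φ ((σ : ℂ) + y * I) :=
    continuous_vertical_of_differentiableAt fun s hs' => hd s (Or.inr (hs'.symm ▸ hs))
  have hi : ∀ a b : ℝ, IntervalIntegrable (fun y : ℝ => Φ ((σ : ℂ) + y * I)) volume a b :=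
    fun a b => hc.intervalIntegrable a b
  have h3 : ∫ y in (-T)..T, Φ ((σ : ℂ) + y * I) = (∫ y in (-T)..(-τ), Φ ((σ : ℂ) + y * I))
      + (∫ y in (-τ)..τ, Φ ((σ : ℂ) + y * I)) + ∫ y in τ..T, Φ ((σ : ℂ) + y * I) := by
    rw [intervalIntegral.integral_add_adjacent_intervals (hi _ _) (hi _ _),
      intervalIntegral.integral_add_adjacent_intervals (hi _ _) (hi _ _)]
  have e : ∀ t x : ℝ, ((x : ℂ) - t * I) = (x : ℂ) + ((-t : ℝ) : ℂ) * I := by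
    intro t x; push_cast; ring
  rw [leftLoopIntegral, leftLoopIntegral, h3]
  simp_rw [e]
  linear_combination (2 * Real.pi * I : ℂ)⁻¹ * (h1 + h2)

/-- The height of the loop is raised through the integers. The vertical side converges to the line,
and the legs at height n are O(1/n²), by the bound on a strip of width one and the decay to the
left. -/
lemma leftLoopIntegral_eq_lineIntegral {Φ : ℂ → ℂ} (h : LeftDecay Φ) {σ τ s₀ C : ℝ} (hs : s₀ < σ)
    (hσ : 0 < σ) (hτ : 0 < τ) (hd : ∀ s : ℂ, s.im ≠ 0 ∨ s₀ < s.re → DifferentiableAt ℂ Φ s)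
    (hC : ∀ s : ℂ, σ ≤ s.re → s.re ≤ σ + 1 → ‖Φ s‖ ≤ C / ‖s‖ ^ 2) :
    leftLoopIntegral σ τ Φ = lineIntegral σ Φ := by
  have hc : Continuous fun y : ℝ => Φ ((σ : ℂ) + y * I) :=
    continuous_vertical_of_differentiableAt fun s hs' => hd s (Or.inr (hs'.symm ▸ hs))
  have hint : Integrable fun y : ℝ => Φ ((σ : ℂ) + y * I) :=
    integrable_of_norm_le_inv_sq hc hσ fun y => hC _ (by simp) (by simp)
  have hC0 : 0 ≤ C := by
    have := (norm_nonneg _).trans (hC σ (by simp) (by simp))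
    rw [le_div_iff₀ (by simpa using sq_pos_of_pos hσ)] at this
    simpa using this
  have hnat : Tendsto (fun n : ℕ => (n : ℝ)) atTop atTop := tendsto_natCast_atTop_atTop
  have h1 : Tendsto (fun n : ℕ => ∫ y in (-(n : ℝ))..n, Φ ((σ : ℂ) + y * I)) atTop
      (𝓝 (∫ y : ℝ, Φ ((σ : ℂ) + y * I))) :=
    intervalIntegral_tendsto_integral hint (tendsto_neg_atTop_atBot.comp hnat) hnat
  obtain ⟨r, M, hr, hr1, hM⟩ := h.high
  have h2 : ∀ t : ℕ → ℝ, (∀ n, |t n| = n) →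
      Tendsto (fun n : ℕ => ∫ x in Iic σ, Φ ((x : ℂ) + t n * I)) atTop (𝓝 0) := by
    intro t ht
    have hlim : Tendsto (fun n : ℕ => C / (n : ℝ) ^ 2 * (Real.exp (-Real.log r) / -Real.log r))
        atTop (𝓝 0) := by
      have : Tendsto (fun n : ℕ => C / (n : ℝ) ^ 2) atTop (𝓝 0) :=
        tendsto_const_nhds.div_atTop ((tendsto_pow_atTop two_ne_zero).comp hnat)
      simpa using this.mul_const (Real.exp (-Real.log r) / -Real.log r)
    refine squeeze_zero_norm' ?_ hlim
    filter_upwards [hnat.eventually (eventually_ge_atTop M),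
      hnat.eventually (eventually_gt_atTop 0)] with n hn hn0
    -- With this b the unit window is [σ, σ+1], the strip where the inverse-square bound is
    -- available.
    refine norm_setIntegral_Iic_le_of_shift (b := σ + 1) hr hr1 (by positivity)
      (fun x _ => hM (t n) (by rw [ht]; exact hn) x) (fun x hx => ?_) (by linarith)
    refine (hC _ (by simpa using hx.1) (by simpa using hx.2)).trans ?_
    have := abs_im_le_norm_add_mul_I x (t n)
    rw [ht] at this
    gcongr
  have h3 := h2 (fun n => -(n : ℝ)) (by simp)
  have h4 := h2 (fun n => (n : ℝ)) (by simp)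
  have h5 := ((h3.add (h1.const_mul I)).sub h4).const_mul (2 * Real.pi * I : ℂ)⁻¹
  rw [zero_add, sub_zero] at h5
  refine tendsto_nhds_unique (tendsto_const_nhds.congr' ?_) h5
  filter_upwards [hnat.eventually (eventually_ge_atTop τ)] with n hn
  rw [← leftLoopIntegral_height h hs hτ hn hd, leftLoopIntegral]
  simp [sub_eq_add_neg]

/-- No singularity lies to the right of s₀: the loop is closed by a vertical side whose real part
tends to infinity, where the exponential bound kills it. -/
lemma rightLoopIntegral_eq_zero {Φ : ℂ → ℂ} {σ τ s₀ c C : ℝ} (hs : s₀ < σ) (hτ : 0 < τ)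
    (hc : c < 0) (hd : ∀ s : ℂ, s₀ < s.re → DifferentiableAt ℂ Φ s)
    (hC : ∀ s : ℂ, σ ≤ s.re → ‖Φ s‖ ≤ C * Real.exp (c * s.re)) :
    rightLoopIntegral σ τ Φ = 0 := by
  have hi : ∀ t : ℝ, IntegrableOn (fun x : ℝ => Φ ((x : ℂ) + t * I)) (Ioi σ) := by
    intro t
    refine ((integrableOn_exp_mul_Ioi hc σ).const_mul C).mono' ?_ ?_
    · refine ContinuousOn.aestronglyMeasurable (fun x hx => ?_) measurableSet_Ioi
      exact (ContinuousAt.comp (f := fun x : ℝ => (x : ℂ) + t * I)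
        (hd _ (by simpa using hs.trans hx)).continuousAt (by fun_prop)).continuousWithinAt
    · refine (ae_restrict_iff' measurableSet_Ioi).2 (Eventually.of_forall fun x hx => ?_)
      simpa using hC ((x : ℂ) + t * I) (by simpa using (le_of_lt hx))
  have e : ∀ x : ℝ, ((x : ℂ) - τ * I) = (x : ℂ) + ((-τ : ℝ) : ℂ) * I := by
    intro x; push_cast; ring
  have h1 := intervalIntegral_tendsto_integral_Ioi σ (hi (-τ)) tendsto_id
  have h2 := intervalIntegral_tendsto_integral_Ioi σ (hi τ) tendsto_id
  have h3 : Tendsto (fun R : ℝ => ∫ y in (-τ)..τ, Φ ((R : ℂ) + y * I)) atTop (𝓝 0) := by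
    have hlim : Tendsto (fun R : ℝ => C * Real.exp (c * R) * |τ - -τ|) atTop (𝓝 0) := by
      have : Tendsto (fun R : ℝ => Real.exp (c * R)) atTop (𝓝 0) :=
        Real.tendsto_exp_atBot.comp (tendsto_id.const_mul_atTop_of_neg hc)
      simpa using (this.const_mul C).mul_const |τ - -τ|
    refine squeeze_zero_norm' ?_ hlim
    filter_upwards [eventually_ge_atTop σ] with R hR
    refine intervalIntegral.norm_integral_le_of_norm_le_const fun y _ => ?_
    simpa using hC ((R : ℂ) + y * I) (by simpa using hR)
  have h4 := ((h1.sub h2).add (h3.const_mul I)).sub_const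
    (I * ∫ y in (-τ)..τ, Φ ((σ : ℂ) + y * I))
  have h5 : (∫ x in Ioi σ, Φ ((x : ℂ) + ((-τ : ℝ) : ℂ) * I)) - (∫ x in Ioi σ, Φ ((x : ℂ) + τ * I))
      + I * 0 - I * (∫ y in (-τ)..τ, Φ ((σ : ℂ) + y * I)) = 0 := by
    refine tendsto_nhds_unique h4 (tendsto_const_nhds.congr' ?_)
    filter_upwards [eventually_ge_atTop σ] with R hR
    have := rectIntegral_eq_zero (Φ := Φ) hR hτ.le fun s h _ _ => hd s (hs.trans_le h)
    rw [rectIntegral] at this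
    simp_rw [e] at this
    exact this.symm
  rw [rightLoopIntegral]
  simp_rw [e]
  rw [integral_Ici_eq_integral_Ioi, integral_Ici_eq_integral_Ioi]
  linear_combination (-(2 * Real.pi * I : ℂ)⁻¹) * h5

/-! ## Differentiation of the loop integral -/

lemma hasDerivAt_ofReal_cpow_neg_div {x : ℝ} (hx : x ≠ 0) {w : ℂ} (hw : w ≠ 0) (k : ℂ) :
    HasDerivAt (fun x : ℝ => k / w * (x : ℂ) ^ (-w)) (-(k * (x : ℂ) ^ (-w)) / x) x := by
  have h := (hasDerivAt_ofReal_cpow_const hx (neg_ne_zero.2 hw)).const_mul (k / w)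
  refine h.congr_deriv ?_
  rw [cpow_sub _ _ (ofReal_ne_zero.2 hx), cpow_one]
  field_simp

/-- Differentiating x^(-w)/w cancels the denominator w. Differentiation under the integral is
dominated on a neighbourhood (p, q) of x by the integrands at its two endpoints. -/
lemma hasDerivAt_curve_integral {k : ℂ → ℂ} {γ : ℝ → ℂ} {S : Set ℝ} (hS : MeasurableSet S)
    (hγ : ∀ y ∈ S, γ y ≠ 0)
    (h1 : ∀ x ∈ Ioo (0 : ℝ) 1, IntegrableOn (fun y => k (γ y) * (x : ℂ) ^ (-γ y)) S)
    (h2 : ∀ x ∈ Ioo (0 : ℝ) 1, IntegrableOn (fun y => k (γ y) / γ y * (x : ℂ) ^ (-γ y)) S)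
    {x : ℝ} (hx : x ∈ Ioo (0 : ℝ) 1) :
    HasDerivAt (fun x : ℝ => ∫ y in S, k (γ y) / γ y * (x : ℂ) ^ (-γ y))
      (-(∫ y in S, k (γ y) * (x : ℂ) ^ (-γ y)) / x) x := by
  obtain ⟨p, hp0, hpx⟩ := exists_between hx.1
  obtain ⟨q, hxq, hq1⟩ := exists_between hx.2
  have hp : p ∈ Ioo (0 : ℝ) 1 := ⟨hp0, hpx.trans hx.2⟩
  have hq : q ∈ Ioo (0 : ℝ) 1 := ⟨hx.1.trans hxq, hq1⟩
  have hsub : ∀ y ∈ Ioo p q, y ∈ Ioo (0 : ℝ) 1 := fun y hy => ⟨hp0.trans hy.1, hy.2.trans hq1⟩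
  have key := (hasDerivAt_integral_of_dominated_loc_of_deriv_le
    (μ := volume.restrict S) (F := fun (x : ℝ) y => k (γ y) / γ y * (x : ℂ) ^ (-γ y))
    (F' := fun (x : ℝ) y => -(k (γ y) * (x : ℂ) ^ (-γ y)) / x)
    (bound := fun y => (‖k (γ y) * (p : ℂ) ^ (-γ y)‖ + ‖k (γ y) * (q : ℂ) ^ (-γ y)‖) / p)
    (Ioo_mem_nhds hpx hxq) ?_ (h2 x hx) ?_ ?_ ?_ ?_).2
  · rwa [integral_div, integral_neg] at key
  · filter_upwards [Ioo_mem_nhds hpx hxq] with y hy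
    exact (h2 y (hsub y hy)).aestronglyMeasurable
  · exact ((h1 x hx).neg.div_const _).aestronglyMeasurable
  · refine Eventually.of_forall fun y u hu => ?_
    have hu0 := (hsub u hu).1
    rw [norm_div, norm_neg, norm_mul, norm_mul, norm_mul, norm_cpow_eq_rpow_re_of_pos hu0,
      norm_cpow_eq_rpow_re_of_pos hp0, norm_cpow_eq_rpow_re_of_pos hq.1, norm_real,
      Real.norm_of_nonneg hu0.le]
    -- A power function of u is monotone, so one of the endpoints dominates; which one depends on
    -- the sign of the exponent, hence the sum.
    have : u ^ (-γ y).re ≤ p ^ (-γ y).re + q ^ (-γ y).re := by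
      rcases le_total 0 (-γ y).re with h | h
      · have := Real.rpow_le_rpow hu0.le hu.2.le h
        have := Real.rpow_nonneg hp0.le (-γ y).re
        linarith
      · have := Real.rpow_le_rpow_of_nonpos hp0 hu.1.le h
        have := Real.rpow_nonneg hq.1.le (-γ y).re
        linarith
    rw [← mul_add]
    gcongr
    · have := Real.rpow_nonneg hp0.le (-γ y).re
      have := Real.rpow_nonneg hq.1.le (-γ y).re
      positivity
    · exact hu.1.le
  · exact (((h1 p hp).norm.add (h1 q hq).norm).div_const p)
  · refine (ae_restrict_iff' hS).2 (Eventually.of_forall fun y hy u hu => ?_)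
    exact hasDerivAt_ofReal_cpow_neg_div (hsub u hu).1.ne' (hγ y hy) _

/-- The operator -x d/dx multiplies the kernel by s and so undoes a division by s. Such a division
creates no new trouble: the loop avoids 0, since its rays are off the real axis and its vertical
side has σ > s₀ ≥ 0. -/
lemma hasDerivAt_leftLoopIntegral {k : ℂ → ℂ} {σ τ s₀ : ℝ} (hs₀ : 0 ≤ s₀) (hs : s₀ < σ)
    (hτ : 0 < τ) (hd : ∀ s : ℂ, s.im ≠ 0 ∨ s₀ < s.re → DifferentiableAt ℂ k s)
    (hk : ∀ x ∈ Ioo (0 : ℝ) 1, LeftDecay fun s => k s * (x : ℂ) ^ (-s))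
    {x : ℝ} (hx : x ∈ Ioo (0 : ℝ) 1) :
    HasDerivAt (fun x : ℝ => leftLoopIntegral σ τ fun s => k s / s * (x : ℂ) ^ (-s))
      (-(leftLoopIntegral σ τ fun s => k s * (x : ℂ) ^ (-s)) / x) x := by
  have hk1 : ∀ x ∈ Ioo (0 : ℝ) 1, LeftDecay fun s => k s / s * (x : ℂ) ^ (-s) := by
    intro x hx
    convert (hk x hx).div_id using 2
    ring
  have hdx : ∀ x ∈ Ioo (0 : ℝ) 1, ∀ s : ℂ, s.im ≠ 0 ∨ s₀ < s.re →
      DifferentiableAt ℂ (fun s => k s * (x : ℂ) ^ (-s)) s := fun x hx s h =>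
    (hd s h).fun_mul (differentiableAt_const_cpow_neg (ofReal_ne_zero.2 hx.1.ne') s)
  have hne : ∀ s : ℂ, s.im ≠ 0 ∨ s₀ < s.re → s ≠ 0 := by
    rintro s h rfl
    rcases h with h | h
    · simp at h
    · simp at h
      linarith
  have hdx1 : ∀ x ∈ Ioo (0 : ℝ) 1, ∀ s : ℂ, s.im ≠ 0 ∨ s₀ < s.re →
      DifferentiableAt ℂ (fun s => k s / s * (x : ℂ) ^ (-s)) s := fun x hx s h =>
    ((hd s h).fun_div differentiableAt_id (hne s h)).fun_mul
      (differentiableAt_const_cpow_neg (ofReal_ne_zero.2 hx.1.ne') s)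
  have hor : ∀ t : ℝ, t ≠ 0 → HasDerivAt
      (fun x : ℝ => ∫ y in Iic σ, k ((y : ℂ) + t * I) / ((y : ℂ) + t * I)
        * (x : ℂ) ^ (-((y : ℂ) + t * I)))
      (-(∫ y in Iic σ, k ((y : ℂ) + t * I) * (x : ℂ) ^ (-((y : ℂ) + t * I))) / x) x := by
    intro t ht
    refine hasDerivAt_curve_integral (γ := fun y : ℝ => (y : ℂ) + t * I) measurableSet_Iic
      (fun y _ => hne _ (Or.inl (by simpa using ht))) (fun x hx => ?_) (fun x hx => ?_) hx
    · exact (hk x hx).integrableOn_Iic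
        (continuousOn_horizontal _ fun s h => hdx x hx s (Or.inl (h ▸ ht)))
    · exact (hk1 x hx).integrableOn_Iic
        (continuousOn_horizontal _ fun s h => hdx1 x hx s (Or.inl (h ▸ ht)))
  have hver : HasDerivAt
      (fun x : ℝ => ∫ y in (-τ)..τ, k ((σ : ℂ) + y * I) / ((σ : ℂ) + y * I)
        * (x : ℂ) ^ (-((σ : ℂ) + y * I)))
      (-(∫ y in (-τ)..τ, k ((σ : ℂ) + y * I) * (x : ℂ) ^ (-((σ : ℂ) + y * I))) / x) x := by
    simp_rw [intervalIntegral.integral_of_le (show -τ ≤ τ by linarith)]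
    refine hasDerivAt_curve_integral (γ := fun y : ℝ => (σ : ℂ) + y * I) measurableSet_Ioc
      (fun y _ => hne _ (Or.inr (by simpa using hs))) (fun x hx => ?_) (fun x hx => ?_) hx
    · exact ((continuous_vertical_of_differentiableAt fun s h =>
        hdx x hx s (Or.inr (h.symm ▸ hs))).integrableOn_Icc (a := -τ) (b := τ)).mono_set
          Ioc_subset_Icc_self
    · exact ((continuous_vertical_of_differentiableAt fun s h =>
        hdx1 x hx s (Or.inr (h.symm ▸ hs))).integrableOn_Icc (a := -τ) (b := τ)).mono_set
          Ioc_subset_Icc_self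
  have e : ∀ y : ℝ, ((y : ℂ) - τ * I) = (y : ℂ) + ((-τ : ℝ) : ℂ) * I := by
    intro y; push_cast; ring
  have h := (((hor (-τ) (neg_ne_zero.2 hτ.ne')).add (hver.const_mul I)).sub
    (hor τ hτ.ne')).const_mul (2 * Real.pi * I : ℂ)⁻¹
  simp only [leftLoopIntegral, e]
  refine h.congr_deriv ?_
  ring

/-! ## The functions `G^{q,0}_{p,q}` as densities -/

lemma lineIntegral_eq_mellinInv (σ : ℝ) (k : ℂ → ℂ) (x : ℝ) :
    lineIntegral σ (fun s => k s * (x : ℂ) ^ (-s)) = mellinInv σ k x := by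
  rw [lineIntegral, mellinInv, mul_inv, mul_assoc, inv_mul_cancel_left₀ I_ne_zero, real_smul]
  push_cast
  rw [one_div]
  simp_rw [smul_eq_mul, mul_comm]

lemma MellinPair.mellinInv_eq {d : ℝ → ℝ} {K : ℂ → ℂ} {s₀ σ : ℝ} (h : MellinPair d K s₀)
    (hσ : s₀ < σ) {x : ℝ} (hx : 0 < x) (hc : ContinuousAt d x)
    (hv : Integrable fun y : ℝ => K (σ + y * I)) : mellinInv σ K x = d x := by
  have e : ∀ y : ℝ, mellin (fun x => (d x : ℂ)) ((σ : ℂ) + y * I) = K ((σ : ℂ) + y * I) :=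
    fun y => (h.hasMellin _ (by simpa using hσ)).2
  rw [← mellinInv_mellin_eq σ (fun x => (d x : ℂ)) hx
    (h.hasMellin σ (by simpa using hσ)).1 (hv.congr (Eventually.of_forall fun y => (e y).symm))
    (continuous_ofReal.continuousAt.comp hc)]
  simp only [mellinInv, e]

/-- If `p < q`, then `G^{q,0}_{p,q}` is the positive density whose Mellin transform is its
kernel. -/
theorem meijerG_eq_of_isDensityIoi {as' bs : List ℝ} (hlen : as'.length < bs.length) {d : ℝ → ℝ}
    {s₀ : ℝ} (h : IsDensityIoi d (meijerKernel [] (as'.map (↑)) (bs.map (↑)) []) s₀)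
    (hs₀ : ∀ σ, (∀ b ∈ bs, -b < σ) → s₀ < σ) {x : ℝ} (hx : 0 < x) :
    meijerG [] (as'.map (↑)) (bs.map (↑)) [] x = d x := by
  have hadm : ∃ c : ℝ × ℝ, MeijerAdmissible [] (bs.map (↑)) c := by
    simpa using meijerAdmissible_exists (as := []) (bs := bs) (by simp)
  -- The argument is 0 and the aperture is (q-p)π/2 > 0, so the contour is the vertical line.
  have harg : |(x : ℂ).arg| < (((bs.map ((↑) : ℝ → ℂ)).length + ([] : List ℂ).length : ℝ)
      - ((([] : List ℂ).length + (as'.map ((↑) : ℝ → ℂ)).length)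
        + ((bs.map ((↑) : ℝ → ℂ)).length + ([] : List ℂ).length)) / 2) * Real.pi := by
    rw [arg_ofReal_of_nonneg hx.le, abs_zero]
    refine mul_pos ?_ Real.pi_pos
    have : (as'.length : ℝ) < bs.length := by exact_mod_cast hlen
    simp only [List.length_map, List.length_nil]
    push_cast
    linarith
  rw [meijerG, dif_pos hadm, if_pos harg]
  obtain ⟨-, hb, -⟩ := hadm.choose_spec
  have hσ : s₀ < hadm.choose.1 := hs₀ _ fun b hb' => by
    simpa using (hb b (List.mem_map.2 ⟨b, hb', rfl⟩)).1
  exact (lineIntegral_eq_mellinInv _ _ x).trans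
    (h.mellinInv_eq hσ hx (h.cont.continuousAt (Ioi_mem_nhds hx)) (h.vertical _ hσ))

/-- One step of removing a factor 1/s: the loop with kernel k/s equals the tail integral of d(v)/v.
Differentiating both in x gives the loop with kernel k on one side and d on the other. -/
lemma leftLoopIntegral_eq_of_div {k : ℂ → ℂ} {d : ℝ → ℝ} {σ τ s₀ : ℝ} (hs₀ : 0 ≤ s₀)
    (hs : s₀ < σ) (hτ : 0 < τ) (hd : ∀ s : ℂ, s.im ≠ 0 ∨ s₀ < s.re → DifferentiableAt ℂ k s)
    (hk : ∀ x ∈ Ioo (0 : ℝ) 1, LeftDecay fun s => k s * (x : ℂ) ^ (-s))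
    (h : IsDensityIoo d k s₀)
    (hdiv : ∀ x ∈ Ioo (0 : ℝ) 1, leftLoopIntegral σ τ (fun s => k s / s * (x : ℂ) ^ (-s))
      = (mulConv (powDensity 0) d x : ℝ))
    {x : ℝ} (hx : x ∈ Ioo (0 : ℝ) 1) :
    leftLoopIntegral σ τ (fun s => k s * (x : ℂ) ^ (-s)) = d x := by
  have h1 := hasDerivAt_leftLoopIntegral hs₀ hs hτ hd hk hx
  have h2 := (h.hasDerivAt_tail 0 hx).ofReal_comp
  have h3 := h2.congr_of_eventuallyEq (f₁ := fun x : ℝ =>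
    leftLoopIntegral σ τ fun s => k s / s * (x : ℂ) ^ (-s)) (by
      filter_upwards [Ioo_mem_nhds hx.1 hx.2] with y hy
      rw [hdiv y hy, mulConv_powDensity_eq 0 d hy.1, Real.rpow_zero, one_mul])
  have h4 := h1.unique h3
  have hx0 : (x : ℂ) ≠ 0 := ofReal_ne_zero.2 hx.1.ne'
  rw [neg_zero, zero_sub, Real.rpow_neg_one] at h4
  push_cast at h4
  field_simp at h4
  linear_combination -h4

/-- The kernel is known to be bounded on vertical lines but need not be integrable there. After two
divisions by s it is integrable, the loop opens into a line and Mellin inversion applies; two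
removals of 1/s then return to k. -/
lemma leftLoopIntegral_eq_of_isDensityIoo {k : ℂ → ℂ} {d : ℝ → ℝ} {σ τ s₀ : ℝ} (h0 : 0 ≤ s₀)
    (hσ : s₀ < σ) (hτ : 0 < τ) (hk : ∀ s : ℂ, s.im ≠ 0 ∨ s₀ < s.re → DifferentiableAt ℂ k s)
    (hdec : ∀ x ∈ Ioo (0 : ℝ) 1, LeftDecay fun s => k s * (x : ℂ) ^ (-s))
    (h : IsDensityIoo d k s₀) {x : ℝ} (hx : x ∈ Ioo (0 : ℝ) 1) :
    leftLoopIntegral σ τ (fun s => k s * (x : ℂ) ^ (-s)) = d x := by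
  obtain ⟨C, hC⟩ := h.exists_norm_le hσ
  have hne : ∀ s : ℂ, s.im ≠ 0 ∨ s₀ < s.re → s ≠ 0 := by
    rintro s h rfl
    rcases h with h | h
    · simp at h
    · simp at h
      linarith
  have hdec1 : ∀ x ∈ Ioo (0 : ℝ) 1, LeftDecay fun s => k s / s * (x : ℂ) ^ (-s) := by
    intro x hx
    convert (hdec x hx).div_id using 2
    ring
  have hdec2 : ∀ x ∈ Ioo (0 : ℝ) 1, LeftDecay fun s => k s / s / s * (x : ℂ) ^ (-s) := by
    intro x hx
    convert (hdec1 x hx).div_id using 2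
    ring
  have hk1 : ∀ s : ℂ, s.im ≠ 0 ∨ s₀ < s.re → DifferentiableAt ℂ (fun s => k s / s) s :=
    fun s hs => (hk s hs).fun_div differentiableAt_id (hne s hs)
  have hk2 : ∀ s : ℂ, s.im ≠ 0 ∨ s₀ < s.re → DifferentiableAt ℂ (fun s => k s / s / s) s :=
    fun s hs => (hk1 s hs).fun_div differentiableAt_id (hne s hs)
  have h1 : IsDensityIoo (mulConv (powDensity 0) d) (fun s => k s / s) s₀ :=
    (h.mulConv_powDensity (c := 0) (by simpa using h0)).congr fun s _ => by simp [div_eq_mul_inv]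
  have h2 : IsDensityIoo (mulConv (powDensity 0) (mulConv (powDensity 0) d))
      (fun s => k s / s / s) s₀ :=
    (h1.mulConv_powDensity (c := 0) (by simpa using h0)).congr fun s _ => by simp [div_eq_mul_inv]
  refine leftLoopIntegral_eq_of_div h0 hσ hτ hk hdec h
    (fun x hx => leftLoopIntegral_eq_of_div h0 hσ hτ hk1 hdec1 h1 (fun x hx => ?_) hx) hx
  have hσ0 : 0 < σ := h0.trans_lt hσ
  have hC' : ∀ s : ℂ, σ ≤ s.re → ‖k s / s / s‖ ≤ C / ‖s‖ ^ 2 := by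
    intro s hs
    rw [div_div, norm_div, norm_mul, ← sq]
    gcongr
    exact hC s hs
  have hline := leftLoopIntegral_eq_lineIntegral (hdec2 x hx) (C := C * x ^ (-(σ + 1))) hσ hσ0 hτ
    (fun s hs => (hk2 s hs).fun_mul
      (differentiableAt_const_cpow_neg (ofReal_ne_zero.2 hx.1.ne') s)) (fun s hs1 hs2 => by
        rw [norm_mul, norm_cpow_eq_rpow_re_of_pos hx.1, mul_div_right_comm]
        have hCn : 0 ≤ C / ‖s‖ ^ 2 := (norm_nonneg _).trans (hC' s hs1)
        -- Since x < 1, the power is largest at the right end Re s = σ+1 of the strip.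
        have h3 : x ^ (-s).re ≤ x ^ (-(σ + 1)) :=
          Real.rpow_le_rpow_of_exponent_ge hx.1 hx.2.le (by rw [neg_re]; linarith)
        have := Real.rpow_nonneg hx.1.le (-s).re
        exact mul_le_mul (hC' s hs1) h3 this hCn)
  rw [hline, lineIntegral_eq_mellinInv]
  refine h2.mellinInv_eq hσ hx.1 (h2.cont.continuousAt (Ioo_mem_nhds hx.1 hx.2)) ?_
  exact integrable_of_norm_le_inv_sq (continuous_vertical_of_differentiableAt fun s hs =>
    hk2 s (Or.inr (hs.symm ▸ hσ))) hσ0 fun y => hC' _ (by simp)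

/-- If `p = q`, then `G^{q,0}_{p,q}` is the density on the unit interval whose Mellin transform is
its kernel. -/
theorem meijerG_eq_of_isDensityIoo {as' bs : List ℝ} (hlen : as'.length = bs.length) {d : ℝ → ℝ}
    {s₀ : ℝ} (h : IsDensityIoo d (meijerKernel [] (as'.map (↑)) (bs.map (↑)) []) s₀) (h0 : 0 ≤ s₀)
    (hs₀ : ∀ σ, (∀ b ∈ bs, -b < σ) → s₀ < σ) (hb : ∀ b ∈ bs, -b ≤ s₀) {x : ℝ} (hx : 0 < x)
    (hx1 : x ≠ 1) :
    meijerG [] (as'.map (↑)) (bs.map (↑)) [] x = d x := by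
  have hadm : ∃ c : ℝ × ℝ, MeijerAdmissible [] (bs.map (↑)) c := by
    simpa using meijerAdmissible_exists (as := []) (bs := bs) (by simp)
  -- For p = q the aperture is 0, so the contour is a loop even at argument 0.
  have harg : ¬ |(x : ℂ).arg| < (((bs.map ((↑) : ℝ → ℂ)).length + ([] : List ℂ).length : ℝ)
      - ((([] : List ℂ).length + (as'.map ((↑) : ℝ → ℂ)).length)
        + ((bs.map ((↑) : ℝ → ℂ)).length + ([] : List ℂ).length)) / 2) * Real.pi := by
    have : (as'.length : ℝ) = bs.length := by exact_mod_cast hlen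
    simp only [List.length_map, List.length_nil, this]
    rw [arg_ofReal_of_nonneg hx.le]
    simp
  rw [meijerG, dif_pos hadm, if_neg harg]
  obtain ⟨hτ, hb', -⟩ := hadm.choose_spec
  have hσ : s₀ < hadm.choose.1 := hs₀ _ fun b hb => by
    simpa using (hb' b (List.mem_map.2 ⟨b, hb, rfl⟩)).1
  generalize hadm.choose = c at hτ hσ
  obtain ⟨σ, τ⟩ := c
  simp only at hτ hσ ⊢
  have hk : ∀ s : ℂ, s.im ≠ 0 ∨ s₀ < s.re →
      DifferentiableAt ℂ (meijerKernel [] (as'.map ((↑) : ℝ → ℂ)) (bs.map (↑)) []) s := by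
    intro s hs
    refine differentiableAt_meijerKernel (fun b hb' => ?_) (by simp)
    obtain ⟨b, hb'', rfl⟩ := List.mem_map.1 hb'
    rcases hs with hs | hs
    · left; simpa using hs
    · right
      have := hb _ hb''
      simp
      linarith
  rcases lt_or_gt_of_ne hx1 with hx1 | hx1
  · rw [if_pos (Or.inr ⟨by simp [hlen], by simpa [abs_of_pos hx] using hx1⟩)]
    refine leftLoopIntegral_eq_of_isDensityIoo h0 hσ hτ hk (fun x hx => ?_) h ⟨hx, hx1⟩
    have hx2 : ‖(x : ℂ)‖ < 1 := by simpa [abs_of_pos hx.1] using hx.2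
    have hdec := leftDecay_meijerIntegrand [] (as'.map ((↑) : ℝ → ℂ)) (bs.map (↑)) [] (z := (x : ℂ))
      (ofReal_ne_zero.2 hx.1.ne') (Or.inr ⟨by simp [hlen], hx2⟩)
    exact hdec
  -- For x > 1 the kernel is bounded to the right of the loop while x^(-s) decays there at the rate
  -- log x, so the right loop vanishes, in agreement with the support of d.
  · obtain ⟨C, hC⟩ := h.exists_norm_le hσ
    rw [if_neg (by simp [hlen, abs_of_pos hx, hx1.le]), h.zero x hx1.le, ofReal_zero]
    refine rightLoopIntegral_eq_zero (c := -Real.log x) (C := C) hσ hτ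
      (by linarith [Real.log_pos hx1]) (fun s hs => (hk s (Or.inr hs)).fun_mul
        (differentiableAt_const_cpow_neg (ofReal_ne_zero.2 hx.ne') s)) fun s hs => ?_
    rw [meijerIntegrand, norm_mul, norm_cpow_eq_rpow_re_of_pos hx, Real.rpow_def_of_pos hx, neg_re,
      mul_neg, neg_mul]
    gcongr
    exact hC s hs

/-! ## Photon-added states -/

namespace SIPSystem

variable (S : SIPSystem)

lemma partialSum_iterate_shift (a : ℝ) (j k N : ℕ) :
    S.partialSum (S.shift^[j] a) k N = S.partialSum a (k + j) (N + j) := by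
  unfold partialSum paramSeq
  rw [← Finset.sum_Ico_add' (fun s => S.remainder (S.shift^[s] a))]
  simp only [← Function.iterate_add_apply]

lemma raise_iterate_of_lt (φ : ℝ → ℕ → ℂ) (m : ℕ) :
    ∀ (a : ℝ) (n : ℕ), n < m → (S.raise^[m] φ) a n = 0 := by
  induction m with
  | zero => intro a n hn; omega
  | succ m ih =>
    intro a n hn
    rw [Function.iterate_succ_apply']
    cases n with
    | zero => rfl
    | succ n => simp [raise, ih _ n (by omega)]

/-- The j-th outer application of the operator acts at the parameter shifted j times (j from 0),
where the energy is R(a_{j+1}) + ⋯ + R(a_{n+m}). These are the sums under the second square root of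
K. -/
lemma raise_iterate_add (φ : ℝ → ℕ → ℂ) (m : ℕ) : ∀ (a : ℝ) (n : ℕ),
    (S.raise^[m] φ) a (n + m)
      = (∏ j ∈ Finset.range m, (√(S.partialSum a j (n + m)) : ℂ)) * φ (S.shift^[m] a) n := by
  induction m with
  | zero => intro a n; simp
  | succ m ih =>
    intro a n
    rw [Function.iterate_succ_apply', ← add_assoc]
    simp only [raise]
    rw [ih, Finset.prod_range_succ', energy, Function.iterate_succ_apply]
    have : ∀ j, S.partialSum (S.shift a) j (n + m) = S.partialSum a (j + 1) (n + m + 1) :=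
      fun j => S.partialSum_iterate_shift a 1 j (n + m)
    simp only [this]
    ring

variable {S} {a : ℝ} (hS : ∀ k N, k < N → 0 < S.partialSum a k N) (Z : ℝ → ℂ) (m : ℕ)
include hS

/-- The coefficient h_n is evaluated at the parameter shifted m times, which moves its indices 1,
..., n to m+1, ..., m+n; the square roots from the raising operators supply the other factor. -/
lemma paCoeff_add (z : ℂ) (n : ℕ) : S.paCoeff Z m z a (n + m) = z ^ n / S.kCoeff Z m a n := by
  rw [paCoeff, raise_iterate_add, sipcsCoeff, hCoeff, kCoeff]
  rw [Finset.prod_Ico_eq_prod_range, Finset.prod_Ico_eq_prod_range, Nat.add_sub_cancel]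
  rw [Real.sqrt_prod (Finset.range m) (fun j hj => (hS j _ (by
    have := Finset.mem_range.mp hj; omega)).le)]
  simp only [partialSum_iterate_shift, paramSeq, ← Function.iterate_add_apply, Complex.ofReal_prod,
    add_comm m]
  simp only [div_eq_mul_inv, mul_inv, inv_inv]
  ring

lemma norm_kCoeff_sq (n : ℕ) :
    ‖S.kCoeff Z m a n‖ ^ 2 = (∏ k ∈ Finset.range n, S.partialSum a (m + k) (n + m))
      / ((∏ k ∈ Finset.range n, ‖Z (S.paramSeq a (m + k))‖ ^ 2)
        * ∏ k ∈ Finset.range m, S.partialSum a k (n + m)) := by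
  rw [kCoeff, Finset.prod_Ico_eq_prod_range, Finset.prod_Ico_eq_prod_range, Nat.add_sub_cancel]
  rw [norm_div, norm_mul, Complex.norm_real, Complex.norm_real, Real.norm_of_nonneg (Real.sqrt_nonneg _),
    Real.norm_of_nonneg (Real.sqrt_nonneg _), div_pow, mul_pow, Real.sq_sqrt, Real.sq_sqrt,
    norm_prod, Finset.prod_pow]
  all_goals
    refine Finset.prod_nonneg fun k hk => (hS _ _ ?_).le
    have := Finset.mem_range.mp hk
    omega

lemma kCoeff_ne_zero (hZ : ∀ k, Z (S.paramSeq a k) ≠ 0) (n : ℕ) : S.kCoeff Z m a n ≠ 0 := by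
  have h : 0 < ‖S.kCoeff Z m a n‖ ^ 2 := by
    rw [norm_kCoeff_sq hS]
    refine div_pos (Finset.prod_pos fun k hk => hS _ _ ?_)
      (mul_pos (Finset.prod_pos fun k hk => ?_) (Finset.prod_pos fun k hk => hS _ _ ?_))
    · have := Finset.mem_range.mp hk
      omega
    · exact pow_pos (norm_pos_iff.mpr (hZ _)) 2
    · have := Finset.mem_range.mp hk
      omega
  intro h0
  simp [h0] at h

end SIPSystem

section Hilbert

variable {E : Type*} [NormedAddCommGroup E] [InnerProductSpace ℂ E]

lemma Orthonormal.hasSum_smul_norm_sq [CompleteSpace E] {e : ℕ → E} (he : Orthonormal ℂ e)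
    {c : ℕ → ℂ} {T : ℝ} (hc : HasSum (fun n => ‖c n‖ ^ 2) T) :
    ∃ v, HasSum (fun n => c n • e n) v ∧ ‖v‖ ^ 2 = T := by
  have h1 := (he.orthogonalFamily.summable_iff_norm_sq_summable c).mpr hc.summable
  simp only [LinearIsometry.toSpanSingleton_apply] at h1
  refine ⟨_, h1.hasSum, ?_⟩
  refine tendsto_nhds_unique (h1.hasSum.norm.pow 2) (hc.congr fun s => ?_)
  have := he.orthogonalFamily.norm_sum c s
  simp only [LinearIsometry.toSpanSingleton_apply] at this
  exact this.symm

lemma SIPSystem.paState_properties [CompleteSpace E] {S : SIPSystem} {a : ℝ}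
    (hS : ∀ k N, k < N → 0 < S.partialSum a k N)
    (Z : ℝ → ℂ) (m : ℕ) (Ψ : HilbertBasis ℕ ℂ E) {z : ℂ} {T : ℝ} (hT : 0 < T)
    (hsum : HasSum (fun n : ℕ => (‖z‖ ^ 2) ^ n / ‖S.kCoeff Z m a n‖ ^ 2) T) :
    HasSum (fun n : ℕ => (‖z‖ ^ 2) ^ n / ‖S.kCoeff Z m a n‖ ^ 2) T ∧
    S.normFactor Z m a (‖z‖ ^ 2) = T ^ (-(1 / 2) : ℝ) ∧
    ‖S.paState Z m a Ψ z‖ = 1 ∧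
    HasSum (fun n : ℕ => ((S.normFactor Z m a (‖z‖ ^ 2) : ℂ) * (z ^ n / S.kCoeff Z m a n))
      • Ψ (n + m)) (S.paState Z m a Ψ z) := by
  have hN : S.normFactor Z m a (‖z‖ ^ 2) = T ^ (-(1 / 2) : ℝ) := by
    rw [normFactor, hsum.tsum_eq]
  have he := Ψ.orthonormal.comp (fun n => n + m) (add_left_injective m)
  obtain ⟨v, hv, hvn⟩ := he.hasSum_smul_norm_sq (c := fun n => z ^ n / S.kCoeff Z m a n) (T := T) (by
    convert hsum using 2 with n
    rw [norm_div, norm_pow, div_pow]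
    ring)
  have hst : S.paState Z m a Ψ z = (S.normFactor Z m a (‖z‖ ^ 2) : ℂ) • v := by
    rw [paState]
    congr 1
    refine HasSum.tsum_eq ?_
    rw [← (add_left_injective m).hasSum_iff]
    · refine hv.congr_fun fun n => ?_
      simp only [Function.comp, paCoeff_add hS]
    · intro n hn
      rw [paCoeff, raise_iterate_of_lt, zero_smul]
      by_contra h
      exact hn ⟨n - m, by simp only; omega⟩
  refine ⟨hsum, hN, ?_, ?_⟩
  · rw [hst, norm_smul, hN, Complex.norm_real, Real.norm_of_nonneg (by positivity),
      ← Real.sqrt_sq (norm_nonneg v), hvn, Real.sqrt_eq_rpow, ← Real.rpow_add hT]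
    norm_num
  · rw [hst]
    simpa only [mul_smul, Function.comp] using hv.const_smul (S.normFactor Z m a (‖z‖ ^ 2) : ℂ)

lemma rpow_neg_half_sq_inv {T : ℝ} (hT : 0 < T) : ((T ^ (-(1 / 2) : ℝ)) ^ 2)⁻¹ = T := by
  rw [← Real.rpow_natCast, ← Real.rpow_mul hT.le]
  norm_num [Real.rpow_neg_one]

/-! ## Resolution of the identity -/

lemma Orthonormal.exists_lp_hasSum {e : ℕ → E} [CompleteSpace E] (he : Orthonormal ℂ e) {φ : E}
    (hφ : φ ∈ (Submodule.span ℂ (range e)).topologicalClosure) :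
    ∃ c : lp (fun _ : ℕ => ℂ) 2, he.orthogonalFamily.linearIsometry c = φ := by
  have h := he.orthogonalFamily.range_linearIsometry
  rw [Submodule.span_range_eq_iSup] at hφ
  have h2 : φ ∈ LinearMap.range he.orthogonalFamily.linearIsometry.toLinearMap := by
    rw [h]
    have h3 : ∀ i, (LinearIsometry.toSpanSingleton ℂ E (he.1 i)).range
        = Submodule.span ℂ {e i} := fun i => by
      ext y
      rw [Submodule.mem_span_singleton]
      rfl
    simpa only [h3] using hφ
  exact h2

/-- A weakly measurable family of vectors whose coefficients along an orthonormal sequence are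
themselves orthonormal in `L²(μ)` resolves the identity of the closed span of the sequence. -/
lemma integral_inner_mul_inner_of_orthonormal {X : Type*} [MeasurableSpace X] {μ : Measure X}
    [CompleteSpace E] {e : ℕ → E} (he : Orthonormal ℂ e) {u : ℕ → X → ℂ}
    (hu : ∀ n, MemLp (u n) 2 μ)
    (hou : ∀ n k, ∫ x, (starRingEnd ℂ) (u n x) * u k x ∂μ = if n = k then 1 else 0)
    {v : X → E} (hv : ∀ᵐ x ∂μ, ∀ n, inner ℂ (e n) (v x) = u n x) {φ ψ : E}
    (hφ : φ ∈ (Submodule.span ℂ (range e)).topologicalClosure)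
    (hψ : ψ ∈ (Submodule.span ℂ (range e)).topologicalClosure) :
    Integrable (fun x => inner ℂ φ (v x) * inner ℂ (v x) ψ) μ ∧
      ∫ x, inner ℂ φ (v x) * inner ℂ (v x) ψ ∂μ = inner ℂ φ ψ := by
  -- The inner product is conjugate linear on the left, so pairing v(x) with a vector of
  -- coefficients c gives the sum of c_n times the conjugate of u_n(x).
  have hw : ∀ n, MemLp (fun x => (starRingEnd ℂ) (u n x)) 2 μ := fun n => (hu n).star
  have hf : Orthonormal ℂ (fun n => (hw n).toLp _) := by
    rw [orthonormal_iff_ite]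
    intro n k
    rw [L2.inner_def, integral_congr_ae (g := fun x => (starRingEnd ℂ) (u k x) * u n x), hou]
    · simp only [eq_comm]
    · filter_upwards [(hw n).coeFn_toLp, (hw k).coeFn_toLp] with x h1 h2
      rw [h1, h2]
      simp
  -- The partial sums converge in L², hence almost everywhere along a subsequence, while at a fixed
  -- x they converge to the inner product by continuity. Uniqueness of limits identifies the L²
  -- element with the pointwise pairing.
  have key : ∀ c : lp (fun _ : ℕ => ℂ) 2, ∀ᵐ x ∂μ,
      (hf.orthogonalFamily.linearIsometry c) x
        = inner ℂ (v x) (he.orthogonalFamily.linearIsometry c) := by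
    intro c
    obtain ⟨ns, hns, hlim⟩ := (tendstoInMeasure_of_tendsto_Lp
      (hf.orthogonalFamily.hasSum_linearIsometry c).tendsto_sum_nat).exists_seq_tendsto_ae
    have h1 : ∀ᵐ x ∂μ, ∀ N : ℕ, (∑ i ∈ Finset.range N,
        (LinearIsometry.toSpanSingleton ℂ (Lp ℂ 2 μ) (hf.1 i)) (c i) : Lp ℂ 2 μ) x
          = ∑ i ∈ Finset.range N, c i * (starRingEnd ℂ) (u i x) := by
      rw [ae_all_iff]
      intro N
      have h2 : ∀ᵐ x ∂μ, ∀ i : ℕ,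
          (LinearIsometry.toSpanSingleton ℂ (Lp ℂ 2 μ) (hf.1 i)) (c i) x
            = c i * (starRingEnd ℂ) (u i x) := by
        rw [ae_all_iff]
        intro i
        filter_upwards [Lp.coeFn_smul (c i) ((hw i).toLp _), (hw i).coeFn_toLp] with x h3 h4
        rw [LinearIsometry.toSpanSingleton_apply, h3, Pi.smul_apply, h4, smul_eq_mul]
      filter_upwards [h2, Lp.coeFn_fun_finsetSum (Finset.range N) (fun i =>
        (LinearIsometry.toSpanSingleton ℂ (Lp ℂ 2 μ) (hf.1 i)) (c i))] with x h3 h4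
      rw [h4]
      exact Finset.sum_congr rfl fun i _ => h3 i
    filter_upwards [hlim, h1, hv] with x hx1 hx2 hx3
    refine tendsto_nhds_unique hx1 ?_
    have h5 := ((he.orthogonalFamily.hasSum_linearIsometry c).mapL (innerSL ℂ (v x))).tendsto_sum_nat.comp
      hns.tendsto_atTop
    refine h5.congr fun i => ?_
    simp only [Function.comp, hx2]
    refine Finset.sum_congr rfl fun j _ => ?_
    rw [LinearIsometry.toSpanSingleton_apply, innerSL_apply_apply, inner_smul_right,
      ← inner_conj_symm, hx3]
  obtain ⟨c, rfl⟩ := he.exists_lp_hasSum hφ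
  obtain ⟨d, rfl⟩ := he.exists_lp_hasSum hψ
  -- The integrand is now a pointwise inner product of two L² elements. Two isometries from ℓ², into
  -- E and into L², carry c and d to these elements and to the given vectors, so the inner products
  -- agree.
  have hae : (fun x => inner ℂ (he.orthogonalFamily.linearIsometry c) (v x)
      * inner ℂ (v x) (he.orthogonalFamily.linearIsometry d)) =ᵐ[μ]
      fun x => inner ℂ ((hf.orthogonalFamily.linearIsometry c : Lp ℂ 2 μ) x)
        ((hf.orthogonalFamily.linearIsometry d : Lp ℂ 2 μ) x) := by
    filter_upwards [key c, key d] with x h1 h2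
    rw [h1, h2, RCLike.inner_apply, inner_conj_symm, mul_comm]
  refine ⟨(L2.integrable_inner _ _).congr hae.symm, ?_⟩
  rw [integral_congr_ae hae, ← L2.inner_def, LinearIsometry.inner_map_map,
    LinearIsometry.inner_map_map]

end Hilbert

/-! ### Polar coordinates and resolution of the identity from moments -/

lemma integral_exp_int_mul_I (k : ℤ) :
    ∫ θ in Ioo (-Real.pi) Real.pi, Complex.exp (k * θ * I) = if k = 0 then 2 * (Real.pi : ℂ) else 0 := by
  rw [← integral_Ioc_eq_integral_Ioo, ← intervalIntegral.integral_of_le (by linarith [Real.pi_pos])]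
  split_ifs with hk
  · simp [hk]
    ring
  · have h : ∀ θ : ℝ, (k : ℂ) * θ * I = (k * I) * θ := fun θ => by ring
    simp only [h]
    rw [integral_exp_mul_complex (by simp [hk])]
    rw [div_eq_zero_iff]
    left
    rw [sub_eq_zero, Complex.exp_eq_exp_iff_exists_int]
    refine ⟨k, ?_⟩
    push_cast
    ring

/-- The angular integral annihilates n ≠ k, and x = r² turns the radial one into a moment. No
integrability of F is needed: the identities used remain valid with the default value 0 of a
divergent integral. -/
lemma integral_radial_mul_pow (F : ℝ → ℝ) (n k : ℕ) :
    ∫ z : ℂ, (F (‖z‖ ^ 2) : ℂ) * ((starRingEnd ℂ) z ^ n * z ^ k)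
      = if n = k then (Real.pi : ℂ) * ((∫ x in Ioi (0:ℝ), x ^ n * F x : ℝ) : ℂ) else 0 := by
  rw [← Complex.integral_comp_polarCoord_symm, polarCoord_target]
  have h1 : ∀ p ∈ Ioi (0:ℝ) ×ˢ Ioo (-Real.pi) Real.pi,
      p.1 • ((F (‖Complex.polarCoord.symm p‖ ^ 2) : ℂ)
        * ((starRingEnd ℂ) (Complex.polarCoord.symm p) ^ n * Complex.polarCoord.symm p ^ k))
      = ((p.1 * F (p.1 ^ 2) * p.1 ^ (n + k) : ℝ) : ℂ)
        * Complex.exp (((k : ℤ) - n : ℤ) * p.2 * I) := by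
    rintro ⟨r, θ⟩ ⟨hr, -⟩
    simp only [mem_Ioi] at hr
    simp only [Complex.norm_polarCoord_symm, abs_of_pos hr]
    rw [Complex.polarCoord_symm_apply]
    simp only
    rw [Complex.ofReal_cos, Complex.ofReal_sin, ← Complex.exp_mul_I]
    simp only [map_mul, ← Complex.exp_conj, Complex.conj_ofReal, Complex.conj_I, mul_pow,
      ← Complex.exp_nat_mul, Complex.real_smul]
    have : ∀ a b : ℂ, (k:ℂ) * (θ * I) + (n:ℂ) * (θ * -I) = ((k : ℤ) - n : ℤ) * θ * I := by
      intro _ _; push_cast; ring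
    rw [← this 0 0, Complex.exp_add]
    push_cast
    ring
  rw [setIntegral_congr_fun (measurableSet_Ioi.prod measurableSet_Ioo) h1, Measure.volume_eq_prod,
    setIntegral_prod_mul (fun r : ℝ => ((r * F (r ^ 2) * r ^ (n + k) : ℝ) : ℂ))
    (fun θ : ℝ => Complex.exp (((k : ℤ) - n : ℤ) * θ * I)), integral_exp_int_mul_I,
    integral_complex_ofReal]
  split_ifs with hk hn hn
  · subst hn
    rw [← integral_comp_rpow_Ioi_of_pos (g := fun x : ℝ => x ^ n * F x) (p := 2) (by norm_num)]
    rw [mul_comm (Real.pi : ℂ), ← mul_assoc]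
    congr 1
    rw [← Complex.ofReal_ofNat, ← Complex.ofReal_mul, ← integral_mul_const]
    congr 1
    refine setIntegral_congr_fun measurableSet_Ioi fun x hx => ?_
    simp only [smul_eq_mul]
    norm_num
    ring
  · omega
  · omega
  · simp

lemma ae_ne_zero_complex : ∀ᵐ z : ℂ, z ≠ 0 := by
  simp [ae_iff]

/-- The criterion is applied to the vectors √ω·|z⟩, whose coefficients are √F(|z|²) z^n/K_n with F =
N²ω on D. Their orthonormality is exactly the moment problem. -/
lemma ResolvesIdentity.of_moments {E : Type*} [NormedAddCommGroup E] [InnerProductSpace ℂ E]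
    [CompleteSpace E] {Ψ : HilbertBasis ℕ ℂ E} {m : ℕ} {D : Set ℂ} {state : ℂ → E} {ω N g : ℝ → ℝ}
    {K : ℕ → ℂ} (hD : MeasurableSet D) (hK : ∀ n, K n ≠ 0)
    (hstate : ∀ z ∈ D, z ≠ 0 →
      HasSum (fun n : ℕ => ((N (‖z‖ ^ 2) : ℂ) * (z ^ n / K n)) • Ψ (n + m)) (state z))
    (hN : ∀ x, 0 < x → 0 ≤ N x) (hgm : Measurable g) (hg0 : ∀ x, 0 < x → 0 ≤ g x)
    (hgD : ∀ z ∉ D, g (‖z‖ ^ 2) = 0)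
    (hgω : ∀ z ∈ D, z ≠ 0 →
      g (‖z‖ ^ 2) = Real.pi * N (‖z‖ ^ 2) ^ 2 * ((‖z‖ ^ 2) ^ m)⁻¹ * ω (‖z‖ ^ 2))
    (hω : ∀ z ∈ D, z ≠ 0 → 0 ≤ ω (‖z‖ ^ 2))
    (hmom : ∀ n : ℕ, ∫ x in Ioi (0 : ℝ), x ^ (n + m) * g x = ‖K n‖ ^ 2) :
    ResolvesIdentity Ψ m D state ω := by
  -- Expressing N²ω through g makes it measurable and zero outside D, whereas ω and N are not
  -- assumed to be measurable.
  set F : ℝ → ℝ := fun x => g x * x ^ m / Real.pi with hF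
  have hF0 : ∀ x, 0 < x → 0 ≤ F x := fun x hx => by
    have := hg0 x hx
    have := Real.pi_pos
    positivity
  set u : ℕ → ℂ → ℂ := fun n z => (√(F (‖z‖ ^ 2)) : ℂ) * (z ^ n / K n) with hu
  have hum : ∀ n, Measurable (u n) := fun n => by
    have : Measurable F := (hgm.mul (measurable_id.pow_const m)).div_const _
    have h2 : Measurable fun z : ℂ => F (‖z‖ ^ 2) := this.comp (measurable_norm.pow_const 2)
    exact (Complex.measurable_ofReal.comp h2.sqrt).mul ((measurable_id.pow_const n).div_const _)
  have hpt : ∀ z : ℂ, z ≠ 0 → ∀ n k, (starRingEnd ℂ) (u n z) * u k z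
      = ((starRingEnd ℂ) (K n) * K k)⁻¹
        * ((F (‖z‖ ^ 2) : ℂ) * ((starRingEnd ℂ) z ^ n * z ^ k)) := by
    intro z hz n k
    have h1 : (F (‖z‖ ^ 2) : ℂ) = (√(F (‖z‖ ^ 2)) : ℂ) * (√(F (‖z‖ ^ 2)) : ℂ) := by
      rw [← Complex.ofReal_mul, Real.mul_self_sqrt (hF0 _ (by positivity))]
    rw [h1]
    simp only [hu, map_mul, Complex.conj_ofReal, map_div₀, map_pow, mul_inv]
    ring
  have hzero : ∀ n k, ∀ z ∉ D, (starRingEnd ℂ) (u n z) * u k z = 0 := by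
    intro n k z hz
    simp [hu, hF, hgD z hz]
  have hou : ∀ n k, ∫ z in D, (starRingEnd ℂ) (u n z) * u k z = if n = k then 1 else 0 := by
    intro n k
    rw [setIntegral_eq_integral_of_forall_compl_eq_zero (hzero n k)]
    rw [integral_congr_ae (ae_ne_zero_complex.mono fun z hz => hpt z hz n k), integral_const_mul,
      integral_radial_mul_pow]
    split_ifs with h
    · subst h
      have h2 : ∫ x in Ioi (0:ℝ), x ^ n * F x = ‖K n‖ ^ 2 / Real.pi := by
        rw [← hmom n, ← integral_div]
        congr 1
        ext x
        simp only [hF, pow_add]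
        ring
      rw [h2, mul_comm (starRingEnd ℂ (K n)), Complex.mul_conj, Complex.normSq_eq_norm_sq]
      have h3 : (‖K n‖ : ℂ) ≠ 0 := by simpa using hK n
      have h4 : (Real.pi : ℂ) ≠ 0 := by simp
      push_cast
      field_simp
    · simp
  have hmem : ∀ n, MemLp (u n) 2 (volume.restrict D) := by
    intro n
    rw [memLp_two_iff_integrable_sq_norm (hum n).aestronglyMeasurable]
    -- A nonintegrable function has integral 0 by convention; here the integral is 1, so
    -- integrability follows.
    have h1 : Integrable (fun z => (starRingEnd ℂ) (u n z) * u n z) (volume.restrict D) :=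
      Integrable.of_integral_ne_zero (by rw [hou]; simp)
    refine h1.norm.congr (ae_of_all _ fun z => ?_)
    simp [pow_two]
  have hv : ∀ᵐ z ∂(volume.restrict D), ∀ n,
      inner ℂ (Ψ (n + m)) ((√(ω (‖z‖ ^ 2)) : ℂ) • state z) = u n z := by
    filter_upwards [ae_restrict_mem hD, ae_restrict_of_ae ae_ne_zero_complex] with z hzD hz n
    have h1 := (hstate z hzD hz).mapL (innerSL ℂ (Ψ (n + m)))
    have h2 : HasSum (fun k => innerSL ℂ (Ψ (n + m))
        (((N (‖z‖ ^ 2) : ℂ) * (z ^ k / K k)) • Ψ (k + m))) ((N (‖z‖ ^ 2) : ℂ) * (z ^ n / K n)) := by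
      convert hasSum_ite_eq n ((N (‖z‖ ^ 2) : ℂ) * (z ^ n / K n)) using 2 with k
      rw [innerSL_apply_apply, inner_smul_right, orthonormal_iff_ite.mp Ψ.orthonormal]
      by_cases hk : k = n
      · simp [hk]
      · simp [hk, Ne.symm hk]
    have h3 := h1.unique h2
    rw [innerSL_apply_apply] at h3
    rw [inner_smul_right, h3]
    have h4 : F (‖z‖ ^ 2) = N (‖z‖ ^ 2) ^ 2 * ω (‖z‖ ^ 2) := by
      have : (‖z‖ ^ 2) ^ m ≠ 0 := by positivity
      simp only [hF]
      rw [hgω z hzD hz]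
      field_simp
    simp only [hu, h4]
    rw [Real.sqrt_mul (sq_nonneg _), Real.sqrt_sq (hN _ (by positivity))]
    push_cast
    ring
  have he := Ψ.orthonormal.comp (fun n => n + m) (add_left_injective m)
  intro φ hφ ψ hψ
  obtain ⟨h1, h2⟩ := integral_inner_mul_inner_of_orthonormal he hmem hou hv hφ hψ
  have hae : (fun z => inner ℂ φ ((√(ω (‖z‖ ^ 2)) : ℂ) • state z)
      * inner ℂ ((√(ω (‖z‖ ^ 2)) : ℂ) • state z) ψ) =ᵐ[volume.restrict D]
      fun z => inner ℂ φ (state z) * (ω (‖z‖ ^ 2) : ℂ) * inner ℂ (state z) ψ := by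
    filter_upwards [ae_restrict_mem hD, ae_restrict_of_ae ae_ne_zero_complex] with z hzD hz
    rw [inner_smul_right, inner_smul_left, Complex.conj_ofReal]
    have h1 : (ω (‖z‖ ^ 2) : ℂ) = (√(ω (‖z‖ ^ 2)) : ℂ) * (√(ω (‖z‖ ^ 2)) : ℂ) := by
      rw [← Complex.ofReal_mul, Real.mul_self_sqrt (hω z hzD hz)]
    rw [h1]
    ring
  exact ⟨h1.congr hae, by rw [← integral_congr_ae hae, h2]⟩

/-! ## Products of linear factors -/

lemma pow_mul_prod_range {M : Type*} [CommMonoid M] (c : M) (f : ℕ → M) (n : ℕ) :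
    c ^ n * ∏ k ∈ Finset.range n, f k = ∏ k ∈ Finset.range n, c * f k := by
  rw [Finset.prod_mul_distrib, Finset.prod_const, Finset.card_range]

lemma Real.prod_range_add_natCast {x : ℝ} (hx : 0 < x) (n : ℕ) :
    ∏ k ∈ Finset.range n, (x + k) = Real.Gamma (x + n) / Real.Gamma x := by
  rw [eq_div_iff (Real.Gamma_pos_of_pos hx).ne']
  induction n with
  | zero => simp
  | succ n ih =>
    rw [Finset.prod_range_succ, mul_right_comm, ih, Nat.cast_succ, ← add_assoc,
      Real.Gamma_add_one (by positivity), mul_comm]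

lemma Real.prod_range_add_sub_natCast {x : ℝ} (hx : -1 < x) (n : ℕ) :
    ∏ k ∈ Finset.range n, (x + n - k) = Real.Gamma (x + n + 1) / Real.Gamma (x + 1) := by
  rw [← Finset.prod_range_reflect, ← add_right_comm x 1,
    ← Real.prod_range_add_natCast (by linarith : 0 < x + 1) n]
  refine Finset.prod_congr rfl fun k hk => ?_
  have := Finset.mem_range.mp hk
  rw [Nat.cast_sub (by omega), Nat.cast_sub (by omega)]
  push_cast
  ring

lemma Real.prod_range_add_two_mul {x : ℝ} (hx : 0 < x) (n : ℕ) :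
    ∏ k ∈ Finset.range n, ((x + 2 * k) * (x + 2 * k + 1))
      = Real.Gamma (x + 2 * n) / Real.Gamma x := by
  rw [eq_div_iff (Real.Gamma_pos_of_pos hx).ne']
  induction n with
  | zero => simp
  | succ n ih =>
    rw [Finset.prod_range_succ, mul_right_comm, ih,
      show x + 2 * ((n + 1 : ℕ) : ℝ) = x + 2 * n + 1 + 1 by push_cast; ring,
      Real.Gamma_add_one (by positivity), Real.Gamma_add_one (by positivity)]
    ring

lemma Real.ascPochhammer_eval_eq {x : ℝ} (hx : 0 < x) (n : ℕ) :
    (ascPochhammer ℝ n).eval x = Real.Gamma (x + n) / Real.Gamma x := by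
  rw [← Real.prod_range_add_natCast hx]
  induction n with
  | zero => simp
  | succ n ih => rw [ascPochhammer_succ_eval, Finset.prod_range_succ, ih]

/-! ## Expansion coefficients of the individual systems -/

namespace SIPSystem

lemma paramSeq_of_shift_sub_one {S : SIPSystem} (h : S.shift = fun a => a - 1) (a : ℝ) (k : ℕ) :
    S.paramSeq a k = a - k := by
  rw [paramSeq, h]
  induction k with
  | zero => simp
  | succ k ih =>
    rw [Function.iterate_succ_apply', ih]
    push_cast
    ring

lemma partialSum_of_remainder_const {S : SIPSystem} {γ : ℝ} (h : S.remainder = fun _ => γ) (a : ℝ)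
    {k N : ℕ} (hk : k ≤ N) : S.partialSum a k N = γ * (N - k) := by
  rw [partialSum, h]
  simp [Nat.cast_sub hk, mul_comm]

lemma partialSum_aType (β γ lam δ a ρ : ℝ) (hρ : ρ = -(a + γ)) {k N : ℕ} (hk : k ≤ N) :
    (aType β γ lam δ).partialSum a k N = β ^ 2 * ((N - k) * (2 * ρ + N + k)) := by
  have h1 : ∀ s, (aType β γ lam δ).paramSeq a s = a - s := paramSeq_of_shift_sub_one rfl a
  induction N, hk using Nat.le_induction with
  | base => simp [partialSum]
  | succ N hN ih =>
    rw [partialSum, Finset.sum_Ico_succ_top (by omega), ← partialSum, ih, h1]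
    simp only [aType]
    subst hρ
    push_cast
    ring

end SIPSystem

lemma partialSum_pos_of_remainder_const {S : SIPSystem} {γ : ℝ} (hγ : 0 < γ)
    (h : S.remainder = fun _ => γ) (a : ℝ) {k N : ℕ} (hk : k < N) : 0 < S.partialSum a k N := by
  rw [S.partialSum_of_remainder_const h a hk.le]
  have : (k : ℝ) < N := by exact_mod_cast hk
  exact mul_pos hγ (by linarith)

lemma norm_kCoeff_sq_of_remainder_const {S : SIPSystem} {γ : ℝ} (hγ : 0 < γ)
    (h : S.remainder = fun _ => γ) (Z : ℝ → ℂ) (m : ℕ) (a : ℝ) (n : ℕ) :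
    ‖S.kCoeff Z m a n‖ ^ 2 = γ ^ n * Real.Gamma (n + 1) ^ 2
      / ((∏ k ∈ Finset.range n, ‖Z (S.paramSeq a (m + k))‖ ^ 2)
        * γ ^ m * Real.Gamma (n + m + 1)) := by
  rw [SIPSystem.norm_kCoeff_sq fun k N => partialSum_pos_of_remainder_const hγ h a]
  have h1 : ∏ k ∈ Finset.range n, S.partialSum a (m + k) (n + m) = γ ^ n * Real.Gamma (n + 1) := by
    have := Real.prod_range_add_sub_natCast (x := 0) (by norm_num) n
    simp only [zero_add, Real.Gamma_one, div_one] at this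
    rw [← this, pow_mul_prod_range]
    refine Finset.prod_congr rfl fun k hk => ?_
    have := Finset.mem_range.mp hk
    rw [S.partialSum_of_remainder_const h a (by omega)]
    push_cast
    ring
  have h2 : ∏ k ∈ Finset.range m, S.partialSum a k (n + m)
      = γ ^ m * (Real.Gamma (n + m + 1) / Real.Gamma (n + 1)) := by
    have h0 : (-1 : ℝ) < n := by have : (0:ℝ) ≤ n := n.cast_nonneg; linarith
    rw [← Real.prod_range_add_sub_natCast h0 m, pow_mul_prod_range]
    refine Finset.prod_congr rfl fun k hk => ?_
    have := Finset.mem_range.mp hk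
    rw [S.partialSum_of_remainder_const h a (by omega)]
    push_cast
    ring
  rw [h1, h2]
  have h3 : Real.Gamma (n + 1) ≠ 0 := (Real.Gamma_pos_of_pos (by positivity)).ne'
  field_simp

lemma partialSum_aType_pos {β γ lam δ a ρ : ℝ} (hβ : β ≠ 0) (hρ : ρ = -(a + γ)) (hρ0 : 0 < ρ)
    {k N : ℕ} (hk : k < N) : 0 < (aType β γ lam δ).partialSum a k N := by
  rw [SIPSystem.partialSum_aType β γ lam δ a ρ hρ hk.le]
  have : (k : ℝ) < N := by exact_mod_cast hk
  have : (0 : ℝ) < N - k := by linarith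
  positivity

/-- The partial sums are β²(N-k)(N+k+2ρ). Over k the first factors descend and the second ascend in
unit steps, and each run telescopes to a Gamma quotient. -/
lemma norm_kCoeff_sq_aType {β γ lam δ a ρ : ℝ} (hβ : β ≠ 0) (hρ : ρ = -(a + γ)) (hρ0 : 0 < ρ)
    (Z : ℝ → ℂ) (m n : ℕ) :
    ‖(aType β γ lam δ).kCoeff Z m a n‖ ^ 2
      = (β ^ 2) ^ n * Real.Gamma (n + 1) ^ 2 * Real.Gamma (2 * n + 2 * m + 2 * ρ)
          * Real.Gamma (n + m + 2 * ρ)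
        / ((∏ k ∈ Finset.range n, ‖Z (a - (m + k : ℕ))‖ ^ 2) * (β ^ 2) ^ m
          * (Real.Gamma (n + m + 1) * Real.Gamma (n + 2 * m + 2 * ρ) ^ 2)) := by
  rw [SIPSystem.norm_kCoeff_sq fun k N => partialSum_aType_pos hβ hρ hρ0]
  have h1 : ∏ k ∈ Finset.range n, (aType β γ lam δ).partialSum a (m + k) (n + m)
      = (β ^ 2) ^ n * (Real.Gamma (n + 1) * (Real.Gamma (2 * n + 2 * m + 2 * ρ)
        / Real.Gamma (n + 2 * m + 2 * ρ))) := by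
    have e1 := Real.prod_range_add_sub_natCast (x := 0) (by norm_num) n
    have e2 := Real.prod_range_add_natCast (x := n + 2 * m + 2 * ρ) (by positivity) n
    simp only [zero_add, Real.Gamma_one, div_one] at e1
    rw [show (2 : ℝ) * n + 2 * m + 2 * ρ = n + 2 * m + 2 * ρ + n by ring, ← e1, ← e2,
      ← Finset.prod_mul_distrib]
    rw [pow_mul_prod_range]
    refine Finset.prod_congr rfl fun k hk => ?_
    have := Finset.mem_range.mp hk
    rw [SIPSystem.partialSum_aType β γ lam δ a ρ hρ (by omega)]
    push_cast
    ring
  have h2 : ∏ k ∈ Finset.range m, (aType β γ lam δ).partialSum a k (n + m)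
      = (β ^ 2) ^ m * (Real.Gamma (n + m + 1) / Real.Gamma (n + 1)
        * (Real.Gamma (n + 2 * m + 2 * ρ) / Real.Gamma (n + m + 2 * ρ))) := by
    have h0 : (-1 : ℝ) < n := by have : (0:ℝ) ≤ n := n.cast_nonneg; linarith
    have e1 := Real.prod_range_add_sub_natCast h0 m
    have e2 := Real.prod_range_add_natCast (x := n + m + 2 * ρ) (by positivity) m
    rw [show (n : ℝ) + 2 * m + 2 * ρ = n + m + 2 * ρ + m by ring, ← e1, ← e2,
      ← Finset.prod_mul_distrib, pow_mul_prod_range]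
    refine Finset.prod_congr rfl fun k hk => ?_
    have := Finset.mem_range.mp hk
    rw [SIPSystem.partialSum_aType β γ lam δ a ρ hρ (by omega)]
    push_cast
    ring
  have h3 : ∀ k, (aType β γ lam δ).paramSeq a k = a - k :=
    SIPSystem.paramSeq_of_shift_sub_one rfl a
  simp only [h3]
  rw [h1, h2]
  have h4 : Real.Gamma (n + 1) ≠ 0 := (Real.Gamma_pos_of_pos (by positivity)).ne'
  have h5 : Real.Gamma (n + 2 * m + 2 * ρ) ≠ 0 := (Real.Gamma_pos_of_pos (by positivity)).ne'
  have h6 : Real.Gamma (n + m + 2 * ρ) ≠ 0 := (Real.Gamma_pos_of_pos (by positivity)).ne'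
  field_simp

/-! ### From expansion coefficients to normalization, moments and weight -/

/-- The same term is written in two ways: the Gamma form gives convergence and the Meijer function,
the Pochhammer form the hypergeometric one. The scale l is 1/4 when a duplication formula
intervenes. -/
lemma hasSum_and_eq_meijerG {κ : ℕ → ℝ} (as bs' as'' bs'' : List ℝ) {C ξ l : ℝ} (hl : 0 < l)
    (has : ∀ a ∈ as, a < 1) (hbs : ∀ b ∈ bs', b < 1)
    (h1 : ∀ (n : ℕ) (x : ℝ), x ^ n / κ n = C * ((as.map fun a => Real.Gamma (1 - a + n)).prod
      / (bs'.map fun b => Real.Gamma (1 - b + n)).prod * ((l * x) ^ n / n.factorial)))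
    (h2 : ∀ (n : ℕ) (x : ℝ), x ^ n / κ n
      = ξ * ((as''.map fun a => (ascPochhammer ℝ n).eval a).prod
        / (bs''.map fun b => (ascPochhammer ℝ n).eval b).prod * ((l * x) ^ n / n.factorial)))
    {x : ℝ} (hx : 0 ≤ x)
    (hlen : as.length < 1 + bs'.length ∨ (as.length = 1 + bs'.length ∧ l * x < 1)) :
    HasSum (fun n => x ^ n / κ n) (ξ * genHypergeometric as'' bs'' (l * x)) ∧
      (0 < x → ((ξ * genHypergeometric as'' bs'' (l * x) : ℝ) : ℂ)
        = C * meijerG (as.map (↑)) [] [0] (bs'.map (↑)) (-((l * x : ℝ) : ℂ))) := by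
  have htsum : ∑' n, x ^ n / κ n = ξ * genHypergeometric as'' bs'' (l * x) := by
    rw [genHypergeometric, ← tsum_mul_left]
    exact tsum_congr fun n => h2 n x
  constructor
  · rw [← htsum]
    refine Summable.hasSum ?_
    rcases hx.eq_or_lt with rfl | hx
    · refine summable_of_ne_finset_zero (s := {0}) fun n hn => ?_
      rw [zero_pow (by simpa using hn), zero_div]
    · simp only [h1]
      exact (meijerG_neg_eq_tsum as bs' (mul_pos hl hx) has hbs hlen).1.mul_left C
  · intro hx
    rw [(meijerG_neg_eq_tsum as bs' (mul_pos hl hx) has hbs hlen).2, ← htsum, ← Complex.ofReal_mul,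
      ← tsum_mul_left]
    congr 1
    exact tsum_congr fun n => h1 n x

lemma MellinPair.mellin_comp_mul_left {d : ℝ → ℝ} {K : ℂ → ℂ} {s₀ l : ℝ} (hd : MellinPair d K s₀)
    (hl : 0 < l) {h : ℝ → ℂ} (hh : ∀ x, 0 < x → x ≠ 1 → h x = d (l * x)) {s : ℂ} (hs : s₀ < s.re) :
    MellinConvergent h s ∧ mellin h s = (l : ℂ) ^ (-s) * K s := by
  obtain ⟨h1, h2⟩ := hd.hasMellin s hs
  -- The point 1, where the Meijer function with p = q is not controlled, is a null set.
  have hae : ∀ᵐ x : ℝ ∂(volume.restrict (Ioi 0)), (x : ℂ) ^ (s - 1) • ((d (l * x) : ℝ) : ℂ)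
      = (x : ℂ) ^ (s - 1) • h x := by
    filter_upwards [ae_restrict_mem measurableSet_Ioi,
      ae_restrict_of_ae (measure_eq_zero_iff_ae_notMem.mp (Real.volume_singleton (a := 1)))] with x hx hx1
    rw [hh x hx hx1]
  constructor
  · have h3 : MellinConvergent (fun x => ((d (l * x) : ℝ) : ℂ)) s :=
      (MellinConvergent.comp_mul_left (f := fun x => (d x : ℂ)) hl).mpr h1
    exact Integrable.congr h3 hae
  · rw [← h2, ← smul_eq_mul, ← _root_.mellin_comp_mul_left (fun x => (d x : ℂ)) s hl]
    exact (integral_congr_ae hae).symm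

lemma MellinPair.moment_comp_mul_left {d : ℝ → ℝ} {K : ℂ → ℂ} {s₀ l : ℝ} (hd : MellinPair d K s₀)
    (hl : 0 < l) (A : ℝ) (n : ℕ) (hs₀ : s₀ < n + 1) :
    IntegrableOn (fun x : ℝ => x ^ n * (A * d (l * x))) (Ioi 0) ∧
      ((∫ x in Ioi (0 : ℝ), x ^ n * (A * d (l * x)) : ℝ) : ℂ)
        = A * ((l : ℂ) ^ (n + 1))⁻¹ * K (n + 1) := by
  have h0 : ∀ x : ℝ, x ^ (((n : ℝ) + 1) - 1) * d x = x ^ n * d x := fun x => by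
    rw [add_sub_cancel_right, Real.rpow_natCast]
  have h1 := hd.integrableOn hs₀
  have h2 := hd.integral_eq hs₀
  simp only [h0] at h1 h2
  have h3 : ∀ x : ℝ, x ^ n * (A * d (l * x)) = A * (l ^ n)⁻¹ * ((l * x) ^ n * d (l * x)) := by
    intro x
    have : l ^ n ≠ 0 := by positivity
    rw [mul_pow]
    field_simp
  simp only [h3]
  constructor
  · refine Integrable.const_mul ?_ _
    have := (integrableOn_Ioi_comp_mul_left_iff (fun x => x ^ n * d x) 0 hl).mpr (by simpa using h1)
    exact this
  · rw [integral_const_mul, integral_comp_mul_left_Ioi (fun x => x ^ n * d x) 0 hl, mul_zero,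
      smul_eq_mul]
    push_cast at h2 ⊢
    rw [h2, pow_succ, mul_inv]
    ring

lemma SIPSystem.normFactor_sq_eq {S : SIPSystem} {Z : ℝ → ℂ} {m : ℕ} {a x T : ℝ} (hT : 0 < T)
    (h : HasSum (fun n => x ^ n / ‖S.kCoeff Z m a n‖ ^ 2) T) :
    S.normFactor Z m a x ^ 2 = T⁻¹ := by
  rw [normFactor, h.tsum_eq, ← inv_inv (_ ^ 2), rpow_neg_half_sq_inv hT]

lemma pos_of_hasSum_pow_div {κ : ℕ → ℝ} (hκ : ∀ n, 0 < κ n) {x T : ℝ} (hx : 0 ≤ x)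
    (h : HasSum (fun n => x ^ n / κ n) T) : 0 < T := by
  have h1 := le_hasSum h 0 fun n _ => div_nonneg (pow_nonneg hx n) (hκ n).le
  exact (div_pos (by simp) (hκ 0)).trans_le h1

/-- The moment function is g(x) = A d(lx), and the relation between g and ω is solved for ω using T
= 1/N². Here J describes D in terms of |z|²: the whole line for the plane, x < 1 for the disc. -/
lemma SIPSystem.exists_weight {E : Type*} [NormedAddCommGroup E] [InnerProductSpace ℂ E]
    [CompleteSpace E] (Ψ : HilbertBasis ℕ ℂ E) {S : SIPSystem} {Z : ℝ → ℂ} {m : ℕ} {a : ℝ}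
    (hS : ∀ k N, k < N → 0 < S.partialSum a k N) (hZ : ∀ k, Z (S.paramSeq a k) ≠ 0)
    {D : Set ℂ} {J : Set ℝ} (hD : MeasurableSet D) (hDJ : ∀ z, z ∈ D ↔ ‖z‖ ^ 2 ∈ J) {T : ℝ → ℝ}
    (hT : ∀ x, 0 ≤ x → x ∈ J → HasSum (fun n => x ^ n / ‖S.kCoeff Z m a n‖ ^ 2) (T x))
    {d : ℝ → ℝ} {Kd : ℂ → ℂ} {s₀ l A : ℝ} (hd : MellinPair d Kd s₀) (hl : 0 < l) (hA : 0 < A)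
    (hs₀ : s₀ < m + 1)
    (hmom : ∀ n : ℕ, (A : ℂ) * ((l : ℂ) ^ (n + m + 1))⁻¹ * Kd (n + m + 1)
      = ((‖S.kCoeff Z m a n‖ ^ 2 : ℝ) : ℂ))
    (hpos : ∀ x, 0 < x → x ∈ J → 0 < d (l * x)) (hzero : ∀ x ∉ J, d (l * x) = 0) :
    ∃ g ω : ℝ → ℝ, (∀ x, g x = A * d (l * x)) ∧
      (∀ n : ℕ, IntegrableOn (fun x : ℝ => x ^ (n + m) * g x) (Ioi 0) ∧
        ∫ x in Ioi (0 : ℝ), x ^ (n + m) * g x = ‖S.kCoeff Z m a n‖ ^ 2) ∧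
      (∀ x, 0 < x → x ∈ J → g x = Real.pi * S.normFactor Z m a x ^ 2 * (x ^ m)⁻¹ * ω x) ∧
      (∀ x, 0 < x → x ∈ J → ω x = A / Real.pi * T x * (x ^ m * d (l * x))) ∧
      (∀ x, 0 < x → x ∈ J → 0 < ω x) ∧
      ResolvesIdentity Ψ m D (S.paState Z m a Ψ) ω := by
  have hK : ∀ n, S.kCoeff Z m a n ≠ 0 := kCoeff_ne_zero hS Z m hZ
  have hTpos : ∀ x, 0 ≤ x → x ∈ J → 0 < T x := fun x hx hxJ =>
    pos_of_hasSum_pow_div (fun n => pow_pos (norm_pos_iff.mpr (hK n)) 2) hx (hT x hx hxJ)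
  have hπ := Real.pi_pos
  set g : ℝ → ℝ := fun x => A * d (l * x) with hg
  set ω : ℝ → ℝ := fun x => A / Real.pi * T x * (x ^ m * d (l * x)) with hω
  have hmom' : ∀ n : ℕ, IntegrableOn (fun x : ℝ => x ^ (n + m) * g x) (Ioi 0) ∧
        ∫ x in Ioi (0 : ℝ), x ^ (n + m) * g x = ‖S.kCoeff Z m a n‖ ^ 2 := by
    intro n
    have hn : (0 : ℝ) ≤ n := n.cast_nonneg
    obtain ⟨h1, h2⟩ := hd.moment_comp_mul_left hl A (n + m) (by push_cast; linarith)
    refine ⟨h1, ?_⟩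
    push_cast at h2
    rw [hmom n] at h2
    exact Complex.ofReal_injective h2
  have hgω : ∀ x, 0 < x → x ∈ J → g x = Real.pi * S.normFactor Z m a x ^ 2 * (x ^ m)⁻¹ * ω x := by
    intro x hx hxJ
    have h1 := hTpos x hx.le hxJ
    rw [normFactor_sq_eq h1 (hT x hx.le hxJ)]
    simp only [hg, hω]
    field_simp
  have hωpos : ∀ x, 0 < x → x ∈ J → 0 < ω x := fun x hx hxJ => by
    have h1 := hTpos x hx.le hxJ
    have h2 := hpos x hx hxJ
    positivity
  refine ⟨g, ω, fun x => rfl, hmom', hgω, fun x _ _ => rfl, hωpos, ?_⟩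
  have hsq : ∀ z : ℂ, z ≠ 0 → 0 < ‖z‖ ^ 2 := fun z hz => by positivity
  refine ResolvesIdentity.of_moments (N := S.normFactor Z m a) (g := g) hD hK ?_ ?_ ?_ ?_ ?_ ?_ ?_
    fun n => (hmom' n).2
  · intro z hz _
    have hz' := (hDJ z).mp hz
    exact (paState_properties hS Z m Ψ (hTpos _ (sq_nonneg _) hz') (hT _ (sq_nonneg _) hz')).2.2.2
  · exact fun x hx => Real.rpow_nonneg (tsum_nonneg fun n => by positivity) _
  · exact (hd.meas.comp (measurable_const_mul l)).const_mul A
  · exact fun x hx => mul_nonneg hA.le (hd.nonneg _ (mul_pos hl hx))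
  · intro z hz
    simp only [hg, hzero _ (fun h => hz ((hDJ z).mpr h)), mul_zero]
  · exact fun z hz hz0 => hgω _ (hsq z hz0) ((hDJ z).mp hz)
  · exact fun z hz hz0 => (hωpos _ (hsq z hz0) ((hDJ z).mp hz)).le

lemma SIPSystem.normFactor_sq_inv_eq {S : SIPSystem} {Z : ℝ → ℂ} {m : ℕ} {a x T : ℝ} (hT : 0 < T)
    (h : HasSum (fun n => x ^ n / ‖S.kCoeff Z m a n‖ ^ 2) T) :
    (S.normFactor Z m a x ^ 2)⁻¹ = T := by
  rw [normFactor_sq_eq hT h, inv_inv]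

lemma meijerKernel_add_natCast (as' bs : List ℝ) (m : ℕ) (s : ℂ) :
    meijerKernel [] (as'.map (↑)) (bs.map (↑)) [] (s + m)
      = meijerKernel [] ((as'.map (· + (m : ℝ))).map (↑)) ((bs.map (· + (m : ℝ))).map (↑)) [] s := by
  have h : ∀ a : ℝ, ((a : ℂ) + (s + m)) = ((a + m : ℝ) : ℂ) + s := fun a => by push_cast; ring
  simp [meijerKernel, List.map_map, Function.comp_def, h]

lemma IsDensityIoi.meijerG_eq_and_shift {as' bs : List ℝ} (hlen : as'.length < bs.length)
    {d : ℝ → ℝ} {s₀ : ℝ} (h : IsDensityIoi d (meijerKernel [] (as'.map (↑)) (bs.map (↑)) []) s₀)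
    (hs₀ : ∀ σ, (∀ b ∈ bs, -b < σ) → s₀ < σ) (m : ℕ) {x : ℝ} (hx : 0 < x) :
    meijerG [] (as'.map (↑)) (bs.map (↑)) [] x = d x ∧
      meijerG [] ((as'.map (· + (m : ℝ))).map (↑)) ((bs.map (· + (m : ℝ))).map (↑)) [] x
        = ((x ^ m * d x : ℝ) : ℂ) := by
  refine ⟨meijerG_eq_of_isDensityIoi hlen h hs₀ hx, ?_⟩
  refine meijerG_eq_of_isDensityIoi (d := fun x => x ^ m * d x) (s₀ := s₀ - m) (by simpa using hlen)
    ((h.pow_mul m).congr fun s _ => meijerKernel_add_natCast as' bs m s) (fun σ hσ => ?_) hx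
  have := hs₀ (σ + m) fun b hb => by
    have := hσ (b + m) (List.mem_map.mpr ⟨b, hb, rfl⟩)
    linarith
  linarith

/-- The abscissa m is determined by the lower parameter -m; after translation it becomes m - m = 0,
so the requirement of a nonnegative abscissa still holds. -/
lemma IsDensityIoo.meijerG_eq_and_shift {as' bs : List ℝ} (hlen : as'.length = bs.length)
    {d : ℝ → ℝ} {m : ℕ} (h : IsDensityIoo d (meijerKernel [] (as'.map (↑)) (bs.map (↑)) []) m)
    (hbm : -(m : ℝ) ∈ bs) (hb : ∀ b ∈ bs, -(m : ℝ) ≤ b) {x : ℝ} (hx : 0 < x) (hx1 : x ≠ 1) :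
    meijerG [] (as'.map (↑)) (bs.map (↑)) [] x = d x ∧
      meijerG [] ((as'.map (· + (m : ℝ))).map (↑)) ((bs.map (· + (m : ℝ))).map (↑)) [] x
        = ((x ^ m * d x : ℝ) : ℂ) := by
  have hs₀ : ∀ σ, (∀ b ∈ bs, -b < σ) → (m : ℝ) < σ := fun σ hσ => by simpa using hσ _ hbm
  refine ⟨meijerG_eq_of_isDensityIoo hlen h m.cast_nonneg hs₀ (fun b hb' => ?_) hx hx1, ?_⟩
  · linarith [hb b hb']
  refine meijerG_eq_of_isDensityIoo (d := fun x => x ^ m * d x) (s₀ := m - m) (by simpa using hlen)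
    ((h.pow_mul m).congr fun s _ => meijerKernel_add_natCast as' bs m s) (by simp)
    (fun σ hσ => ?_) (fun b hb' => ?_) hx hx1
  · have := hs₀ (σ + m) fun b hb => by
      have := hσ (b + m) (List.mem_map.mpr ⟨b, hb, rfl⟩)
      linarith
    linarith
  · obtain ⟨b, hb'', rfl⟩ := List.mem_map.mp hb'
    linarith [hb b hb'']

/-- The phase is unimodular, which is why α leaves no trace in the norms. -/
lemma norm_ofReal_sqrt_mul_exp_sq {x t r : ℝ} (hx : 0 ≤ x) :
    ‖(√x : ℂ) * Complex.exp (-(I * t * r))‖ ^ 2 = x := by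
  have h : -(I * (t : ℂ) * r) = ((-(t * r) : ℝ) : ℂ) * I := by
    push_cast
    ring
  rw [norm_mul, h, Complex.norm_exp_ofReal_mul_I, mul_one, Complex.norm_real,
    Real.norm_of_nonneg (Real.sqrt_nonneg _), Real.sq_sqrt hx]

/-! ## The D-type system -/

lemma norm_kCoeff_sq_dType {β δ γ : ℝ} (hγ : 0 < γ) (hβ : γ = 2 * β) (a : ℝ) (c : ℂ) (m n : ℕ) :
    ‖(dType β δ).kCoeff (fun _ => c) m a n‖ ^ 2 = γ ^ n * (n.factorial : ℝ) * Real.Gamma (n + 1)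
      / (‖c‖ ^ (2 * n) * γ ^ m * Real.Gamma (n + m + 1)) := by
  rw [norm_kCoeff_sq_of_remainder_const hγ (by rw [hβ]; rfl), Finset.prod_const, Finset.card_range,
    ← pow_mul, Real.Gamma_nat_eq_factorial]
  ring

lemma hasSum_dType {γ r : ℝ} (hγ : 0 < γ) (hr : 0 < r) (m : ℕ) {κ : ℕ → ℝ}
    (hκ : ∀ n, κ n = γ ^ n * (n.factorial : ℝ) * Real.Gamma (n + 1)
      / (r ^ (2 * n) * γ ^ m * Real.Gamma (n + m + 1))) {x : ℝ} (hx : 0 ≤ x) :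
    HasSum (fun n => x ^ n / κ n)
        (γ ^ m * Real.Gamma (m + 1) * genHypergeometric [(m : ℝ) + 1] [1] (r ^ 2 / γ * x)) ∧
      (0 < x → ((γ ^ m * Real.Gamma (m + 1)
        * genHypergeometric [(m : ℝ) + 1] [1] (r ^ 2 / γ * x) : ℝ) : ℂ)
          = (γ : ℂ) ^ m * meijerG [-(m : ℂ)] [] [0] [0] (-((r ^ 2 / γ * x : ℝ) : ℂ))) := by
  have hm : (0 : ℝ) ≤ m := m.cast_nonneg
  have hf : ∀ n : ℕ, (n.factorial : ℝ) ≠ 0 := fun n => by positivity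
  have hg : ∀ n : ℕ, Real.Gamma ((n : ℝ) + 1) ≠ 0 := fun n =>
    (Real.Gamma_pos_of_pos (by positivity)).ne'
  have := hasSum_and_eq_meijerG (κ := κ) [-(m : ℝ)] [0] [(m : ℝ) + 1] [1] (C := γ ^ m)
    (ξ := γ ^ m * Real.Gamma (m + 1)) (l := r ^ 2 / γ) (by positivity) (by simp; linarith) (by simp)
    (fun n x => ?_) (fun n x => ?_) hx (by simp)
  · simpa using this
  · rw [hκ]
    have e1 : (1 : ℝ) - -m + n = n + m + 1 := by ring
    have e2 : (1 : ℝ) - 0 + n = n + 1 := by ring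
    have := hg n
    simp only [List.map_cons, List.map_nil, List.prod_cons, List.prod_nil, mul_one, e1, e2]
    have := hf n
    rw [mul_pow, div_pow, ← pow_mul]
    field_simp
  · rw [hκ]
    simp only [List.map_cons, List.map_nil, List.prod_cons, List.prod_nil, mul_one]
    rw [Real.ascPochhammer_eval_eq (by positivity), Real.ascPochhammer_eval_eq (by positivity)]
    have e1 : (m : ℝ) + 1 + n = n + m + 1 := by ring
    rw [e1, add_comm (1 : ℝ), Real.Gamma_one, mul_pow, div_pow, ← pow_mul]
    have := hg n
    have := hg m
    have := hf n
    field_simp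

/-- The kernel is Γ(s-m) times Γ(s-m)/Γ(s): a gamma density followed by m power convolutions. -/
lemma exists_density_dType (m : ℕ) :
    ∃ d, IsDensityIoi d (fun s => Gamma (s - m) ^ 2 / Gamma s) m := by
  obtain ⟨d, hd⟩ := (isDensityIoi_gammaDensity (-(m : ℝ))).exists_mul_Gamma_ratio (c := -m)
    le_rfl m
  refine ⟨d, IsDensityIoi.congr (by simpa using hd) fun s _ => ?_⟩
  rw [← sub_eq_add_neg]
  ring

/-! ## The C-type system -/

lemma norm_kCoeff_sq_cType {β δ γ a α ρ : ℝ} (hγ : 0 < γ) (hβ : γ = 2 * β) (hρ : ρ = a - 1 / γ)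
    (hρ0 : ρ < 0) (m n : ℕ) :
    ‖(cType β δ).kCoeff (fun a => (Real.sqrt (auxG (-γ) 1 a) : ℂ)
        * Complex.exp (-(Complex.I * α * (cType β δ).remainder a))) m a n‖ ^ 2
      = Real.Gamma (-ρ + m) * Real.Gamma (n + 1) ^ 2
        / (γ ^ m * Real.Gamma (-ρ + m + n) * Real.Gamma (n + m + 1)) := by
  have hm : (0 : ℝ) ≤ m := m.cast_nonneg
  have hρm : 0 < -ρ + m := by linarith
  have h1 := Real.prod_range_add_natCast hρm n
  rw [norm_kCoeff_sq_of_remainder_const hγ (by rw [hβ]; rfl)]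
  have h2 : ∏ k ∈ Finset.range n, ‖(Real.sqrt (auxG (-γ) 1 ((cType β δ).paramSeq a (m + k))) : ℂ)
        * Complex.exp (-(Complex.I * α
          * (cType β δ).remainder ((cType β δ).paramSeq a (m + k))))‖ ^ 2
      = γ ^ n * (Real.Gamma (-ρ + m + n) / Real.Gamma (-ρ + m)) := by
    rw [← h1, pow_mul_prod_range]
    refine Finset.prod_congr rfl fun k _ => ?_
    have hk : (0 : ℝ) ≤ k := k.cast_nonneg
    have h3 : auxG (-γ) 1 ((cType β δ).paramSeq a (m + k)) = γ * (-ρ + m + k) := by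
      rw [SIPSystem.paramSeq_of_shift_sub_one rfl, hρ, auxG]
      push_cast
      field_simp
      ring
    rw [h3, norm_ofReal_sqrt_mul_exp_sq (by nlinarith)]
  rw [h2]
  have h4 : Real.Gamma (-ρ + m) ≠ 0 := (Real.Gamma_pos_of_pos hρm).ne'
  have h5 : Real.Gamma (-ρ + m + n) ≠ 0 := (Real.Gamma_pos_of_pos (by positivity)).ne'
  field_simp

lemma hasSum_cType {γ ρ : ℝ} (hγ : 0 < γ) (hρ : ρ < 0) (m : ℕ) {κ : ℕ → ℝ}
    (hκ : ∀ n : ℕ, κ n = Real.Gamma (-ρ + m) * Real.Gamma (n + 1) ^ 2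
        / (γ ^ m * Real.Gamma (-ρ + m + n) * Real.Gamma (n + m + 1)))
    {x : ℝ} (hx : 0 ≤ x) (hx1 : x < 1) :
    HasSum (fun n => x ^ n / κ n) (γ ^ m * Real.Gamma (m + 1)
        * genHypergeometric [(m : ℝ) - ρ, (m : ℝ) + 1] [1] x) ∧
      (0 < x → ((γ ^ m * Real.Gamma (m + 1)
        * genHypergeometric [(m : ℝ) - ρ, (m : ℝ) + 1] [1] x : ℝ) : ℂ)
          = ((γ ^ m / Real.Gamma (m - ρ) : ℝ) : ℂ)
            * meijerG [-(m : ℂ), 1 - (m : ℂ) + (ρ : ℂ)] [] [0] [0] (-(x : ℂ))) := by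
  have hm : (0 : ℝ) ≤ m := m.cast_nonneg
  have hmρ : 0 < (m : ℝ) - ρ := by linarith
  have hf : ∀ n : ℕ, Real.Gamma ((n : ℝ) + 1) = n.factorial := Real.Gamma_nat_eq_factorial
  have hf0 : ∀ n : ℕ, (n.factorial : ℝ) ≠ 0 := fun n => by positivity
  have hg : Real.Gamma ((m : ℝ) - ρ) ≠ 0 := (Real.Gamma_pos_of_pos hmρ).ne'
  have := hasSum_and_eq_meijerG (κ := κ) [-(m : ℝ), 1 - m + ρ] [0] [(m : ℝ) - ρ, (m : ℝ) + 1] [1]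
    (C := γ ^ m / Real.Gamma (m - ρ)) (ξ := γ ^ m * Real.Gamma (m + 1)) (l := 1) one_pos
    (by simp; constructor <;> linarith) (by simp)
    (fun n x => ?_) (fun n x => ?_) hx (by simpa using hx1)
  · simpa using this
  · rw [hκ]
    have e1 : (1 : ℝ) - -m + n = n + m + 1 := by ring
    have e2 : (1 : ℝ) - 0 + n = n + 1 := by ring
    have e3 : 1 - (1 - (m : ℝ) + ρ) + n = -ρ + m + n := by ring
    have e4 : -ρ + (m : ℝ) = m - ρ := by ring
    simp only [List.map_cons, List.map_nil, List.prod_cons, List.prod_nil, mul_one, e1, e2, e3, hf,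
      one_mul]
    rw [e4]
    have := hf0 n
    field_simp
  · rw [hκ]
    simp only [List.map_cons, List.map_nil, List.prod_cons, List.prod_nil, mul_one, one_mul]
    rw [Real.ascPochhammer_eval_eq hmρ, Real.ascPochhammer_eval_eq (by positivity),
      Real.ascPochhammer_eval_eq (by positivity)]
    have e1 : (m : ℝ) + 1 + n = n + m + 1 := by ring
    have e4 : -ρ + (m : ℝ) = m - ρ := by ring
    rw [e1, e4, add_comm (1 : ℝ), Real.Gamma_one, hf, hf]
    have := hf0 n
    have := hf0 m
    field_simp

/-- The kernel is Γ(s-m)/Γ(s-ρ-1) times Γ(s-m)/Γ(s). The first factor belongs to a beta density with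
exponent q = m-ρ-1, positive for every m when ρ < -1. -/
lemma exists_density_cType (m : ℕ) {ρ : ℝ} (hρ : ρ < -1) :
    ∃ d, IsDensityIoo d (fun s => Gamma (s - m) ^ 2 / (Gamma s * Gamma (s - ρ - 1))) m := by
  have hm : (0 : ℝ) ≤ m := m.cast_nonneg
  obtain ⟨d, hd⟩ := (isDensityIoo_betaDensity (-(m : ℝ)) (q := m - ρ - 1)
    (by linarith)).exists_mul_Gamma_ratio (c := -m) le_rfl m
  refine ⟨d, IsDensityIoo.congr (by simpa using hd) fun s _ => ?_⟩
  rw [← sub_eq_add_neg, show s - m + (m - ρ - 1) = s - ρ - 1 by ring]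
  rw [div_mul_div_comm, mul_comm (Gamma s)]
  ring

/-! ## The A-type system, first choice -/

lemma hasSum_aType {κ₀ ρ : ℝ} (hκ₀ : κ₀ ≠ 0) (hρ : 0 < ρ) (m : ℕ) {κ : ℕ → ℝ}
    (hκ : ∀ n : ℕ, κ n = 1 / κ₀ ^ (2 * m)
        * (Real.Gamma (n + 1) ^ 2 * Real.Gamma (2 * n + 2 * m + 2 * ρ)
            * Real.Gamma (n + m + 2 * ρ)
          / (Real.Gamma (n + m + 1) * Real.Gamma (n + 2 * m + 2 * ρ) ^ 2)))
    {x : ℝ} (hx : 0 ≤ x) :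
    HasSum (fun n => x ^ n / κ n) (κ₀ ^ (2 * m) * Real.Gamma (m + 1) * Real.Gamma (2 * m + 2 * ρ)
        / Real.Gamma (m + 2 * ρ) * genHypergeometric [(m : ℝ) + 1, 2 * m + 2 * ρ, 2 * m + 2 * ρ]
          [1, m + ρ, m + 2 * ρ, m + ρ + 1 / 2] (x / 4)) ∧
      (0 < x → ((κ₀ ^ (2 * m) * Real.Gamma (m + 1) * Real.Gamma (2 * m + 2 * ρ)
        / Real.Gamma (m + 2 * ρ) * genHypergeometric [(m : ℝ) + 1, 2 * m + 2 * ρ, 2 * m + 2 * ρ]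
          [1, m + ρ, m + 2 * ρ, m + ρ + 1 / 2] (x / 4) : ℝ) : ℂ)
        = ((κ₀ ^ (2 * m) * Real.Gamma (m + ρ) * Real.Gamma (m + ρ + 1 / 2)
          / Real.Gamma (2 * m + 2 * ρ) : ℝ) : ℂ)
          * meijerG [-(m : ℂ), 1 - 2 * (m : ℂ) - 2 * (ρ : ℂ), 1 - 2 * (m : ℂ) - 2 * (ρ : ℂ)] []
            [0] [0, 1 - (m : ℂ) - (ρ : ℂ), 1 - (m : ℂ) - 2 * (ρ : ℂ), 1 / 2 - (m : ℂ) - (ρ : ℂ)]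
            (-((x / 4 : ℝ) : ℂ))) := by
  have hm : (0 : ℝ) ≤ m := m.cast_nonneg
  have hf : ∀ n : ℕ, Real.Gamma ((n : ℝ) + 1) = n.factorial := Real.Gamma_nat_eq_factorial
  have hf0 : ∀ n : ℕ, (n.factorial : ℝ) ≠ 0 := fun n => by positivity
  have hG : ∀ {y : ℝ}, 0 < y → Real.Gamma y ≠ 0 := fun hy => (Real.Gamma_pos_of_pos hy).ne'
  -- Legendre's duplication formula at m+ρ and at m+ρ+n. It splits Γ(2n+2m+2ρ) into two Gamma
  -- functions with unit steps in n, and produces the 4^n behind the argument x/4.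
  have hdup : ∀ n : ℕ, Real.Gamma (2 * n + 2 * m + 2 * ρ) * (Real.Gamma (m + ρ)
      * Real.Gamma (m + ρ + 1 / 2)) = 4 ^ n * Real.Gamma (2 * m + 2 * ρ)
        * (Real.Gamma (m + ρ + n) * Real.Gamma (m + ρ + 1 / 2 + n)) := by
    intro n
    have h1 := Real.Gamma_mul_Gamma_add_half (m + ρ)
    have h2 := Real.Gamma_mul_Gamma_add_half (m + ρ + n)
    rw [show (m : ℝ) + ρ + 1 / 2 + n = m + ρ + n + 1 / 2 by ring, h1, h2,
      show (2 : ℝ) * n + 2 * m + 2 * ρ = 2 * (m + ρ + n) by ring,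
      show (2 : ℝ) * m + 2 * ρ = 2 * (m + ρ) by ring,
      show (1 : ℝ) - 2 * (m + ρ) = 1 - 2 * (m + ρ + n) + (2 * n : ℕ) by push_cast; ring,
      Real.rpow_add_natCast (by norm_num), pow_mul]
    norm_num
    ring
  have := hasSum_and_eq_meijerG (κ := κ) [-(m : ℝ), 1 - 2 * m - 2 * ρ, 1 - 2 * m - 2 * ρ]
    [0, 1 - m - ρ, 1 - m - 2 * ρ, 1 / 2 - m - ρ] [(m : ℝ) + 1, 2 * m + 2 * ρ, 2 * m + 2 * ρ]
    [1, m + ρ, m + 2 * ρ, m + ρ + 1 / 2]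
    (C := κ₀ ^ (2 * m) * Real.Gamma (m + ρ) * Real.Gamma (m + ρ + 1 / 2)
          / Real.Gamma (2 * m + 2 * ρ))
    (ξ := κ₀ ^ (2 * m) * Real.Gamma (m + 1) * Real.Gamma (2 * m + 2 * ρ)
        / Real.Gamma (m + 2 * ρ)) (l := 1 / 4) (by norm_num)
    (by simp; constructor <;> linarith) (by simp; refine ⟨?_, ?_, ?_⟩ <;> linarith)
    (fun n x => ?_) (fun n x => ?_) hx (by simp)
  · simpa [div_eq_inv_mul] using this
  · rw [hκ]
    have e1 : (1 : ℝ) - -m + n = n + m + 1 := by ring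
    have e2 : (1 : ℝ) - 0 + n = n + 1 := by ring
    have e3 : 1 - (1 - 2 * (m : ℝ) - 2 * ρ) + n = n + 2 * m + 2 * ρ := by ring
    have e4 : 1 - (1 - (m : ℝ) - ρ) + n = m + ρ + n := by ring
    have e5 : 1 - (1 - (m : ℝ) - 2 * ρ) + n = n + m + 2 * ρ := by ring
    have e6 : 1 - (1 / 2 - (m : ℝ) - ρ) + n = m + ρ + 1 / 2 + n := by ring
    simp only [List.map_cons, List.map_nil, List.prod_cons, List.prod_nil, mul_one, e1, e2, e3, e4,
      e5, e6, hf]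
    have := hf0 n
    have := hdup n
    have h1 := hG (by positivity : 0 < (n : ℝ) + m + 2 * ρ)
    have h2 := hG (by positivity : 0 < 2 * (n : ℝ) + 2 * m + 2 * ρ)
    have h3 := hG (by positivity : 0 < 2 * (m : ℝ) + 2 * ρ)
    have h4 := hG (by positivity : 0 < (n : ℝ) + 2 * m + 2 * ρ)
    have h5 := hG (by positivity : 0 < (m : ℝ) + ρ + n)
    have h6 := hG (by positivity : 0 < (m : ℝ) + ρ + 1 / 2 + n)
    have h7 := hG (by positivity : 0 < (m : ℝ) + ρ + 1 / 2)
    have h8 := hG (by positivity : 0 < (m : ℝ) + ρ)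
    rw [mul_pow, div_pow, one_pow]
    generalize Real.Gamma (2 * n + 2 * m + 2 * ρ) = A at *
    generalize Real.Gamma (m + ρ + n) = B at *
    generalize Real.Gamma (m + ρ + 1 / 2 + n) = B' at *
    generalize Real.Gamma (2 * m + 2 * ρ) = A₀ at *
    generalize Real.Gamma (m + ρ + 1 / 2) = B₀' at *
    generalize Real.Gamma (m + ρ) = B₀ at *
    have hA : A = 4 ^ n * A₀ * (B * B') / (B₀ * B₀') := by
      field_simp
      linarith
    rw [hA]
    field_simp
  · rw [hκ]
    simp only [List.map_cons, List.map_nil, List.prod_cons, List.prod_nil, mul_one]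
    rw [Real.ascPochhammer_eval_eq (by positivity), Real.ascPochhammer_eval_eq (by positivity),
      Real.ascPochhammer_eval_eq (by positivity), Real.ascPochhammer_eval_eq (by positivity),
      Real.ascPochhammer_eval_eq (by positivity), Real.ascPochhammer_eval_eq (by positivity)]
    have e1 : (m : ℝ) + 1 + n = n + m + 1 := by ring
    have e2 : 2 * (m : ℝ) + 2 * ρ + n = n + 2 * m + 2 * ρ := by ring
    have e3 : (m : ℝ) + 2 * ρ + n = n + m + 2 * ρ := by ring
    rw [e1, e2, e3, add_comm (1 : ℝ) n, Real.Gamma_one, hf, hf]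
    have := hf0 n
    have := hf0 m
    have := hdup n
    have h1 := hG (by positivity : 0 < (n : ℝ) + m + 2 * ρ)
    have h2 := hG (by positivity : 0 < 2 * (n : ℝ) + 2 * m + 2 * ρ)
    have h3 := hG (by positivity : 0 < 2 * (m : ℝ) + 2 * ρ)
    have h4 := hG (by positivity : 0 < (n : ℝ) + 2 * m + 2 * ρ)
    have h5 := hG (by positivity : 0 < (m : ℝ) + ρ + n)
    have h6 := hG (by positivity : 0 < (m : ℝ) + ρ + 1 / 2 + n)
    have h7 := hG (by positivity : 0 < (m : ℝ) + ρ + 1 / 2)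
    have h8 := hG (by positivity : 0 < (m : ℝ) + ρ)
    have h9 := hG (by positivity : 0 < (m : ℝ) + 2 * ρ)
    rw [mul_pow, div_pow, one_pow]
    generalize Real.Gamma (2 * n + 2 * m + 2 * ρ) = A at *
    generalize Real.Gamma (m + ρ + n) = B at *
    generalize Real.Gamma (m + ρ + 1 / 2 + n) = B' at *
    generalize Real.Gamma (2 * m + 2 * ρ) = A₀ at *
    generalize Real.Gamma (m + ρ + 1 / 2) = B₀' at *
    generalize Real.Gamma (m + ρ) = B₀ at *
    have hA : A = 4 ^ n * A₀ * (B * B') / (B₀ * B₀') := by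
      field_simp
      linarith
    rw [hA]
    field_simp

/-- The powers of 2 combine to 2, and the factor √π of the duplication formula cancels the one in
the prefactor. It is used with k = n+m for the moments and with k = m for the constant of the
weight. -/
lemma gamma_duplication_weight (ρ : ℝ) (k : ℕ) :
    1 / (2 * √Real.pi) * (2 : ℝ) ^ (2 * (ρ - 1)) * ((1 / 4 : ℝ) ^ (k + 1))⁻¹
      * (Real.Gamma (k + ρ) * Real.Gamma (k + ρ + 1 / 2)) = Real.Gamma (2 * k + 2 * ρ) := by
  have hπ : √Real.pi ≠ 0 := (Real.sqrt_pos.mpr Real.pi_pos).ne'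
  have h1 : (2 : ℝ) ^ (2 * (ρ - 1)) * ((1 / 4 : ℝ) ^ (k + 1))⁻¹ * 2 ^ (1 - 2 * (k + ρ)) = 2 := by
    rw [show ((1 / 4 : ℝ) ^ (k + 1))⁻¹ = 2 ^ ((2 * (k + 1) : ℕ) : ℝ) by
        rw [Real.rpow_natCast, pow_mul, one_div, inv_pow, inv_inv]
        norm_num,
      ← Real.rpow_add two_pos, ← Real.rpow_add two_pos]
    conv_rhs => rw [← Real.rpow_one 2]
    congr 1
    push_cast
    ring
  rw [Real.Gamma_mul_Gamma_add_half, ← mul_add]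
  calc _ = (2 : ℝ) ^ (2 * (ρ - 1)) * ((1 / 4 : ℝ) ^ (k + 1))⁻¹ * 2 ^ (1 - 2 * (k + ρ))
        * Real.Gamma (2 * (k + ρ)) * (1 / (2 * √Real.pi) * √Real.pi) := by ring
    _ = _ := by
      rw [h1]
      field_simp

/-- The factors are Γ(s+ρ-1/2) and Γ(s-m) from gamma densities, Γ(s+ρ-1)/Γ(s+2ρ+m-1) from a beta
density with q = ρ+m, and the two integer-step quotients Γ(s-m)/Γ(s) and Γ(s+2ρ-1)/Γ(s+2ρ-1+m). -/
lemma exists_density_aType (m : ℕ) {ρ : ℝ} (hρ : 0 < ρ) :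
    ∃ d, IsDensityIoi d (fun s => Gamma (s - m) ^ 2 * Gamma (s - 1 + 2 * ρ) * Gamma (s - 1 + ρ)
      * Gamma (s - 1 / 2 + ρ) / (Gamma s * Gamma (s - 1 + 2 * ρ + m) ^ 2)) (max m (1 - ρ)) := by
  have hm : (0 : ℝ) ≤ m := m.cast_nonneg
  have hb := isDensityIoo_betaDensity (ρ - 1) (q := ρ + m) (by linarith)
  have h1 : IsDensityIoi _ _ (max (m : ℝ) (1 - ρ)) :=
    ((isDensityIoi_gammaDensity (ρ - 1 / 2)).mono
      (s₁ := max (m : ℝ) (1 - ρ)) (by rw [le_max_iff]; right; linarith)).mulConv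
    (hb.toMellinPair.mono (s₁ := max (m : ℝ) (1 - ρ)) (by rw [le_max_iff]; right; linarith)) hb.pos
    fun σ hσ => by
      obtain ⟨hσ1, hσ2⟩ := max_lt_iff.mp hσ
      refine continuous_vertical_of_differentiableAt (F := fun s =>
        Gamma (s + (ρ - 1 : ℝ)) / Gamma (s + (ρ - 1 : ℝ) + (ρ + m : ℝ))) fun s hs => ?_
      refine (differentiableAt_Gamma_add (by linarith)).div ?_ ?_
      · simp only [add_assoc, ← Complex.ofReal_add]
        exact differentiableAt_Gamma_add (by linarith)
      · exact Gamma_ne_zero_of_re_pos (by simp; linarith)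
  have hg := isDensityIoi_gammaDensity (-(m : ℝ))
  have h2 := h1.mulConv (hg.toMellinPair.mono (s₁ := max (m : ℝ) (1 - ρ)) (by simp))
    (fun x hx => hg.pos x hx.1) fun σ hσ => continuous_vertical_of_differentiableAt
      (F := fun s => Gamma (s + (-(m : ℝ) : ℝ))) fun s hs => by
      obtain ⟨hσ1, hσ2⟩ := max_lt_iff.mp hσ
      exact differentiableAt_Gamma_add (by linarith)
  obtain ⟨d₁, h3⟩ := h2.exists_mul_Gamma_ratio (c := -m) (by simp) m
  obtain ⟨d, h4⟩ := h3.exists_mul_Gamma_ratio (c := 2 * ρ - 1)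
    (by rw [le_max_iff]; right; linarith) m
  refine ⟨d, h4.congr fun s _ => ?_⟩
  push_cast
  rw [← sub_eq_add_neg, sub_add_cancel, show s + (ρ - 1 / 2) = s - 1 / 2 + ρ by ring,
    show s + (ρ - 1) + (ρ + m) = s - 1 + 2 * ρ + m by ring,
    show s + (ρ - 1) = s - 1 + ρ by ring, show s + (2 * ρ - 1) = s - 1 + 2 * ρ by ring]
  simp only [div_eq_mul_inv, mul_inv]
  ring

/-! ## The A-type system, second choice -/

/-- The squared modulus of Z at step k is κ² times two consecutive factors 2m+ν+1+2k and 2m+ν+2+2k.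
Their product over k cancels Γ(2n+2m+ν+1), which lowers the growth of the coefficients and confines
the states to the disc. -/
lemma norm_kCoeff_sq_aType_affine {κ γ lam δ a α ν : ℝ} (hκ : κ ≠ 0) (ha : a = -ν / 2)
    (hγ : -(a + γ) = ν / 2 + 1 / 2) (hν : -1 < ν) (m n : ℕ) :
    ‖(aType κ γ lam δ).kCoeff (fun a =>
        (Real.sqrt (auxG (-2 * κ) κ a * auxG (-2 * κ) (2 * κ) a) : ℂ)
          * Complex.exp (-(Complex.I * α * (aType κ γ lam δ).remainder a))) m a n‖ ^ 2
      = 1 / κ ^ (2 * m)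
        * (Real.Gamma (n + 1) ^ 2 * Real.Gamma (n + m + ν + 1) * Real.Gamma (2 * m + ν + 1)
          / (Real.Gamma (n + m + 1) * Real.Gamma (n + 2 * m + ν + 1) ^ 2)) := by
  have hm : (0 : ℝ) ≤ m := m.cast_nonneg
  have hn : (0 : ℝ) ≤ n := n.cast_nonneg
  have hx : 0 < 2 * m + ν + 1 := by linarith
  have h1 := Real.prod_range_add_two_mul hx n
  rw [norm_kCoeff_sq_aType hκ hγ.symm (by linarith)]
  have h2 : ∏ k ∈ Finset.range n, ‖(Real.sqrt (auxG (-2 * κ) κ (a - (m + k : ℕ))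
        * auxG (-2 * κ) (2 * κ) (a - (m + k : ℕ))) : ℂ)
        * Complex.exp (-(Complex.I * α * (aType κ γ lam δ).remainder (a - (m + k : ℕ))))‖ ^ 2
      = (κ ^ 2) ^ n * (Real.Gamma (2 * m + ν + 1 + 2 * n) / Real.Gamma (2 * m + ν + 1)) := by
    rw [← h1, pow_mul_prod_range]
    refine Finset.prod_congr rfl fun k _ => ?_
    have hk : (0 : ℝ) ≤ k := k.cast_nonneg
    have h3 : auxG (-2 * κ) κ (a - (m + k : ℕ)) * auxG (-2 * κ) (2 * κ) (a - (m + k : ℕ))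
        = κ ^ 2 * ((2 * m + ν + 1 + 2 * k) * (2 * m + ν + 1 + 2 * k + 1)) := by
      rw [ha, auxG, auxG]
      push_cast
      ring
    rw [h3, norm_ofReal_sqrt_mul_exp_sq (by positivity)]
  rw [h2, show 2 * (n : ℝ) + 2 * m + 2 * (ν / 2 + 1 / 2) = 2 * m + ν + 1 + 2 * n by ring,
    show (n : ℝ) + m + 2 * (ν / 2 + 1 / 2) = n + m + ν + 1 by ring,
    show (n : ℝ) + 2 * m + 2 * (ν / 2 + 1 / 2) = n + 2 * m + ν + 1 by ring, pow_mul]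
  have h4 : Real.Gamma (2 * m + ν + 1) ≠ 0 := (Real.Gamma_pos_of_pos hx).ne'
  have h5 : Real.Gamma (2 * m + ν + 1 + 2 * n) ≠ 0 := (Real.Gamma_pos_of_pos (by positivity)).ne'
  field_simp

lemma hasSum_aType_affine {κ₀ ν : ℝ} (hκ₀ : κ₀ ≠ 0) (hν : -1 < ν) (m : ℕ) {κ : ℕ → ℝ}
    (hκ : ∀ n : ℕ, κ n = 1 / κ₀ ^ (2 * m)
        * (Real.Gamma (n + 1) ^ 2 * Real.Gamma (n + m + ν + 1) * Real.Gamma (2 * m + ν + 1)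
          / (Real.Gamma (n + m + 1) * Real.Gamma (n + 2 * m + ν + 1) ^ 2)))
    {x : ℝ} (hx : 0 ≤ x) (hx1 : x < 1) :
    HasSum (fun n => x ^ n / κ n) (κ₀ ^ (2 * m) * Real.Gamma (m + 1)
        * (Real.Gamma (2 * m + ν + 1) / Real.Gamma (m + ν + 1)) * genHypergeometric
        [(m : ℝ) + 1, 2 * m + ν + 1, 2 * m + ν + 1] [1, m + ν + 1] x) ∧
      (0 < x → ((κ₀ ^ (2 * m) * Real.Gamma (m + 1)
        * (Real.Gamma (2 * m + ν + 1) / Real.Gamma (m + ν + 1)) * genHypergeometric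
        [(m : ℝ) + 1, 2 * m + ν + 1, 2 * m + ν + 1] [1, m + ν + 1] x : ℝ) : ℂ)
        = ((κ₀ ^ (2 * m) / Real.Gamma (2 * m + ν + 1) : ℝ) : ℂ)
          * meijerG [-(m : ℂ), -2 * (m : ℂ) - (ν : ℂ), -2 * (m : ℂ) - (ν : ℂ)] []
            [0] [0, -(m : ℂ) - (ν : ℂ)] (-(x : ℂ))) := by
  have hm : (0 : ℝ) ≤ m := m.cast_nonneg
  have hf : ∀ n : ℕ, Real.Gamma ((n : ℝ) + 1) = n.factorial := Real.Gamma_nat_eq_factorial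
  have hf0 : ∀ n : ℕ, (n.factorial : ℝ) ≠ 0 := fun n => by positivity
  have hG : ∀ {y : ℝ}, 0 < y → Real.Gamma y ≠ 0 := fun hy => (Real.Gamma_pos_of_pos hy).ne'
  have h1 : 0 < (m : ℝ) + ν + 1 := by linarith
  have h2 : 0 < 2 * (m : ℝ) + ν + 1 := by linarith
  have h1' := hG h1
  have h2' := hG h2
  have h3' : ∀ n : ℕ, Real.Gamma (n + m + ν + 1) ≠ 0 := fun n => hG (by
    have : (0 : ℝ) ≤ n := n.cast_nonneg
    linarith)
  have h4' : ∀ n : ℕ, Real.Gamma (n + 2 * m + ν + 1) ≠ 0 := fun n => hG (by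
    have : (0 : ℝ) ≤ n := n.cast_nonneg
    linarith)
  have := hasSum_and_eq_meijerG (κ := κ) [-(m : ℝ), -2 * m - ν, -2 * m - ν]
    [0, -m - ν] [(m : ℝ) + 1, 2 * m + ν + 1, 2 * m + ν + 1] [1, m + ν + 1]
    (C := κ₀ ^ (2 * m) / Real.Gamma (2 * m + ν + 1))
    (ξ := κ₀ ^ (2 * m) * Real.Gamma (m + 1)
        * (Real.Gamma (2 * m + ν + 1) / Real.Gamma (m + ν + 1))) (l := 1) one_pos
    (by simp; constructor <;> linarith) (by simp; linarith)
    (fun n x => ?_) (fun n x => ?_) hx (by simpa using hx1)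
  · simpa using this
  · rw [hκ]
    have e1 : (1 : ℝ) - -m + n = n + m + 1 := by ring
    have e2 : (1 : ℝ) - 0 + n = n + 1 := by ring
    have e3 : 1 - (-2 * (m : ℝ) - ν) + n = n + 2 * m + ν + 1 := by ring
    have e4 : 1 - (-(m : ℝ) - ν) + n = n + m + ν + 1 := by ring
    simp only [List.map_cons, List.map_nil, List.prod_cons, List.prod_nil, mul_one, e1, e2, e3, e4,
      hf, one_mul]
    have := hf0 n
    have := h3' n
    have := h4' n
    field_simp
  · rw [hκ]
    simp only [List.map_cons, List.map_nil, List.prod_cons, List.prod_nil, mul_one, one_mul]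
    rw [Real.ascPochhammer_eval_eq (by positivity), Real.ascPochhammer_eval_eq h2,
      Real.ascPochhammer_eval_eq (by positivity), Real.ascPochhammer_eval_eq h1]
    have e1 : (m : ℝ) + 1 + n = n + m + 1 := by ring
    have e2 : 2 * (m : ℝ) + ν + 1 + n = n + 2 * m + ν + 1 := by ring
    have e3 : (m : ℝ) + ν + 1 + n = n + m + ν + 1 := by ring
    rw [e1, e2, e3, add_comm (1 : ℝ) n, Real.Gamma_one, hf, hf]
    have := hf0 n
    have := hf0 m
    have := h3' n
    have := h4' n
    field_simp

/-- A beta density with q = 2m+ν, positive for every m because ν > 0, gives Γ(s-m)/Γ(s+m+ν). The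
quotients Γ(s-m)/Γ(s) and Γ(s+ν)/Γ(s+ν+m) have integer steps. -/
lemma exists_density_aType_affine (m : ℕ) {ν : ℝ} (hν : 0 < ν) :
    ∃ d, IsDensityIoo d (fun s => Gamma (s - m) ^ 2 * Gamma (s + ν)
      / (Gamma s * Gamma (s + m + ν) ^ 2)) m := by
  have hm : (0 : ℝ) ≤ m := m.cast_nonneg
  obtain ⟨d₁, h1⟩ := (isDensityIoo_betaDensity (-(m : ℝ)) (q := 2 * m + ν)
    (by linarith)).exists_mul_Gamma_ratio (c := -m) le_rfl m
  rw [neg_neg] at h1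
  obtain ⟨d, h2⟩ := h1.exists_mul_Gamma_ratio (c := ν) (by linarith) m
  refine ⟨d, h2.congr fun s _ => ?_⟩
  push_cast
  rw [← sub_eq_add_neg, sub_add_cancel, show s - m + (2 * m + ν) = s + m + ν by ring,
    show s + ν + m = s + m + ν by ring]
  simp only [div_eq_mul_inv, mul_inv]
  ring

end

/-! ### The four families of systems -/

theorem mainTheorem2
    {E : Type*} [NormedAddCommGroup E] [InnerProductSpace ℂ E] [CompleteSpace E]
    (Ψ : HilbertBasis ℕ ℂ E) (m : ℕ) :
    -- D-type systems, `γ = 2 β`, with the constant functional `Z = c`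
    (∀ (β δ γ a₁ : ℝ) (c : ℂ), 0 < γ → γ = 2 * β → c ≠ 0 →
      let S := dType β δ
      let Z : ℝ → ℂ := fun _ => c
      let K := S.kCoeff Z m a₁
      let N := S.normFactor Z m a₁
      let state := S.paState Z m a₁ Ψ
      let h : ℝ → ℂ := fun x =>
        meijerG [] [0] [-(m : ℂ), -(m : ℂ)] [] ((‖c‖ ^ 2 / γ * x : ℝ) : ℂ)
      (∀ n : ℕ, ‖K n‖ ^ 2 = γ ^ n * (n.factorial : ℝ) * Real.Gamma (n + 1)
        / (‖c‖ ^ (2 * n) * γ ^ m * Real.Gamma (n + m + 1))) ∧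
      (∀ z : ℂ,
        HasSum (fun n : ℕ => (‖z‖ ^ 2) ^ n / ‖K n‖ ^ 2)
          (γ ^ m * Real.Gamma (m + 1)
            * genHypergeometric [(m : ℝ) + 1] [1] (‖c * z‖ ^ 2 / γ)) ∧
        N (‖z‖ ^ 2) = (γ ^ m * Real.Gamma (m + 1)
            * genHypergeometric [(m : ℝ) + 1] [1] (‖c * z‖ ^ 2 / γ)) ^ (-(1 / 2) : ℝ) ∧
        ‖state z‖ = 1 ∧
        HasSum (fun n : ℕ => ((N (‖z‖ ^ 2) : ℂ) * (z ^ n / K n)) • Ψ (n + m)) (state z)) ∧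
      (∀ z : ℂ, z ≠ 0 → (((N (‖z‖ ^ 2) ^ 2)⁻¹ : ℝ) : ℂ)
        = (γ : ℂ) ^ m * meijerG [-(m : ℂ)] [] [0] [0] (-((‖c * z‖ ^ 2 / γ : ℝ) : ℂ))) ∧
      (∀ s : ℂ, (m : ℝ) < s.re → MellinConvergent h s ∧
        mellin h s = ((‖c‖ ^ 2 / γ : ℝ) : ℂ) ^ (-s)
          * (Complex.Gamma (s - m) ^ 2 / Complex.Gamma s)) ∧
      ∃ g ω : ℝ → ℝ,
        (∀ x : ℝ, 0 < x → h x = ((g x * γ ^ (2 * m + 1) / ‖c‖ ^ (2 * (m + 1)) : ℝ) : ℂ)) ∧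
        (∀ n : ℕ, IntegrableOn (fun x : ℝ => x ^ (n + m) * g x) (Set.Ioi 0) ∧
          ∫ x in Set.Ioi (0 : ℝ), x ^ (n + m) * g x = ‖K n‖ ^ 2) ∧
        (∀ x : ℝ, 0 < x → g x = Real.pi * N x ^ 2 * (x ^ m)⁻¹ * ω x) ∧
        (∀ x : ℝ, 0 < x → (ω x : ℂ) = ((1 / Real.pi * (‖c‖ ^ 2 / γ) : ℝ) : ℂ)
          * meijerG [-(m : ℂ)] [] [0] [0] (-((‖c‖ ^ 2 * x / γ : ℝ) : ℂ))
          * meijerG [] [(m : ℂ)] [0, 0] [] ((‖c‖ ^ 2 / γ * x : ℝ) : ℂ)) ∧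
        (∀ x : ℝ, 0 < x → 0 < ω x) ∧
        ResolvesIdentity Ψ m Set.univ state ω) ∧
    -- C-type systems, `γ = 2 β`, with `Z(a) = √g(a; -γ, 1) e^{-i α R(a)}` and `ρ = a₁ - 1 / γ`
    (∀ (β δ γ a₁ α ρ : ℝ), 0 < γ → γ = 2 * β → ρ = a₁ - 1 / γ → ρ < 0 →
      let S := cType β δ
      let Z : ℝ → ℂ := fun a => (Real.sqrt (auxG (-γ) 1 a) : ℂ)
        * Complex.exp (-(Complex.I * α * S.remainder a))
      let K := S.kCoeff Z m a₁
      let N := S.normFactor Z m a₁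
      let state := S.paState Z m a₁ Ψ
      let h : ℝ → ℂ := fun x =>
        meijerG [] [0, -(ρ : ℂ) - 1] [-(m : ℂ), -(m : ℂ)] [] (x : ℂ)
      (∀ n : ℕ, ‖K n‖ ^ 2 = Real.Gamma (-ρ + m) * Real.Gamma (n + 1) ^ 2
        / (γ ^ m * Real.Gamma (-ρ + m + n) * Real.Gamma (n + m + 1))) ∧
      (∀ z : ℂ, ‖z‖ < 1 →
        HasSum (fun n : ℕ => (‖z‖ ^ 2) ^ n / ‖K n‖ ^ 2)
          (γ ^ m * Real.Gamma (m + 1)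
            * genHypergeometric [(m : ℝ) - ρ, (m : ℝ) + 1] [1] (‖z‖ ^ 2)) ∧
        N (‖z‖ ^ 2) = (γ ^ m * Real.Gamma (m + 1)
            * genHypergeometric [(m : ℝ) - ρ, (m : ℝ) + 1] [1] (‖z‖ ^ 2)) ^ (-(1 / 2) : ℝ) ∧
        ‖state z‖ = 1 ∧
        HasSum (fun n : ℕ => ((N (‖z‖ ^ 2) : ℂ) * (z ^ n / K n)) • Ψ (n + m)) (state z)) ∧
      (∀ z : ℂ, z ≠ 0 → ‖z‖ < 1 → (((N (‖z‖ ^ 2) ^ 2)⁻¹ : ℝ) : ℂ)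
        = ((γ ^ m / Real.Gamma (m - ρ) : ℝ) : ℂ)
          * meijerG [-(m : ℂ), 1 - (m : ℂ) + (ρ : ℂ)] [] [0] [0] (-((‖z‖ ^ 2 : ℝ) : ℂ))) ∧
      (ρ < -1 →
        (∀ s : ℂ, (m : ℝ) < s.re → MellinConvergent h s ∧
          mellin h s
            = Complex.Gamma (s - m) ^ 2 / (Complex.Gamma s * Complex.Gamma (s - ρ - 1))) ∧
        ∃ g ω : ℝ → ℝ,
          (∀ x : ℝ, 0 < x → x ≠ 1 →
            h x = ((γ ^ m / Real.Gamma (-ρ + m) * g x : ℝ) : ℂ)) ∧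
          (∀ n : ℕ, IntegrableOn (fun x : ℝ => x ^ (n + m) * g x) (Set.Ioi 0) ∧
            ∫ x in Set.Ioi (0 : ℝ), x ^ (n + m) * g x = ‖K n‖ ^ 2) ∧
          (∀ x : ℝ, 0 < x → x < 1 → g x = Real.pi * N x ^ 2 * (x ^ m)⁻¹ * ω x) ∧
          (∀ x : ℝ, 0 < x → x < 1 → (ω x : ℂ) = ((1 / Real.pi : ℝ) : ℂ)
            * meijerG [-(m : ℂ), 1 - (m : ℂ) + (ρ : ℂ)] [] [0] [0] (-(x : ℂ))
            * meijerG [] [(m : ℂ), (m : ℂ) - (ρ : ℂ) - 1] [0, 0] [] (x : ℂ)) ∧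
          (∀ x : ℝ, 0 < x → x < 1 → 0 < ω x) ∧
          ResolvesIdentity Ψ m (Metric.ball 0 1) state ω)) ∧
    -- A-type systems, first choice `Z = κ = β`, with `ρ = -(a₁ + γ)`
    (∀ (κ γ lam δ a₁ ρ : ℝ), κ ≠ 0 → ρ = -(a₁ + γ) → 0 < ρ →
      let S := aType κ γ lam δ
      let Z : ℝ → ℂ := fun _ => (κ : ℂ)
      let K := S.kCoeff Z m a₁
      let N := S.normFactor Z m a₁
      let state := S.paState Z m a₁ Ψ
      let ξ : ℝ := κ ^ (2 * m) * Real.Gamma (m + 1) * Real.Gamma (2 * m + 2 * ρ)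
        / Real.Gamma (m + 2 * ρ)
      let χ : ℝ := κ ^ (2 * m) * Real.Gamma (m + ρ) * Real.Gamma (m + ρ + 1 / 2)
        / Real.Gamma (2 * m + 2 * ρ)
      let F : ℝ → ℝ := fun x => genHypergeometric
        [(m : ℝ) + 1, 2 * m + 2 * ρ, 2 * m + 2 * ρ] [1, m + ρ, m + 2 * ρ, m + ρ + 1 / 2] (x / 4)
      let G₁ : ℝ → ℂ := fun x => meijerG
        [-(m : ℂ), 1 - 2 * (m : ℂ) - 2 * (ρ : ℂ), 1 - 2 * (m : ℂ) - 2 * (ρ : ℂ)] []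
        [0] [0, 1 - (m : ℂ) - (ρ : ℂ), 1 - (m : ℂ) - 2 * (ρ : ℂ), 1 / 2 - (m : ℂ) - (ρ : ℂ)]
        (-((x / 4 : ℝ) : ℂ))
      let h : ℝ → ℂ := fun x => meijerG
        [] [0, -1 + 2 * (ρ : ℂ) + (m : ℂ), -1 + 2 * (ρ : ℂ) + (m : ℂ)]
        [-(m : ℂ), -(m : ℂ), -1 + 2 * (ρ : ℂ), -1 + (ρ : ℂ), -1 / 2 + (ρ : ℂ)] []
        ((x / 4 : ℝ) : ℂ)
      (∀ n : ℕ, ‖K n‖ ^ 2 = 1 / κ ^ (2 * m)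
        * (Real.Gamma (n + 1) ^ 2 * Real.Gamma (2 * n + 2 * m + 2 * ρ)
            * Real.Gamma (n + m + 2 * ρ)
          / (Real.Gamma (n + m + 1) * Real.Gamma (n + 2 * m + 2 * ρ) ^ 2))) ∧
      (∀ z : ℂ,
        HasSum (fun n : ℕ => (‖z‖ ^ 2) ^ n / ‖K n‖ ^ 2) (ξ * F (‖z‖ ^ 2)) ∧
        N (‖z‖ ^ 2) = (ξ * F (‖z‖ ^ 2)) ^ (-(1 / 2) : ℝ) ∧
        ‖state z‖ = 1 ∧
        HasSum (fun n : ℕ => ((N (‖z‖ ^ 2) : ℂ) * (z ^ n / K n)) • Ψ (n + m)) (state z)) ∧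
      (∀ z : ℂ, z ≠ 0 → (((N (‖z‖ ^ 2) ^ 2)⁻¹ : ℝ) : ℂ) = (χ : ℂ) * G₁ (‖z‖ ^ 2)) ∧
      (∀ s : ℂ, (m : ℝ) < s.re → 1 - ρ < s.re → MellinConvergent h s ∧
        mellin h s = (1 / 4 : ℂ) ^ (-s)
          * (Complex.Gamma (s - m) ^ 2 * Complex.Gamma (s - 1 + 2 * ρ)
              * Complex.Gamma (s - 1 + ρ) * Complex.Gamma (s - 1 / 2 + ρ)
            / (Complex.Gamma s * Complex.Gamma (s - 1 + 2 * ρ + m) ^ 2))) ∧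
      ∃ g ω : ℝ → ℝ,
        (∀ x : ℝ, 0 < x → (g x : ℂ) = ((1 / (2 * Real.sqrt Real.pi) * (κ ^ (2 * m))⁻¹
          * (2 : ℝ) ^ (2 * (ρ - 1)) : ℝ) : ℂ) * h x) ∧
        (∀ n : ℕ, IntegrableOn (fun x : ℝ => x ^ (n + m) * g x) (Set.Ioi 0) ∧
          ∫ x in Set.Ioi (0 : ℝ), x ^ (n + m) * g x = ‖K n‖ ^ 2) ∧
        (∀ x : ℝ, 0 < x → g x = Real.pi * N x ^ 2 * (x ^ m)⁻¹ * ω x) ∧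
        (∀ x : ℝ, 0 < x → (ω x : ℂ) = ((1 / (4 * Real.pi) : ℝ) : ℂ) * G₁ x * meijerG
          [] [(m : ℂ), -1 + 2 * (ρ : ℂ) + 2 * (m : ℂ), -1 + 2 * (ρ : ℂ) + 2 * (m : ℂ)]
          [0, 0, 2 * (ρ : ℂ) + (m : ℂ) - 1, -1 + (m : ℂ) + (ρ : ℂ), -1 / 2 + (m : ℂ) + (ρ : ℂ)] []
          ((x / 4 : ℝ) : ℂ)) ∧
        (∀ x : ℝ, 0 < x → 0 < ω x) ∧
        ResolvesIdentity Ψ m Set.univ state ω) ∧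
    -- A-type systems, second choice `Z(a) = √(g(a; -2κ, κ) g(a; -2κ, 2κ)) e^{-i α R(a)}`,
    -- with `β = κ`, `a₁ = -ν / 2` and `-(a₁ + γ) = ν / 2 + 1 / 2`
    (∀ (κ γ lam δ a₁ α ν : ℝ), κ ≠ 0 → a₁ = -ν / 2 → -(a₁ + γ) = ν / 2 + 1 / 2 → -1 < ν →
      let S := aType κ γ lam δ
      let Z : ℝ → ℂ := fun a =>
        (Real.sqrt (auxG (-2 * κ) κ a * auxG (-2 * κ) (2 * κ) a) : ℂ)
          * Complex.exp (-(Complex.I * α * S.remainder a))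
      let K := S.kCoeff Z m a₁
      let N := S.normFactor Z m a₁
      let state := S.paState Z m a₁ Ψ
      let ξ : ℝ := κ ^ (2 * m) * Real.Gamma (m + 1)
        * (Real.Gamma (2 * m + ν + 1) / Real.Gamma (m + ν + 1))
      let F : ℝ → ℝ := genHypergeometric
        [(m : ℝ) + 1, 2 * m + ν + 1, 2 * m + ν + 1] [1, m + ν + 1]
      let G₁ : ℝ → ℂ := fun x => meijerG
        [-(m : ℂ), -2 * (m : ℂ) - (ν : ℂ), -2 * (m : ℂ) - (ν : ℂ)] []
        [0] [0, -(m : ℂ) - (ν : ℂ)] (-(x : ℂ))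
      let h : ℝ → ℂ := fun x => meijerG
        [] [0, (m : ℂ) + (ν : ℂ), (m : ℂ) + (ν : ℂ)] [-(m : ℂ), -(m : ℂ), (ν : ℂ)] [] (x : ℂ)
      (∀ n : ℕ, ‖K n‖ ^ 2 = 1 / κ ^ (2 * m)
        * (Real.Gamma (n + 1) ^ 2 * Real.Gamma (n + m + ν + 1) * Real.Gamma (2 * m + ν + 1)
          / (Real.Gamma (n + m + 1) * Real.Gamma (n + 2 * m + ν + 1) ^ 2))) ∧
      (∀ z : ℂ, ‖z‖ < 1 →
        HasSum (fun n : ℕ => (‖z‖ ^ 2) ^ n / ‖K n‖ ^ 2) (ξ * F (‖z‖ ^ 2)) ∧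
        N (‖z‖ ^ 2) = (ξ * F (‖z‖ ^ 2)) ^ (-(1 / 2) : ℝ) ∧
        ‖state z‖ = 1 ∧
        HasSum (fun n : ℕ => ((N (‖z‖ ^ 2) : ℂ) * (z ^ n / K n)) • Ψ (n + m)) (state z)) ∧
      (∀ z : ℂ, z ≠ 0 → ‖z‖ < 1 → (((N (‖z‖ ^ 2) ^ 2)⁻¹ : ℝ) : ℂ)
        = ((κ ^ (2 * m) / Real.Gamma (2 * m + ν + 1) : ℝ) : ℂ) * G₁ (‖z‖ ^ 2)) ∧
      (0 < ν →
        (∀ s : ℂ, (m : ℝ) < s.re → MellinConvergent h s ∧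
          mellin h s = Complex.Gamma (s - m) ^ 2 * Complex.Gamma (s + ν)
            / (Complex.Gamma s * Complex.Gamma (s + m + ν) ^ 2)) ∧
        ∃ g ω : ℝ → ℝ,
          (∀ x : ℝ, 0 < x → x ≠ 1 →
            (g x : ℂ) = ((Real.Gamma (2 * m + ν + 1) / κ ^ (2 * m) : ℝ) : ℂ) * h x) ∧
          (∀ n : ℕ, IntegrableOn (fun x : ℝ => x ^ (n + m) * g x) (Set.Ioi 0) ∧
            ∫ x in Set.Ioi (0 : ℝ), x ^ (n + m) * g x = ‖K n‖ ^ 2) ∧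
          (∀ x : ℝ, 0 < x → x < 1 → g x = Real.pi * N x ^ 2 * (x ^ m)⁻¹ * ω x) ∧
          (∀ x : ℝ, 0 < x → x < 1 → (ω x : ℂ) = ((1 / Real.pi : ℝ) : ℂ) * G₁ x * meijerG
            [] [(m : ℂ), 2 * (m : ℂ) + (ν : ℂ), 2 * (m : ℂ) + (ν : ℂ)]
            [0, 0, (m : ℂ) + (ν : ℂ)] [] (x : ℂ)) ∧
          (∀ x : ℝ, 0 < x → x < 1 → 0 < ω x) ∧
          ResolvesIdentity Ψ m (Metric.ball 0 1) state ω)) := by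
  refine ⟨?_, ?_, ?_, ?_⟩
  · intro β δ γ a₁ c hγ hβ hc S Z K N state h
    have hr : 0 < ‖c‖ := norm_pos_iff.mpr hc
    have hl : 0 < ‖c‖ ^ 2 / γ := by positivity
    have hK : ∀ n, ‖K n‖ ^ 2 = _ := norm_kCoeff_sq_dType hγ hβ a₁ c m
    have hS : ∀ k N, k < N → 0 < S.partialSum a₁ k N := fun k N =>
      partialSum_pos_of_remainder_const hγ (by rw [hβ]; rfl) a₁
    have hZ : ∀ k, Z (S.paramSeq a₁ k) ≠ 0 := fun _ => hc
    have hsum := fun x (hx : 0 ≤ x) => hasSum_dType hγ hr m hK hx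
    have hKpos : ∀ n, 0 < ‖K n‖ ^ 2 := fun n =>
      pow_pos (norm_pos_iff.mpr (SIPSystem.kCoeff_ne_zero hS Z m hZ n)) 2
    have hTpos := fun x (hx : 0 ≤ x) => pos_of_hasSum_pow_div hKpos hx (hsum x hx).1
    have harg : ∀ z : ℂ, ‖c * z‖ ^ 2 / γ = ‖c‖ ^ 2 / γ * ‖z‖ ^ 2 := fun z => by
      rw [norm_mul]
      ring
    obtain ⟨d, hd⟩ := exists_density_dType m
    have hdG : ∀ x : ℝ, 0 < x → meijerG [] [0] [-(m : ℂ), -(m : ℂ)] [] (x : ℂ) = d x ∧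
        meijerG [] [(m : ℂ)] [0, 0] [] (x : ℂ) = ((x ^ m * d x : ℝ) : ℂ) := fun x hx => by
      have := IsDensityIoi.meijerG_eq_and_shift (as' := [0]) (bs := [-(m : ℝ), -(m : ℝ)])
        (by simp) (hd.congr fun s _ => by simp [meijerKernel]; ring_nf)
        (fun σ hσ => by simpa using hσ) m hx
      simpa using this
    refine ⟨hK, fun z => ?_, fun z hz => ?_, fun s hs => ?_, ?_⟩
    · rw [harg]
      exact SIPSystem.paState_properties hS Z m Ψ (hTpos _ (sq_nonneg _)) (hsum _ (sq_nonneg _)).1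
    · rw [harg, SIPSystem.normFactor_sq_inv_eq (hTpos _ (sq_nonneg _)) (hsum _ (sq_nonneg _)).1]
      exact (hsum _ (sq_nonneg _)).2 (by positivity)
    · exact hd.mellin_comp_mul_left hl (fun x hx _ => (hdG _ (mul_pos hl hx)).1) hs
    · obtain ⟨g, ω, hg, hmom, hgω, hω, hωpos, hres⟩ := SIPSystem.exists_weight Ψ hS hZ
        MeasurableSet.univ (J := Set.univ) (by simp) (fun x hx _ => (hsum x hx).1)
        -- The factor is the inverse of the one relating h to g. Below, the transform at s = n+m+1
        -- is Γ(n+1)²/Γ(n+m+1).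
        hd.toMellinPair hl (A := ‖c‖ ^ (2 * (m + 1)) / γ ^ (2 * m + 1)) (by positivity) (by linarith)
        (fun n => by
          change _ = ((‖K n‖ ^ 2 : ℝ) : ℂ)
          rw [hK, ← Real.Gamma_nat_eq_factorial]
          rw [show (n : ℂ) + m + 1 - m = ((n + 1 : ℝ) : ℂ) by push_cast; ring,
            show (n : ℂ) + m + 1 = ((n + m + 1 : ℝ) : ℂ) by push_cast; ring,
            Complex.Gamma_ofReal, Complex.Gamma_ofReal]
          norm_cast
          have := (Real.Gamma_pos_of_pos (by positivity : (0 : ℝ) < n + m + 1)).ne'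
          rw [div_pow, ← pow_mul]
          field_simp
          ring)
        (fun x hx _ => hd.pos _ (mul_pos hl hx)) (fun x hx => absurd (Set.mem_univ x) hx)
      refine ⟨g, ω, fun x hx => ?_, hmom, fun x hx => hgω x hx trivial, fun x hx => ?_,
        fun x hx => hωpos x hx trivial, hres⟩
      · refine (hdG _ (mul_pos hl hx)).1.trans ?_
        rw [hg]
        congr 1
        field_simp
      · rw [hω x hx trivial, (hdG _ (mul_pos hl hx)).2, Complex.ofReal_mul, Complex.ofReal_mul,
          (hsum x hx.le).2 hx, mul_div_right_comm]
        push_cast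
        rw [mul_pow, div_pow]
        have h1 : (γ : ℂ) ≠ 0 := by exact_mod_cast hγ.ne'
        have h2 : (‖c‖ : ℂ) ≠ 0 := by exact_mod_cast hr.ne'
        have h3 : (Real.pi : ℂ) ≠ 0 := by exact_mod_cast Real.pi_ne_zero
        field_simp
        ring
  · intro β δ γ a₁ α ρ hγ hβ hρ hρ0 S Z K N state h
    have hK : ∀ n, ‖K n‖ ^ 2 = _ := norm_kCoeff_sq_cType hγ hβ hρ hρ0 m
    have hS : ∀ k N, k < N → 0 < S.partialSum a₁ k N := fun k N =>
      partialSum_pos_of_remainder_const hγ (by rw [hβ]; rfl) a₁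
    have hZ : ∀ k, Z (S.paramSeq a₁ k) ≠ 0 := fun k => by
      have h1 : 0 < auxG (-γ) 1 (S.paramSeq a₁ k) := by
        have h2 : auxG (-γ) 1 (S.paramSeq a₁ k) = γ * (k - ρ) := by
          rw [SIPSystem.paramSeq_of_shift_sub_one rfl, hρ, auxG]
          field_simp
          ring
        rw [h2]
        have : (0 : ℝ) ≤ k := k.cast_nonneg
        exact mul_pos hγ (by linarith)
      exact mul_ne_zero (by exact_mod_cast (Real.sqrt_pos.mpr h1).ne') (Complex.exp_ne_zero _)
    have hsum := fun x (hx : 0 ≤ x) (hx1 : x < 1) => hasSum_cType hγ hρ0 m hK hx hx1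
    have hKpos : ∀ n, 0 < ‖K n‖ ^ 2 := fun n =>
      pow_pos (norm_pos_iff.mpr (SIPSystem.kCoeff_ne_zero hS Z m hZ n)) 2
    have hTpos := fun x (hx : 0 ≤ x) (hx1 : x < 1) =>
      pos_of_hasSum_pow_div hKpos hx (hsum x hx hx1).1
    have hsq : ∀ z : ℂ, ‖z‖ < 1 → ‖z‖ ^ 2 < 1 := fun z hz =>
      pow_lt_one₀ (norm_nonneg z) hz two_ne_zero
    refine ⟨hK, fun z hz => ?_, fun z hz0 hz => ?_, fun hρ1 => ?_⟩
    · exact SIPSystem.paState_properties hS Z m Ψ (hTpos _ (sq_nonneg _) (hsq z hz))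
        (hsum _ (sq_nonneg _) (hsq z hz)).1
    · rw [SIPSystem.normFactor_sq_inv_eq (hTpos _ (sq_nonneg _) (hsq z hz))
        (hsum _ (sq_nonneg _) (hsq z hz)).1]
      exact (hsum _ (sq_nonneg _) (hsq z hz)).2 (by positivity)
    -- The stronger bound on ρ enters only here, where the density must exist; the normalization
    -- above needs ρ < 0.
    obtain ⟨d, hd⟩ := exists_density_cType m hρ1
    have hdG : ∀ x : ℝ, 0 < x → x ≠ 1 →
        meijerG [] [0, -(ρ : ℂ) - 1] [-(m : ℂ), -(m : ℂ)] [] (x : ℂ) = d x ∧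
        meijerG [] [(m : ℂ), (m : ℂ) - (ρ : ℂ) - 1] [0, 0] [] (x : ℂ)
          = ((x ^ m * d x : ℝ) : ℂ) := fun x hx hx1 => by
      have := IsDensityIoo.meijerG_eq_and_shift (as' := [0, -ρ - 1]) (bs := [-(m : ℝ), -(m : ℝ)])
        (by simp) (hd.congr fun s _ => by
          simp [meijerKernel]
          ring_nf) (by simp) (by simp) hx hx1
      rw [show (m : ℂ) - ρ - 1 = -ρ - 1 + m by ring]
      simpa using this
    refine ⟨fun s hs => ?_, ?_⟩
    · simpa using hd.mellin_comp_mul_left one_pos (h := h)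
        (fun x hx hx1 => by rw [one_mul]; exact (hdG x hx hx1).1) hs
    · have hmρ : (0 : ℝ) < -ρ + m := by
        have : (0 : ℝ) ≤ m := m.cast_nonneg
        linarith
      have hΓ := Real.Gamma_pos_of_pos hmρ
      obtain ⟨g, ω, hg, hmom, hgω, hω, hωpos, hres⟩ := SIPSystem.exists_weight Ψ hS hZ
        (D := Metric.ball 0 1) measurableSet_ball (J := Set.Iio 1)
        (fun z => by simp)
        (fun x hx hx1 => (hsum x hx hx1).1)
        hd.toMellinPair one_pos (A := Real.Gamma (-ρ + m) / γ ^ m) (by positivity) (by linarith)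
        (fun n => by
          change _ = ((‖K n‖ ^ 2 : ℝ) : ℂ)
          rw [hK]
          rw [show (n : ℂ) + m + 1 - m = ((n + 1 : ℝ) : ℂ) by push_cast; ring,
            show (n : ℂ) + m + 1 - ρ - 1 = ((-ρ + m + n : ℝ) : ℂ) by push_cast; ring,
            show (n : ℂ) + m + 1 = ((n + m + 1 : ℝ) : ℂ) by push_cast; ring,
            Complex.Gamma_ofReal, Complex.Gamma_ofReal, Complex.Gamma_ofReal]
          rw [Complex.ofReal_one, one_pow, inv_one, mul_one]
          norm_cast
          rw [div_mul_div_comm]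
          ring)
        (fun x hx hx1 => hd.pos _ (by rw [one_mul]; exact ⟨hx, hx1⟩))
        (fun x hx => by rw [one_mul]; exact hd.zero x (not_lt.mp hx))
      simp only [one_mul] at hg hω
      refine ⟨g, ω, fun x hx hx1 => ?_, hmom, hgω, fun x hx hx1 => ?_, hωpos, hres⟩
      · rw [hg]
        refine (hdG x hx hx1).1.trans ?_
        congr 1
        field_simp
      · rw [hω x hx hx1, (hdG x hx hx1.ne).2, Complex.ofReal_mul, Complex.ofReal_mul,
          (hsum x hx.le hx1).2 hx, show (m : ℝ) - ρ = -ρ + m by ring]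
        push_cast
        have h1 : (γ : ℂ) ≠ 0 := by exact_mod_cast hγ.ne'
        have h2 : (Real.Gamma (-ρ + m) : ℂ) ≠ 0 := by exact_mod_cast hΓ.ne'
        field_simp
  · intro κ γ lam δ a₁ ρ hκ hρ hρ0 S Z K N state ξ χ F G₁ h
    have hm : (0 : ℝ) ≤ m := m.cast_nonneg
    have hl : (0 : ℝ) < 1 / 4 := by norm_num
    have hK : ∀ n : ℕ, ‖K n‖ ^ 2 = 1 / κ ^ (2 * m)
        * (Real.Gamma (n + 1) ^ 2 * Real.Gamma (2 * n + 2 * m + 2 * ρ) * Real.Gamma (n + m + 2 * ρ)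
          / (Real.Gamma (n + m + 1) * Real.Gamma (n + 2 * m + 2 * ρ) ^ 2)) := fun n => by
      refine (norm_kCoeff_sq_aType hκ hρ hρ0 Z m n).trans ?_
      simp only [Z, Complex.norm_real, Real.norm_eq_abs, sq_abs, Finset.prod_const,
        Finset.card_range]
      rw [← pow_mul, ← pow_mul]
      field_simp
    have hS : ∀ k N, k < N → 0 < S.partialSum a₁ k N := fun k N => partialSum_aType_pos hκ hρ hρ0
    have hZ : ∀ k, Z (S.paramSeq a₁ k) ≠ 0 := fun _ => Complex.ofReal_ne_zero.mpr hκ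
    have hsum := fun x (hx : 0 ≤ x) => hasSum_aType hκ hρ0 m hK hx
    have hKpos : ∀ n, 0 < ‖K n‖ ^ 2 := fun n =>
      pow_pos (norm_pos_iff.mpr (SIPSystem.kCoeff_ne_zero hS Z m hZ n)) 2
    have hTpos := fun x (hx : 0 ≤ x) => pos_of_hasSum_pow_div hKpos hx (hsum x hx).1
    obtain ⟨d, hd⟩ := exists_density_aType m hρ0
    have hdG : ∀ x : ℝ, 0 < x → h x = d (1 / 4 * x) ∧ meijerG
          [] [(m : ℂ), -1 + 2 * (ρ : ℂ) + 2 * (m : ℂ), -1 + 2 * (ρ : ℂ) + 2 * (m : ℂ)]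
          [0, 0, 2 * (ρ : ℂ) + (m : ℂ) - 1, -1 + (m : ℂ) + (ρ : ℂ), -1 / 2 + (m : ℂ) + (ρ : ℂ)] []
          ((x / 4 : ℝ) : ℂ) = (((1 / 4 * x) ^ m * d (1 / 4 * x) : ℝ) : ℂ) := fun x hx => by
      have := IsDensityIoi.meijerG_eq_and_shift (as' := [0, -1 + 2 * ρ + m, -1 + 2 * ρ + m])
        (bs := [-(m : ℝ), -(m : ℝ), -1 + 2 * ρ, -1 + ρ, -1 / 2 + ρ])
        (by simp) (hd.congr fun s _ => by
          simp [meijerKernel]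
          ring_nf)
        -- The lower parameters -m and ρ-1 determine the abscissa max(m, 1-ρ); the remaining ones
        -- give weaker conditions because ρ > 0.
        (fun σ hσ => by
          simp at hσ
          exact max_lt hσ.1 (by linarith [hσ.2.2.1])) m (mul_pos hl hx)
      rw [show 2 * (ρ : ℂ) + m - 1 = -1 + 2 * ρ + m by ring,
        show -1 + (m : ℂ) + ρ = -1 + ρ + m by ring,
        show -1 / 2 + (m : ℂ) + ρ = -1 / 2 + ρ + m by ring,
        show -1 + 2 * (ρ : ℂ) + 2 * m = -1 + 2 * ρ + m + m by ring]
      simp only [h, div_eq_inv_mul x]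
      simpa using this
    refine ⟨hK, fun z => ?_, fun z hz => ?_, fun s hs hs' => ?_, ?_⟩
    · exact SIPSystem.paState_properties hS Z m Ψ (hTpos _ (sq_nonneg _)) (hsum _ (sq_nonneg _)).1
    · rw [SIPSystem.normFactor_sq_inv_eq (hTpos _ (sq_nonneg _)) (hsum _ (sq_nonneg _)).1]
      exact (hsum _ (sq_nonneg _)).2 (by positivity)
    · simpa using hd.mellin_comp_mul_left hl (fun x hx _ => (hdG x hx).1) (max_lt hs hs')
    · have hπ : 0 < √Real.pi := Real.sqrt_pos.mpr Real.pi_pos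
      obtain ⟨g, ω, hg, hmom, hgω, hω, hωpos, hres⟩ := SIPSystem.exists_weight Ψ hS hZ
        MeasurableSet.univ (J := Set.univ) (by simp) (fun x hx _ => (hsum x hx).1)
        hd.toMellinPair hl (A := 1 / (2 * Real.sqrt Real.pi) * (κ ^ (2 * m))⁻¹
          * (2 : ℝ) ^ (2 * (ρ - 1)))
        (by
          have : 0 < κ ^ (2 * m) := by rw [pow_mul]; positivity
          positivity)
        -- Since ρ > 0, the points n+m+1 of all required moments lie to the right of max(m, 1-ρ).
        (max_lt (by linarith) (by linarith))
        (fun n => by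
          change _ = ((‖K n‖ ^ 2 : ℝ) : ℂ)
          have hc := gamma_duplication_weight ρ (n + m)
          rw [hK]
          rw [show (n : ℂ) + m + 1 - m = ((n + 1 : ℝ) : ℂ) by push_cast; ring,
            show (n : ℂ) + m + 1 - 1 + 2 * ρ + m = ((n + 2 * m + 2 * ρ : ℝ) : ℂ) by
              push_cast; ring,
            show (n : ℂ) + m + 1 - 1 + 2 * ρ = ((n + m + 2 * ρ : ℝ) : ℂ) by push_cast; ring,
            show (n : ℂ) + m + 1 - 1 + ρ = (((n + m : ℕ) + ρ : ℝ) : ℂ) by push_cast; ring,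
            show (n : ℂ) + m + 1 - 1 / 2 + ρ = (((n + m : ℕ) + ρ + 1 / 2 : ℝ) : ℂ) by
              push_cast; ring,
            show (n : ℂ) + m + 1 = ((n + m + 1 : ℝ) : ℂ) by push_cast; ring]
          simp only [Complex.Gamma_ofReal]
          rw [show (2 : ℝ) * n + 2 * m + 2 * ρ = 2 * (n + m : ℕ) + 2 * ρ by push_cast; ring, ← hc]
          push_cast
          ring)
        (fun x hx _ => hd.pos _ (mul_pos hl hx)) (fun x hx => absurd (Set.mem_univ x) hx)
      refine ⟨g, ω, fun x hx => ?_, hmom, fun x hx => hgω x hx trivial, fun x hx => ?_,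
        fun x hx => hωpos x hx trivial, hres⟩
      · rw [hg, (hdG x hx).1, Complex.ofReal_mul]
      -- The duplication identity at n = 0 collapses the constants of g and of the normalization.
      -- The remaining (1/4)^m is absorbed by the power (x/4)^m in the second Meijer factor.
      · have hcst : 1 / (2 * √Real.pi) * (κ ^ (2 * m))⁻¹ * 2 ^ (2 * (ρ - 1)) / Real.pi * χ
            = 1 / (4 * Real.pi) * (1 / 4) ^ m := by
          have hΓ := (Real.Gamma_pos_of_pos (by positivity : 0 < 2 * (m : ℝ) + 2 * ρ)).ne'
          have h1 := gamma_duplication_weight ρ m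
          simp only [χ]
          rw [pow_succ, mul_inv] at h1
          rw [← mul_div_assoc, div_eq_iff hΓ, ← h1]
          have := Real.pi_ne_zero
          field_simp
        rw [hω x hx trivial, (hdG x hx).2, Complex.ofReal_mul, Complex.ofReal_mul,
          (hsum x hx.le).2 hx]
        have hcst' := congrArg ((↑) : ℝ → ℂ) hcst
        rw [Complex.ofReal_mul, Complex.ofReal_mul (1 / _)] at hcst'
        rw [mul_pow, mul_assoc ((1 / 4 : ℝ) ^ m), Complex.ofReal_mul ((1 / 4) ^ m),
          Complex.ofReal_mul (x ^ m)]
        simp only [G₁, χ] at hcst' ⊢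
        linear_combination (meijerG [-(m : ℂ), 1 - 2 * (m : ℂ) - 2 * (ρ : ℂ),
          1 - 2 * (m : ℂ) - 2 * (ρ : ℂ)] [] [0] [0, 1 - (m : ℂ) - (ρ : ℂ),
            1 - (m : ℂ) - 2 * (ρ : ℂ), 1 / 2 - (m : ℂ) - (ρ : ℂ)] (-((x / 4 : ℝ) : ℂ))
              * ((x ^ m : ℝ) : ℂ) * ((d (1 / 4 * x) : ℝ) : ℂ)) * hcst'
  · intro κ γ lam δ a₁ α ν hκ ha₁ hγ hν S Z K N state ξ F G₁ h
    have hm : (0 : ℝ) ≤ m := m.cast_nonneg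
    have hK : ∀ n, ‖K n‖ ^ 2 = _ := norm_kCoeff_sq_aType_affine hκ ha₁ hγ hν m
    have hS : ∀ k N, k < N → 0 < S.partialSum a₁ k N := fun k N =>
      partialSum_aType_pos hκ hγ.symm (by linarith)
    have hZ : ∀ k, Z (S.paramSeq a₁ k) ≠ 0 := fun k => by
      have h1 : 0 < auxG (-2 * κ) κ (S.paramSeq a₁ k) * auxG (-2 * κ) (2 * κ) (S.paramSeq a₁ k) := by
        have h2 : auxG (-2 * κ) κ (S.paramSeq a₁ k) * auxG (-2 * κ) (2 * κ) (S.paramSeq a₁ k)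
            = κ ^ 2 * ((ν + 1 + 2 * k) * (ν + 2 + 2 * k)) := by
          rw [SIPSystem.paramSeq_of_shift_sub_one rfl, ha₁, auxG, auxG]
          ring
        rw [h2]
        have : (0 : ℝ) ≤ k := k.cast_nonneg
        exact mul_pos (by positivity) (mul_pos (by linarith) (by linarith))
      exact mul_ne_zero (by exact_mod_cast (Real.sqrt_pos.mpr h1).ne') (Complex.exp_ne_zero _)
    have hsum := fun x (hx : 0 ≤ x) (hx1 : x < 1) => hasSum_aType_affine hκ hν m hK hx hx1
    have hKpos : ∀ n, 0 < ‖K n‖ ^ 2 := fun n =>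
      pow_pos (norm_pos_iff.mpr (SIPSystem.kCoeff_ne_zero hS Z m hZ n)) 2
    have hTpos := fun x (hx : 0 ≤ x) (hx1 : x < 1) =>
      pos_of_hasSum_pow_div hKpos hx (hsum x hx hx1).1
    have hsq : ∀ z : ℂ, ‖z‖ < 1 → ‖z‖ ^ 2 < 1 := fun z hz =>
      pow_lt_one₀ (norm_nonneg z) hz two_ne_zero
    refine ⟨hK, fun z hz => ?_, fun z hz0 hz => ?_, fun hν0 => ?_⟩
    · exact SIPSystem.paState_properties hS Z m Ψ (hTpos _ (sq_nonneg _) (hsq z hz))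
        (hsum _ (sq_nonneg _) (hsq z hz)).1
    · rw [SIPSystem.normFactor_sq_inv_eq (hTpos _ (sq_nonneg _) (hsq z hz))
        (hsum _ (sq_nonneg _) (hsq z hz)).1]
      exact (hsum _ (sq_nonneg _) (hsq z hz)).2 (by positivity)
    obtain ⟨d, hd⟩ := exists_density_aType_affine m hν0
    have hdG : ∀ x : ℝ, 0 < x → x ≠ 1 → h x = d x ∧
        meijerG [] [(m : ℂ), 2 * (m : ℂ) + (ν : ℂ), 2 * (m : ℂ) + (ν : ℂ)]
          [0, 0, (m : ℂ) + (ν : ℂ)] [] (x : ℂ) = ((x ^ m * d x : ℝ) : ℂ) := fun x hx hx1 => by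
      have := IsDensityIoo.meijerG_eq_and_shift (as' := [0, m + ν, m + ν])
        (bs := [-(m : ℝ), -(m : ℝ), ν])
        (by simp) (hd.congr fun s _ => by
          simp [meijerKernel]
          ring_nf) (by simp) (by simp; linarith) hx hx1
      rw [show 2 * (m : ℂ) + ν = m + ν + m by ring, add_comm (m : ℂ) (ν : ℂ)]
      simp only [h]
      rw [add_comm (m : ℂ) (ν : ℂ)]
      simpa [add_comm (m : ℂ) (ν : ℂ)] using this
    refine ⟨fun s hs => ?_, ?_⟩
    · simpa using hd.mellin_comp_mul_left one_pos (h := h)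
        (fun x hx hx1 => by rw [one_mul]; exact (hdG x hx hx1).1) hs
    · have hΓ := Real.Gamma_pos_of_pos (show 0 < 2 * (m : ℝ) + ν + 1 by linarith)
      have hκm : 0 < κ ^ (2 * m) := by rw [pow_mul]; positivity
      obtain ⟨g, ω, hg, hmom, hgω, hω, hωpos, hres⟩ := SIPSystem.exists_weight Ψ hS hZ
        (D := Metric.ball 0 1) measurableSet_ball (J := Set.Iio 1) (fun z => by simp)
        (fun x hx hx1 => (hsum x hx hx1).1)
        hd.toMellinPair one_pos (A := Real.Gamma (2 * m + ν + 1) / κ ^ (2 * m)) (by positivity)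
        (by linarith)
        (fun n => by
          change _ = ((‖K n‖ ^ 2 : ℝ) : ℂ)
          rw [hK]
          rw [show (n : ℂ) + m + 1 - m = ((n + 1 : ℝ) : ℂ) by push_cast; ring,
            show (n : ℂ) + m + 1 + m + ν = ((n + 2 * m + ν + 1 : ℝ) : ℂ) by push_cast; ring,
            show (n : ℂ) + m + 1 + ν = ((n + m + ν + 1 : ℝ) : ℂ) by push_cast; ring,
            show (n : ℂ) + m + 1 = ((n + m + 1 : ℝ) : ℂ) by push_cast; ring]
          simp only [Complex.Gamma_ofReal]
          rw [Complex.ofReal_one, one_pow, inv_one, mul_one]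
          push_cast
          ring)
        (fun x hx hx1 => hd.pos _ (by rw [one_mul]; exact ⟨hx, hx1⟩))
        (fun x hx => by rw [one_mul]; exact hd.zero x (not_lt.mp hx))
      simp only [one_mul] at hg hω
      refine ⟨g, ω, fun x hx hx1 => ?_, hmom, hgω, fun x hx hx1 => ?_, hωpos, hres⟩
      · rw [hg, (hdG x hx hx1).1, Complex.ofReal_mul]
      · rw [hω x hx hx1, (hdG x hx hx1.ne).2, Complex.ofReal_mul, Complex.ofReal_mul,
          (hsum x hx.le hx1).2 hx]
        push_cast
        have h1 : (κ : ℂ) ≠ 0 := by exact_mod_cast hκ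
        have h2 : (Real.Gamma (2 * m + ν + 1) : ℂ) ≠ 0 := by exact_mod_cast hΓ.ne'
        have h3 : (Real.pi : ℂ) ≠ 0 := by exact_mod_cast Real.pi_ne_zero
        simp only [G₁]
        field_simp
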